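/- **Lemma (computing the compressed kernel of a group relaxation).** A *group relaxation* of an integer linear program is given by data $(\mathbf A,\mathbf b,\mathbf c,\{r_i\}_{i=1}^m)$ with $\mathbf A\in\mathbb Z^{m\times d}$, $\mathbf b\in\mathbb Z^m$, $\mathbf c\in\mathbb Q_{\ge 0}^d$ and positive integers $r_1\mid r_2\mid\dots\mid r_m$, where no column of $\mathbf A$ lies in $R\mathbb Z^m$, $R=\mathrm{diag}(r_1,\dots,r_m)$; it stands for the problem $\min\{\mathbf c^\top\mathbf x:\mathbf x\in\mathbb Z_{\ge0}^d,\ \mathbf A\mathbf x=\mathbf b \pmod{R\mathbb Z^m}\}$. Let $s_j$ be the order of the $j$-th column of $\mathbf A$ in $\mathbb Z^m/R\mathbb Z^m$, and let $$K'=\Big\{\mathbf x\in\bigoplus_{j=1}^d\mathbb Z_{s_j} : \mathbf A\mathbf x=\mathbf 0 \pmod{R\mathbb Z^m}\Big\}$$ be the kernel of the homomorphism $\bigoplus_{j}\mathbb Z_{s_j}\to\mathbb Z^m/R\mathbb Z^m$ induced by $\mathbf A$. There is a classical (deterministic) algorithm, i.e. a single program for a random access machine with the logarithmic cost criterion, which,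 for all $m,d$ and all such data $(\mathbf A,\mathbf b,\mathbf c,\{r_i\})$ stored in its memory, halts and outputs cyclic generators $\widetilde h_1,\dots,\widetilde h_v$ of $K'$: they generate $K'$ and the sum of the cyclic subgroups $\langle\widetilde h_i\rangle$ is direct. In particular, $$K'\cong\mathbb Z_{|\langle\widetilde h_1\rangle|}\oplus\dots\oplus\mathbb Z_{|\langle\widetilde h_v\rangle|}.$$ The running time is bounded by a fixed polynomial in $m$, $d$, $\log(1+\|\mathbf A\|_\infty)$ and $\log(1+r_m)$, where $\|\mathbf A\|_\infty=\max_{i,j}|\mathbf A_{ij}|$; it does not depend on $\mathbf b$ and $\mathbf c$. -/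

import Mathlib

/-!
A random access machine with the logarithmic cost criterion, presented as a structured programming
language, followed by group relaxations of integer linear programs and their compressed kernels.
-/

namespace RAM

/-- The memory: integer registers, addressed by integers. -/
abbrev Mem : Type := ℤ → ℤ

/-- The bit length of an integer. -/
def len (a : ℤ) : ℕ := Nat.size a.natAbs

/-- Integer expressions. `load e` is the content of the register whose address is the value
of `e` (indirect addressing); `div` and `mod` are integer division and remainder. -/
inductive Expr : Type
  | const (a : ℤ)
  | load (e : Expr)
  | add (e f : Expr)
  | sub (e f : Expr)
  | mul (e f : Expr)
  | div (e f : Expr)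
  | mod (e f : Expr)

namespace Expr

/-- The value of an expression. -/
def eval (σ : Mem) : Expr → ℤ
  | const a => a
  | load e => σ (e.eval σ)
  | add e f => e.eval σ + f.eval σ
  | sub e f => e.eval σ - f.eval σ
  | mul e f => e.eval σ * f.eval σ
  | div e f => e.eval σ / f.eval σ
  | mod e f => e.eval σ % f.eval σ

/-- The time needed to evaluate an expression: each operation costs one plus the bit lengths of
its operands; a memory access costs one plus the bit lengths of the address and of the content. -/
def cost (σ : Mem) : Expr → ℕ
  | const a => 1 + len a
  | load e => e.cost σ + (1 + len (e.eval σ) + len (σ (e.eval σ)))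
  | add e f => e.cost σ + f.cost σ + (1 + len (e.eval σ) + len (f.eval σ))
  | sub e f => e.cost σ + f.cost σ + (1 + len (e.eval σ) + len (f.eval σ))
  | mul e f => e.cost σ + f.cost σ + (1 + len (e.eval σ) + len (f.eval σ))
  | div e f => e.cost σ + f.cost σ + (1 + len (e.eval σ) + len (f.eval σ))
  | mod e f => e.cost σ + f.cost σ + (1 + len (e.eval σ) + len (f.eval σ))

end Expr

/-- Programs. `store e f` writes the value of `f` into the register whose address is the value
of `e`; the tests of `ite` and `loop` ask whether the value of an expression is positive. -/
inductive Prog : Type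
  | skip
  | store (e f : Expr)
  | seq (p q : Prog)
  | ite (e : Expr) (p q : Prog)
  | loop (e : Expr) (p : Prog)

/-- `Exec p σ t τ`: started with memory `σ`, the program `p` halts after time exactly `t`
(logarithmic cost) with memory `τ`. -/
inductive Exec : Prog → Mem → ℕ → Mem → Prop
  | skip (σ : Mem) : Exec Prog.skip σ 1 σ
  | store (e f : Expr) (σ : Mem) :
      Exec (Prog.store e f) σ
        (e.cost σ + f.cost σ + (1 + len (e.eval σ) + len (f.eval σ)))
        (Function.update σ (e.eval σ) (f.eval σ))
  | seq {p q : Prog} {σ τ ρ : Mem} {t u : ℕ} :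
      Exec p σ t τ → Exec q τ u ρ → Exec (Prog.seq p q) σ (t + u) ρ
  | ite_pos {e : Expr} {p q : Prog} {σ τ : Mem} {t : ℕ} :
      0 < e.eval σ → Exec p σ t τ →
      Exec (Prog.ite e p q) σ (e.cost σ + (1 + len (e.eval σ)) + t) τ
  | ite_neg {e : Expr} {p q : Prog} {σ τ : Mem} {t : ℕ} :
      ¬ 0 < e.eval σ → Exec q σ t τ →
      Exec (Prog.ite e p q) σ (e.cost σ + (1 + len (e.eval σ)) + t) τ
  | loop_pos {e : Expr} {p : Prog} {σ τ ρ : Mem} {t u : ℕ} :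
      0 < e.eval σ → Exec p σ t τ → Exec (Prog.loop e p) τ u ρ →
      Exec (Prog.loop e p) σ (e.cost σ + (1 + len (e.eval σ)) + t + u) ρ
  | loop_neg {e : Expr} {p : Prog} {σ : Mem} :
      ¬ 0 < e.eval σ → Exec (Prog.loop e p) σ (e.cost σ + (1 + len (e.eval σ))) σ

/-- The machine is deterministic: running time and final memory are functions of the program and
the initial memory. -/
theorem Exec.deterministic {p : Prog} {σ τ τ' : Mem} {t t' : ℕ}
    (h : Exec p σ t τ) (h' : Exec p σ t' τ') : t = t' ∧ τ = τ' := by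
  induction h generalizing t' τ' with
  | skip σ => cases h'; exact ⟨rfl, rfl⟩
  | store e f σ => cases h'; exact ⟨rfl, rfl⟩
  | seq _ _ ih₁ ih₂ =>
    cases h' with
    | seq a b =>
      obtain ⟨rfl, rfl⟩ := ih₁ a
      obtain ⟨rfl, rfl⟩ := ih₂ b
      exact ⟨rfl, rfl⟩
  | ite_pos hc _ ih =>
    cases h' with
    | ite_pos _ a => obtain ⟨rfl, rfl⟩ := ih a; exact ⟨rfl, rfl⟩
    | ite_neg hn _ => exact absurd hc hn
  | ite_neg hc _ ih =>
    cases h' with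
    | ite_pos hn _ => exact absurd hn hc
    | ite_neg _ a => obtain ⟨rfl, rfl⟩ := ih a; exact ⟨rfl, rfl⟩
  | loop_pos hc _ _ ih₁ ih₂ =>
    cases h' with
    | loop_pos _ a b =>
      obtain ⟨rfl, rfl⟩ := ih₁ a
      obtain ⟨rfl, rfl⟩ := ih₂ b
      exact ⟨rfl, rfl⟩
    | loop_neg hn => exact absurd hc hn
  | loop_neg hc =>
    cases h' with
    | loop_pos hn _ _ => exact absurd hn hc
    | loop_neg _ => exact ⟨rfl, rfl⟩

/-- The memory that holds the list `l` in the registers `0, 1, 2, …` and `0` elsewhere. -/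
def memOfList (l : List ℤ) : Mem := fun a => if 0 ≤ a then l.getD a.toNat 0 else 0

end RAM

/-- The lattice `R ℤ^m`, where `R = diag(r₁, …, r_m)`. -/
def diagLattice {m : ℕ} (r : Fin m → ℕ) : AddSubgroup (Fin m → ℤ) :=
  (Matrix.mulVecLin (Matrix.diagonal fun i => (r i : ℤ))).range.toAddSubgroup

/-- The data `(A, b, c, r)` of the group relaxation
`min {cᵀ x : x ∈ ℤ^d, x ≥ 0, A x = b (mod R ℤ^m)}`, `R = diag(r₁, …, r_m)`, of an integer linear
program: `r₁ ∣ r₂ ∣ ⋯ ∣ r_m` are positive, the reduced costs `c` are nonnegative, and columns that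
lie in `R ℤ^m` have been dropped. -/
structure GroupRelaxation (m d : ℕ) where
  A : Matrix (Fin m) (Fin d) ℤ
  b : Fin m → ℤ
  c : Fin d → ℚ
  r : Fin m → ℕ
  r_pos : ∀ i, 0 < r i
  r_dvd : ∀ i j, i ≤ j → r i ∣ r j
  c_nonneg : ∀ j, 0 ≤ c j
  col_notMem : ∀ j, (fun i => A i j) ∉ diagLattice r

namespace GroupRelaxation

variable {m d : ℕ} (P : GroupRelaxation m d)

/-- The finite abelian group `ℤ^m / R ℤ^m`. -/
abbrev Target : Type := (Fin m → ℤ) ⧸ diagLattice P.r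

/-- The `j`-th column of `A` modulo `R ℤ^m`. -/
def col (j : Fin d) : P.Target := QuotientAddGroup.mk fun i => P.A i j

/-- `s_j`, the order of the `j`-th column of `A` modulo `R ℤ^m`. -/
noncomputable def s (j : Fin d) : ℕ := addOrderOf (P.col j)

theorem s_zsmul_col (j : Fin d) : zmultiplesHom P.Target (P.col j) (P.s j : ℤ) = 0 := by
  rw [zmultiplesHom_apply, natCast_zsmul]
  exact addOrderOf_nsmul_eq_zero (P.col j)

/-- The compressed ambient group `⨁_j ℤ / s_j ℤ`. -/
abbrev Ambient : Type := ∀ j : Fin d, ZMod (P.s j)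

/-- The homomorphism `x ↦ A x (mod R ℤ^m)` from `⨁_j ℤ / s_j ℤ` to `ℤ^m / R ℤ^m`. -/
noncomputable def constraintHom : P.Ambient →+ P.Target :=
  ∑ j : Fin d,
    (ZMod.lift (P.s j) ⟨zmultiplesHom P.Target (P.col j), P.s_zsmul_col j⟩).comp
      (Pi.evalAddMonoidHom _ j)

/-- The compressed kernel: the kernel of `A` in `⨁_j ℤ / s_j ℤ`. -/
noncomputable def compressedKernel : AddSubgroup P.Ambient := P.constraintHom.ker

/-- `‖A‖_∞`, the largest absolute value of an entry of `A`. -/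
def supNorm : ℕ :=
  Finset.univ.sup fun i : Fin m => Finset.univ.sup fun j : Fin d => (P.A i j).natAbs

/-- The largest modulus, that is, `r_m` (and `0` if `m = 0`). -/
def maxModulus : ℕ := Finset.univ.sup P.r

/-- The data as a list of integers: `m`, `d`, then `r`, then `A` row by row, then `b`, then the
numerators and denominators of `c`. -/
def data : List ℤ :=
  [(m : ℤ), (d : ℤ)] ++ List.ofFn (fun i => (P.r i : ℤ)) ++
    (List.finRange m).flatMap (fun i => List.ofFn (P.A i)) ++
    List.ofFn P.b ++
    (List.finRange d).flatMap (fun j => [(P.c j).num, ((P.c j).den : ℤ)])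

/-- The memory `τ` holds the list `h₁, …, h_v` of elements of `⨁_j ℤ / s_j ℤ`: first `v`, then one
vector after the other, each residue class being represented by its element in `[0, s_j)`. -/
def Holds (τ : RAM.Mem) {v : ℕ} (h : Fin v → P.Ambient) : Prop :=
  τ 0 = (v : ℤ) ∧
    ∀ (i : Fin v) (j : Fin d),
      τ (1 + (i : ℤ) * (d : ℤ) + (j : ℤ)) = ((h i j).val : ℤ)

end GroupRelaxation

/-- `h₁, …, h_v` are cyclic generators of the subgroup `K`: they generate `K`, and the sum of the
cyclic groups `⟨h_i⟩` is direct. -/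
def IsCyclicGenerators {G : Type*} [AddCommGroup G] (K : AddSubgroup G) {v : ℕ} (h : Fin v → G) :
    Prop :=
  AddSubgroup.closure (Set.range h) = K ∧ iSupIndep fun i => AddSubgroup.zmultiples (h i)

/-! The proof exhibits one explicit program and shows that it is correct and fast. Write N = r_m.
The orders come from s_j = N / gcd(N, (N/r_i) A_ij : i), because r_i ∣ n A_ij exactly when N ∣ n
(N/r_i) A_ij (`ediv_eq_s`).

Generators of K' are found by imposing the m constraints one at a time. The unit vectors generate
the ambient group. If h_1, …, h_d generate the solutions of the first i constraints and a_x is an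
integer representing the value of the next constraint at h_x, Euclidean row operations turn the rows
(a_x, h_x) and the extra row (r_i, 0) into rows (0, h'_x) and one row (g, z) with g ≠ 0. The h'_x
then generate the solutions of the first i + 1 constraints (`closure_eq_partialKernel_succ`), and
there are still only d of them.

To make the generators independent, the ambient group is embedded into (ℤ/N)^d by x_j ↦ (N/s_j) x_j,
and the square matrix of the images of the generators is diagonalized. Row operations change the
generators but not the subgroup they generate. Column operations change the coordinate homomorphisms
E_j but keep them jointly injective. This is the invariant `Stage`. Once E_j(h_i) = 0 for all i ≠ j,
joint injectivity makes the sum of the cyclic groups direct (`iSupIndep_zmultiples_of_diagonal`,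
`sumLift_injective_of_diagonal`). No divisibility between diagonal entries is needed, and some
generators may be zero.

For the running time, entries are reduced modulo s_j or N, except in columns where plain Euclid acts
on integers and cannot enlarge them. Hence every loaded number has bit length at most some X linear
in the size parameters. Every loop makes at most 2X + 2 passes: counting loops run to at most X, a
Euclidean pass shortens one of two numbers after at most one exchange, and each further round of
clearing a row and a column halves the pivot or finishes. For a fixed program these two facts bound
the time by a polynomial in X read off from its syntax (`Prog.polyBounded_timeBound`). The
Hoare-style predicate `Spec` carries correctness and this bound together. -/

namespace RAM

/-! ### Bit lengths, costs and polynomial time bounds. -/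

namespace Expr

/-- A bound for the bit length of the value of an expression all of whose loads have bit length
at most `X`. -/
def lenBound (X : ℕ) : Expr → ℕ
  | const a => len a
  | load _ => X
  | add e f => e.lenBound X + f.lenBound X + 1
  | sub e f => e.lenBound X + f.lenBound X + 1
  | mul e f => e.lenBound X + f.lenBound X + 1
  | div e f => e.lenBound X + f.lenBound X + 1
  | mod e f => e.lenBound X + f.lenBound X + 1

/-- A bound for the cost of an expression all of whose loads have bit length at most `X`. -/
def timeBound (X : ℕ) : Expr → ℕ
  | const a => 1 + len a
  | load e => e.timeBound X + (1 + e.lenBound X + X)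
  | add e f => e.timeBound X + f.timeBound X + (1 + e.lenBound X + f.lenBound X)
  | sub e f => e.timeBound X + f.timeBound X + (1 + e.lenBound X + f.lenBound X)
  | mul e f => e.timeBound X + f.timeBound X + (1 + e.lenBound X + f.lenBound X)
  | div e f => e.timeBound X + f.timeBound X + (1 + e.lenBound X + f.lenBound X)
  | mod e f => e.timeBound X + f.timeBound X + (1 + e.lenBound X + f.lenBound X)

/-- All values loaded during the evaluation of an expression have bit length at most `X`. -/
def LoadsLE (X : ℕ) (σ : Mem) : Expr → Prop
  | const _ => True
  | load e => e.LoadsLE X σ ∧ len (σ (e.eval σ)) ≤ X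
  | add e f => e.LoadsLE X σ ∧ f.LoadsLE X σ
  | sub e f => e.LoadsLE X σ ∧ f.LoadsLE X σ
  | mul e f => e.LoadsLE X σ ∧ f.LoadsLE X σ
  | div e f => e.LoadsLE X σ ∧ f.LoadsLE X σ
  | mod e f => e.LoadsLE X σ ∧ f.LoadsLE X σ

end Expr

theorem len_le_iff {a : ℤ} {n : ℕ} : len a ≤ n ↔ |a| < 2 ^ n := by
  rw [len, Nat.size_le, Int.abs_eq_natAbs]
  exact_mod_cast Iff.rfl

theorem abs_lt_two_pow_len (a : ℤ) : |a| < 2 ^ len a := len_le_iff.1 le_rfl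

theorem len_le_of_abs_le {a b : ℤ} (h : |a| ≤ |b|) : len a ≤ len b :=
  len_le_iff.2 (h.trans_lt (abs_lt_two_pow_len b))

theorem len_le_of_nonneg_of_le {a b : ℤ} (ha : 0 ≤ a) (h : a ≤ b) : len a ≤ len b :=
  len_le_of_abs_le (by rwa [abs_of_nonneg ha, abs_of_nonneg (ha.trans h)])

theorem len_le_self {a : ℤ} {n : ℕ} (ha : 0 ≤ a) (h : a ≤ n) : len a ≤ n := by
  rw [len_le_iff, abs_of_nonneg ha]
  exact h.trans_lt (by exact_mod_cast n.lt_two_pow_self)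

theorem len_add_le (a b : ℤ) : len (a + b) ≤ len a + len b + 1 := by
  rw [len_le_iff]
  have h₁ := abs_lt_two_pow_len a
  have h₂ := abs_lt_two_pow_len b
  have h₃ : (2 : ℤ) ^ len a ≤ 2 ^ (len a + len b) := pow_le_pow_right₀ (by norm_num) (by omega)
  have h₄ : (2 : ℤ) ^ len b ≤ 2 ^ (len a + len b) := pow_le_pow_right₀ (by norm_num) (by omega)
  rw [pow_succ]
  have := abs_add_le a b
  linarith

theorem len_neg (a : ℤ) : len (-a) = len a := by simp [len]

theorem len_sub_le (a b : ℤ) : len (a - b) ≤ len a + len b + 1 := by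
  have := len_add_le a (-b)
  rwa [len_neg, ← sub_eq_add_neg] at this

theorem len_mul_le (a b : ℤ) : len (a * b) ≤ len a + len b + 1 := by
  refine le_trans ?_ (Nat.le_succ _)
  rw [len_le_iff, abs_mul, pow_add]
  exact mul_lt_mul'' (abs_lt_two_pow_len a) (abs_lt_two_pow_len b) (abs_nonneg _) (abs_nonneg _)

theorem len_div_le (a b : ℤ) : len (a / b) ≤ len a + len b + 1 := by
  refine le_trans (len_le_of_abs_le ?_) (by omega : len a ≤ _)
  rw [Int.abs_eq_natAbs, Int.abs_eq_natAbs]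
  exact_mod_cast Int.natAbs_ediv_le_natAbs a b

theorem len_mod_le (a b : ℤ) : len (a % b) ≤ len a + len b + 1 := by
  rcases eq_or_ne b 0 with rfl | hb
  · rw [Int.emod_zero]; omega
  · refine le_trans (len_le_of_abs_le ?_) (by omega : len b ≤ _)
    rw [abs_of_nonneg (Int.emod_nonneg a hb)]
    exact (Int.emod_lt_abs a hb).le

namespace Expr

theorem len_eval_le {X : ℕ} {σ : Mem} {e : Expr} (h : e.LoadsLE X σ) :
    len (e.eval σ) ≤ e.lenBound X := by
  induction e with
  | const a => exact le_rfl
  | load e _ => exact h.2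
  | add e f he hf =>
    exact (len_add_le _ _).trans
      (by have := he h.1; have := hf h.2; simp only [lenBound]; omega)
  | sub e f he hf =>
    exact (len_sub_le _ _).trans
      (by have := he h.1; have := hf h.2; simp only [lenBound]; omega)
  | mul e f he hf =>
    exact (len_mul_le _ _).trans
      (by have := he h.1; have := hf h.2; simp only [lenBound]; omega)
  | div e f he hf =>
    exact (len_div_le _ _).trans
      (by have := he h.1; have := hf h.2; simp only [lenBound]; omega)
  | mod e f he hf =>
    exact (len_mod_le _ _).trans
      (by have := he h.1; have := hf h.2; simp only [lenBound]; omega)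

theorem cost_le {X : ℕ} {σ : Mem} {e : Expr} (h : e.LoadsLE X σ) :
    e.cost σ ≤ e.timeBound X := by
  induction e with
  | const a => exact le_rfl
  | load e he =>
    have := he h.1; have := len_eval_le h.1; have := h.2
    simp only [cost, timeBound]; omega
  | add e f he hf | sub e f he hf | mul e f he hf | div e f he hf | mod e f he hf =>
    have := he h.1; have := hf h.2; have := len_eval_le h.1; have := len_eval_le h.2
    simp only [cost, timeBound]; omega

end Expr

/-- A bound for the running time of a program in which all loads have bit length at most `X` and
each loop is run at most `2 * X + 2` times. -/
def Prog.timeBound (X : ℕ) : Prog → ℕ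
  | .skip => 1
  | .store e f => e.timeBound X + f.timeBound X + (1 + e.lenBound X + f.lenBound X)
  | .seq p q => p.timeBound X + q.timeBound X
  | .ite e p q => e.timeBound X + (1 + e.lenBound X) + (p.timeBound X + q.timeBound X)
  | .loop e p => (2 * X + 3) * (e.timeBound X + (1 + e.lenBound X) + p.timeBound X)

/-- Functions bounded by a polynomial. -/
def PolyBounded (f : ℕ → ℕ) : Prop := ∃ C k : ℕ, ∀ X, f X ≤ C * (X + 1) ^ k

namespace PolyBounded

variable {f g : ℕ → ℕ}

theorem const (a : ℕ) : PolyBounded fun _ => a := ⟨a, 0, fun X => by simp⟩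

theorem id : PolyBounded fun X => X := ⟨1, 1, fun X => by simp⟩

theorem add (hf : PolyBounded f) (hg : PolyBounded g) : PolyBounded fun X => f X + g X := by
  obtain ⟨C, k, hf⟩ := hf
  obtain ⟨C', k', hg⟩ := hg
  refine ⟨C + C', k + k', fun X => ?_⟩
  have h₁ : (X + 1) ^ k ≤ (X + 1) ^ (k + k') := Nat.pow_le_pow_right (by omega) (by omega)
  have h₂ : (X + 1) ^ k' ≤ (X + 1) ^ (k + k') := Nat.pow_le_pow_right (by omega) (by omega)
  calc f X + g X ≤ C * (X + 1) ^ k + C' * (X + 1) ^ k' := add_le_add (hf X) (hg X)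
    _ ≤ C * (X + 1) ^ (k + k') + C' * (X + 1) ^ (k + k') := by gcongr
    _ = _ := by ring

theorem mul (hf : PolyBounded f) (hg : PolyBounded g) : PolyBounded fun X => f X * g X := by
  obtain ⟨C, k, hf⟩ := hf
  obtain ⟨C', k', hg⟩ := hg
  refine ⟨C * C', k + k', fun X => ?_⟩
  calc f X * g X ≤ C * (X + 1) ^ k * (C' * (X + 1) ^ k') := Nat.mul_le_mul (hf X) (hg X)
    _ = _ := by ring

end PolyBounded

theorem Expr.polyBounded_lenBound (e : Expr) : PolyBounded fun X => e.lenBound X := by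
  induction e with
  | const a => exact .const _
  | load e _ => exact .id
  | add e f he hf | sub e f he hf | mul e f he hf | div e f he hf | mod e f he hf =>
    exact (he.add hf).add (.const 1)

theorem Expr.polyBounded_timeBound (e : Expr) : PolyBounded fun X => e.timeBound X := by
  induction e with
  | const a => exact .const _
  | load e he => exact he.add (((PolyBounded.const 1).add e.polyBounded_lenBound).add .id)
  | add e f he hf | sub e f he hf | mul e f he hf | div e f he hf | mod e f he hf =>
    exact (he.add hf).add
      (((PolyBounded.const 1).add e.polyBounded_lenBound).add f.polyBounded_lenBound)

theorem Prog.polyBounded_timeBound (p : Prog) : PolyBounded fun X => p.timeBound X := by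
  induction p with
  | skip => exact .const _
  | store e f =>
    exact (e.polyBounded_timeBound.add f.polyBounded_timeBound).add
      (((PolyBounded.const 1).add e.polyBounded_lenBound).add f.polyBounded_lenBound)
  | seq p q hp hq => exact hp.add hq
  | ite e p q hp hq =>
    exact (e.polyBounded_timeBound.add ((PolyBounded.const 1).add e.polyBounded_lenBound)).add
      (hp.add hq)
  | loop e p hp =>
    exact (((PolyBounded.const 2).mul .id).add (.const 3)).mul
      ((e.polyBounded_timeBound.add ((PolyBounded.const 1).add e.polyBounded_lenBound)).add hp)

/-! ### A workspace in the negative registers -/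

/-- The address of entry `(i, j)` of the `t`-th array of the workspace. -/
def cell (t : Fin 4) (i j : ℤ) : ℤ :=
  -((t.val : ℤ) + 1) - 4 * ((i * (2 * i + 1) + j * (2 * j + 1)) * (i * (2 * i + 1) + j * (2 * j + 1))
    + j * (2 * j + 1))

theorem mul_two_mul_add_one_nonneg (i : ℤ) : 0 ≤ i * (2 * i + 1) := by
  rcases le_or_gt 0 i with h | h
  · positivity
  · exact mul_nonneg_of_nonpos_of_nonpos h.le (by omega)

/-- The difference of the two sides is (i - j)(2(i + j) + 1), whose second factor is odd. So i ↦
i(2i + 1) injects ℤ into the nonnegative integers using machine operations only. -/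
theorem mul_two_mul_add_one_inj {i j : ℤ} (h : i * (2 * i + 1) = j * (2 * j + 1)) : i = j := by
  have : (i - j) * (2 * (i + j) + 1) = 0 := by linear_combination h
  rcases mul_eq_zero.1 this with h | h <;> omega

theorem cell_neg (t : Fin 4) (i j : ℤ) : cell t i j < 0 := by
  have := mul_two_mul_add_one_nonneg i
  have := mul_two_mul_add_one_nonneg j
  have : 0 ≤ (i * (2 * i + 1) + j * (2 * j + 1)) * (i * (2 * i + 1) + j * (2 * j + 1)) := by
    positivity
  unfold cell
  omega

/-- The residue modulo 4 reveals the tag. For u, v ≥ 0 the number (u + v)² + v lies between (u + v)²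
and (u + v + 1)², so it determines u + v and then v. -/
theorem cell_inj {t t' : Fin 4} {i j i' j' : ℤ} :
    cell t i j = cell t' i' j' ↔ t = t' ∧ i = i' ∧ j = j' := by
  refine ⟨fun h => ?_, by rintro ⟨rfl, rfl, rfl⟩; rfl⟩
  unfold cell at h
  have hu := mul_two_mul_add_one_nonneg i
  have hv := mul_two_mul_add_one_nonneg j
  have hu' := mul_two_mul_add_one_nonneg i'
  have hv' := mul_two_mul_add_one_nonneg j'
  have aux : ∀ a b : ℤ, a = b → i * (2 * i + 1) = a → i' * (2 * i' + 1) = b → i = i' :=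
    fun a b hab h₁ h₂ => mul_two_mul_add_one_inj (h₁.trans (hab.trans h₂.symm))
  have aux' : ∀ a b : ℤ, a = b → j * (2 * j + 1) = a → j' * (2 * j' + 1) = b → j = j' :=
    fun a b hab h₁ h₂ => mul_two_mul_add_one_inj (h₁.trans (hab.trans h₂.symm))
  generalize i * (2 * i + 1) = u at *
  generalize j * (2 * j + 1) = v at *
  generalize i' * (2 * i' + 1) = u' at *
  generalize j' * (2 * j' + 1) = v' at *
  have ht := t.isLt
  have ht' := t'.isLt
  have htt : t = t' := Fin.ext (by omega)
  subst htt
  have key : (u + v) * (u + v) + v = (u' + v') * (u' + v') + v' := by omega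
  have hs : u + v = u' + v' := by
    rcases lt_trichotomy (u + v) (u' + v') with h | h | h
    · nlinarith
    · exact h
    · nlinarith
  rw [hs] at key
  have hvv : v = v' := by omega
  exact ⟨rfl, aux _ _ (by omega) rfl rfl, aux' _ _ hvv rfl rfl⟩

/-- The state of the machine: scalar variables, a matrix, a vector, and the registers with
nonnegative address. -/
structure St where
  v : ℕ → ℤ
  M : ℤ → ℤ → ℤ
  Q : ℤ → ℤ
  D : ℤ → ℤ

/-- Terms over the workspace. -/
inductive Tm : Type
  | const (a : ℤ)
  | var (x : ℕ)
  | mat (e f : Tm)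
  | vec (e : Tm)
  | add (e f : Tm)
  | sub (e f : Tm)
  | mul (e f : Tm)
  | div (e f : Tm)
  | mod (e f : Tm)

namespace Tm

instance (n : ℕ) : OfNat Tm n := ⟨.const n⟩
instance : Add Tm := ⟨.add⟩
instance : Sub Tm := ⟨.sub⟩
instance : Mul Tm := ⟨.mul⟩
instance : Div Tm := ⟨.div⟩
instance : Mod Tm := ⟨.mod⟩

/-- The value of a term. -/
def eval (s : St) : Tm → ℤ
  | const a => a
  | var x => s.v x
  | mat e f => s.M (e.eval s) (f.eval s)
  | vec e => s.Q (e.eval s)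
  | add e f => e.eval s + f.eval s
  | sub e f => e.eval s - f.eval s
  | mul e f => e.eval s * f.eval s
  | div e f => e.eval s / f.eval s
  | mod e f => e.eval s % f.eval s

section
variable (s : St) (e f : Tm)
@[simp] theorem eval_zero : (0 : Tm).eval s = 0 := rfl
@[simp] theorem eval_one : (1 : Tm).eval s = 1 := rfl
@[simp] theorem eval_two : (2 : Tm).eval s = 2 := rfl
@[simp] theorem eval_var (x : ℕ) : (var x).eval s = s.v x := rfl
@[simp] theorem eval_mat : (mat e f).eval s = s.M (e.eval s) (f.eval s) := rfl
@[simp] theorem eval_vec : (vec e).eval s = s.Q (e.eval s) := rfl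
@[simp] theorem eval_add : (e + f).eval s = e.eval s + f.eval s := rfl
@[simp] theorem eval_sub : (e - f).eval s = e.eval s - f.eval s := rfl
@[simp] theorem eval_mul : (e * f).eval s = e.eval s * f.eval s := rfl
@[simp] theorem eval_div : (e / f).eval s = e.eval s / f.eval s := rfl
@[simp] theorem eval_mod : (e % f).eval s = e.eval s % f.eval s := rfl
end

end Tm

/-- The expression for the address `cell t i j`. -/
def cellExpr (t : Fin 4) (i j : Expr) : Expr :=
  let g (e : Expr) : Expr := .mul e (.add (.mul (.const 2) e) (.const 1))
  .sub (.const (-((t.val : ℤ) + 1)))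
    (.mul (.const 4) (.add (.mul (.add (g i) (g j)) (.add (g i) (g j))) (g j)))

theorem eval_cellExpr (σ : Mem) (t : Fin 4) (i j : Expr) :
    (cellExpr t i j).eval σ = cell t (i.eval σ) (j.eval σ) := rfl

theorem loadsLE_cellExpr {X : ℕ} {σ : Mem} {t : Fin 4} {i j : Expr}
    (hi : i.LoadsLE X σ) (hj : j.LoadsLE X σ) : (cellExpr t i j).LoadsLE X σ := by
  simp [cellExpr, Expr.LoadsLE, hi, hj]

/-- The address expression of a matrix entry; the flag says whether the matrix is stored
transposed. -/
def matExpr (tr : Bool) (i j : Expr) : Expr := if tr then cellExpr 1 j i else cellExpr 1 i j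

/-- The address of a matrix entry. -/
def matCell (tr : Bool) (i j : ℤ) : ℤ := if tr then cell 1 j i else cell 1 i j

theorem eval_matExpr (σ : Mem) (tr : Bool) (i j : Expr) :
    (matExpr tr i j).eval σ = matCell tr (i.eval σ) (j.eval σ) := by
  cases tr <;> rfl

theorem loadsLE_matExpr {X : ℕ} {σ : Mem} {tr : Bool} {i j : Expr}
    (hi : i.LoadsLE X σ) (hj : j.LoadsLE X σ) : (matExpr tr i j).LoadsLE X σ := by
  cases tr
  · exact loadsLE_cellExpr hi hj
  · exact loadsLE_cellExpr hj hi

theorem matCell_neg (tr : Bool) (i j : ℤ) : matCell tr i j < 0 := by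
  cases tr <;> exact cell_neg _ _ _

theorem matCell_inj {tr : Bool} {i j i' j' : ℤ} :
    matCell tr i j = matCell tr i' j' ↔ i = i' ∧ j = j' := by
  cases tr <;> simp [matCell, cell_inj, and_comm]

/-- Compilation of terms to expressions. -/
def Tm.compile (tr : Bool) : Tm → Expr
  | const a => .const a
  | var x => .load (.const (cell 0 x 0))
  | mat e f => .load (matExpr tr (e.compile tr) (f.compile tr))
  | vec e => .load (cellExpr 2 (e.compile tr) (.const 0))
  | add e f => .add (e.compile tr) (f.compile tr)
  | sub e f => .sub (e.compile tr) (f.compile tr)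
  | mul e f => .mul (e.compile tr) (f.compile tr)
  | div e f => .div (e.compile tr) (f.compile tr)
  | mod e f => .mod (e.compile tr) (f.compile tr)

/-- The memory `σ` represents the state `s`, and all numbers in the workspace have bit length at
most `X`. -/
structure Represents (tr : Bool) (X : ℕ) (σ : Mem) (s : St) : Prop where
  v : ∀ x : ℕ, σ (cell 0 x 0) = s.v x
  M : ∀ i j, σ (matCell tr i j) = s.M i j
  Q : ∀ i, σ (cell 2 i 0) = s.Q i
  D : ∀ a, 0 ≤ a → σ a = s.D a
  len_le : ∀ a < 0, len (σ a) ≤ X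

variable {tr : Bool} {X : ℕ} {σ : Mem} {s : St}

theorem Represents.eval (h : Represents tr X σ s) (e : Tm) :
    (e.compile tr).eval σ = e.eval s := by
  induction e with
  | const a => rfl
  | var x => exact h.v x
  | mat e f he hf => simp only [Tm.compile, Expr.eval, eval_matExpr, he, hf, h.M, Tm.eval]
  | vec e he => simp only [Tm.compile, Expr.eval, eval_cellExpr, he, h.Q, Tm.eval]
  | add e f he hf | sub e f he hf | mul e f he hf | div e f he hf | mod e f he hf =>
    simp only [Tm.compile, Expr.eval, he, hf, Tm.eval]

theorem Represents.loadsLE (h : Represents tr X σ s) (e : Tm) :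
    (e.compile tr).LoadsLE X σ := by
  induction e with
  | const a => trivial
  | var x => exact ⟨trivial, h.len_le _ (cell_neg _ _ _)⟩
  | mat e f he hf =>
    refine ⟨loadsLE_matExpr he hf, h.len_le _ ?_⟩
    rw [eval_matExpr]; exact matCell_neg _ _ _
  | vec e he => exact ⟨loadsLE_cellExpr he trivial, h.len_le _ (cell_neg _ _ _)⟩
  | add e f he hf | sub e f he hf | mul e f he hf | div e f he hf | mod e f he hf => exact ⟨he, hf⟩

/-- The same memory read with the other flag shows the transposed matrix. Column operations are
therefore row operations compiled with the flag reversed. -/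
theorem Represents.transpose (h : Represents tr X σ s) :
    Represents (!tr) X σ { s with M := fun i j => s.M j i } :=
  ⟨h.v, fun i j => by rw [← h.M j i]; cases tr <;> rfl, h.Q, h.D, h.len_le⟩

/-- All numbers of the state's workspace have bit length at most `X`. -/
structure St.LenLE (X : ℕ) (s : St) : Prop where
  v : ∀ x, len (s.v x) ≤ X
  M : ∀ i j, len (s.M i j) ≤ X
  Q : ∀ i, len (s.Q i) ≤ X

theorem Represents.lenLE (h : Represents tr X σ s) : s.LenLE X :=
  ⟨fun x => h.v x ▸ h.len_le _ (cell_neg _ _ _), fun i j => h.M i j ▸ h.len_le _ (matCell_neg _ _ _),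
    fun i => h.Q i ▸ h.len_le _ (cell_neg _ _ _)⟩

theorem len_update_le {a y : ℤ} (h : ∀ a < 0, len (σ a) ≤ X) (hy : len y ≤ X) :
    ∀ b < 0, len (Function.update σ a y b) ≤ X := by
  intro b hb
  by_cases hab : b = a
  · subst hab; simpa using hy
  · simpa [hab] using h b hb

/-- Update of a matrix entry. -/
def updateMat (M : ℤ → ℤ → ℤ) (i j y : ℤ) : ℤ → ℤ → ℤ :=
  fun a b => if a = i ∧ b = j then y else M a b

theorem Represents.update_var (h : Represents tr X σ s) (x : ℕ) {y : ℤ} (hy : len y ≤ X) :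
    Represents tr X (Function.update σ (cell 0 x 0) y)
      { s with v := Function.update s.v x y } where
  v x' := by simp [Function.update_apply, cell_inj, h.v]
  M i j := by
    rw [Function.update_of_ne, h.M]
    cases tr <;> simp [matCell, cell_inj]
  Q i := by
    rw [Function.update_of_ne, h.Q]
    simp [cell_inj]
  D a ha := by
    rw [Function.update_of_ne, h.D a ha]
    have := cell_neg 0 x 0
    omega
  len_le := len_update_le h.len_le hy

theorem Represents.update_mat (h : Represents tr X σ s) (i j : ℤ) {y : ℤ} (hy : len y ≤ X) :
    Represents tr X (Function.update σ (matCell tr i j) y)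
      { s with M := updateMat s.M i j y } where
  v x' := by
    rw [Function.update_of_ne, h.v]
    cases tr <;> simp [matCell, cell_inj]
  M i j := by
    simp [Function.update_apply, matCell_inj, h.M, updateMat]
  Q i := by
    rw [Function.update_of_ne, h.Q]
    cases tr <;> simp [matCell, cell_inj]
  D a ha := by
    rw [Function.update_of_ne, h.D a ha]
    have := matCell_neg tr i j
    omega
  len_le := len_update_le h.len_le hy

theorem Represents.update_vec (h : Represents tr X σ s) (i : ℤ) {y : ℤ} (hy : len y ≤ X) :
    Represents tr X (Function.update σ (cell 2 i 0) y)
      { s with Q := Function.update s.Q i y } where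
  v x' := by
    rw [Function.update_of_ne, h.v]
    simp [cell_inj]
  M i j := by
    rw [Function.update_of_ne, h.M]
    cases tr <;> simp [matCell, cell_inj]
  Q i := by
    simp [Function.update_apply, cell_inj, h.Q]
  D a ha := by
    rw [Function.update_of_ne, h.D a ha]
    have := cell_neg 2 i 0
    omega
  len_le := len_update_le h.len_le hy

theorem Represents.update_data (h : Represents tr X σ s) {a : ℤ} (ha : 0 ≤ a) (y : ℤ) :
    Represents tr X (Function.update σ a y) { s with D := Function.update s.D a y } where
  v x' := by
    rw [Function.update_of_ne, h.v]
    have := cell_neg 0 x' 0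
    omega
  M i j := by
    rw [Function.update_of_ne, h.M]
    have := matCell_neg tr i j
    omega
  Q i := by
    rw [Function.update_of_ne, h.Q]
    have := cell_neg 2 i 0
    omega
  D b hb := by simp [Function.update_apply, h.D b hb]
  len_le b hb := by
    rw [Function.update_of_ne (by omega)]
    exact h.len_le b hb

/-! ### Commands and their specifications -/

/-- Assignment to a scalar variable. -/
def setVar (tr : Bool) (x : ℕ) (e : Tm) : Prog := .store (.const (cell 0 x 0)) (e.compile tr)

/-- Assignment to a matrix entry. -/
def setMat (tr : Bool) (i j e : Tm) : Prog :=
  .store (matExpr tr (i.compile tr) (j.compile tr)) (e.compile tr)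

/-- Assignment to a vector entry. -/
def setVec (tr : Bool) (i e : Tm) : Prog :=
  .store (cellExpr 2 (i.compile tr) (.const 0)) (e.compile tr)

/-- Reading a register with nonnegative address into a scalar variable. -/
def getData (tr : Bool) (x : ℕ) (e : Tm) : Prog :=
  .store (.const (cell 0 x 0)) (.load (e.compile tr))

/-- Writing a register with nonnegative address. -/
def putData (tr : Bool) (i e : Tm) : Prog := .store (i.compile tr) (e.compile tr)

/-- Case distinction on the sign of a term. -/
def ifPos (tr : Bool) (e : Tm) (p q : Prog) : Prog := .ite (e.compile tr) p q

/-- Iteration while a term is positive. -/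
def whilePos (tr : Bool) (e : Tm) (p : Prog) : Prog := .loop (e.compile tr) p

/-- Counting the variable `x` up to the value of `hi`. -/
def forTo (tr : Bool) (x : ℕ) (hi : Tm) (p : Prog) : Prog :=
  whilePos tr (hi - .var x) (.seq p (setVar tr x (.var x + 1)))

/-- From the state `s`, the program halts within its time bound in a state that satisfies `R`. -/
def Spec (tr : Bool) (X : ℕ) (p : Prog) (s : St) (R : St → Prop) : Prop :=
  ∀ σ, Represents tr X σ s → ∃ t τ s', Exec p σ t τ ∧ t ≤ p.timeBound X ∧
    Represents tr X τ s' ∧ R s'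

namespace Spec

variable {R : St → Prop} {p q : Prog}

/-- Whatever already stands in the workspace has bit length at most `X`, so length bounds of old
values need not be carried through invariants. -/
theorem of_lenLE (h : s.LenLE X → Spec tr X p s R) : Spec tr X p s R :=
  fun σ hσ => h hσ.lenLE σ hσ

theorem mono {R' : St → Prop} (h : Spec tr X p s R) (hR : ∀ s, R s → R' s) : Spec tr X p s R' :=
  fun σ hσ => by
    obtain ⟨t, τ, s', h₁, h₂, h₃, h₄⟩ := h σ hσ
    exact ⟨t, τ, s', h₁, h₂, h₃, hR _ h₄⟩

theorem transpose (h : Spec tr X p { s with M := fun i j => s.M j i } R) :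
    Spec (!tr) X p s fun s' => R { s' with M := fun i j => s'.M j i } :=
  fun σ hσ => by
    obtain ⟨t, τ, s', h₁, h₂, h₃, h₄⟩ := h σ (by simpa using hσ.transpose)
    exact ⟨t, τ, _, h₁, h₂, h₃.transpose, h₄⟩

theorem skip (h : R s) : Spec tr X .skip s R :=
  fun σ hσ => ⟨1, σ, s, .skip σ, le_rfl, hσ, h⟩

theorem store {e f : Expr} (s' : Mem → St) (he : ∀ σ, Represents tr X σ s → e.LoadsLE X σ)
    (hf : ∀ σ, Represents tr X σ s → f.LoadsLE X σ)
    (h : ∀ σ, Represents tr X σ s →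
      Represents tr X (Function.update σ (e.eval σ) (f.eval σ)) (s' σ) ∧ R (s' σ)) :
    Spec tr X (.store e f) s R :=
  fun σ hσ => by
    refine ⟨_, _, s' σ, .store e f σ, ?_, (h σ hσ).1, (h σ hσ).2⟩
    have := Expr.cost_le (he σ hσ)
    have := Expr.cost_le (hf σ hσ)
    have := Expr.len_eval_le (he σ hσ)
    have := Expr.len_eval_le (hf σ hσ)
    simp only [Prog.timeBound]
    omega

theorem setVar {x : ℕ} {e : Tm} (he : len (e.eval s) ≤ X)
    (h : R { s with v := Function.update s.v x (e.eval s) }) : Spec tr X (setVar tr x e) s R :=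
  store (fun _ => _) (fun _ _ => trivial) (fun _ hσ => hσ.loadsLE e)
    (fun _ hσ => ⟨by rw [hσ.eval e]; exact hσ.update_var x he, h⟩)

theorem setMat {i j e : Tm} (he : len (e.eval s) ≤ X)
    (h : R { s with M := updateMat s.M (i.eval s) (j.eval s) (e.eval s) }) :
    Spec tr X (setMat tr i j e) s R :=
  store (fun _ => _) (fun _ hσ => loadsLE_matExpr (hσ.loadsLE i) (hσ.loadsLE j))
    (fun _ hσ => hσ.loadsLE e)
    (fun _ hσ => ⟨by
      rw [hσ.eval e, eval_matExpr, hσ.eval i, hσ.eval j]; exact hσ.update_mat _ _ he, h⟩)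

theorem setVec {i e : Tm} (he : len (e.eval s) ≤ X)
    (h : R { s with Q := Function.update s.Q (i.eval s) (e.eval s) }) :
    Spec tr X (setVec tr i e) s R :=
  store (fun _ => _) (fun _ hσ => loadsLE_cellExpr (hσ.loadsLE i) trivial)
    (fun _ hσ => hσ.loadsLE e)
    (fun _ hσ => ⟨by
      rw [hσ.eval e, eval_cellExpr, hσ.eval i]; exact hσ.update_vec _ he, h⟩)

/-- Registers with nonnegative address are under no length bound in `Represents`, so each read has
to supply its own. The vectors b and c are never read, which is why their size does not affect the
running time. -/
theorem getData {x : ℕ} {e : Tm} (h₀ : 0 ≤ e.eval s) (he : len (s.D (e.eval s)) ≤ X)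
    (h : R { s with v := Function.update s.v x (s.D (e.eval s)) }) :
    Spec tr X (getData tr x e) s R :=
  store (fun _ => _) (fun _ _ => trivial)
    (fun _ hσ => ⟨hσ.loadsLE e, by rwa [hσ.eval e, hσ.D _ h₀]⟩)
    (fun _ hσ => ⟨by
      simp only [Expr.eval]
      rw [hσ.eval e, hσ.D _ h₀]; exact hσ.update_var x he, h⟩)

theorem putData {i e : Tm} (hi : 0 ≤ i.eval s)
    (h : R { s with D := Function.update s.D (i.eval s) (e.eval s) }) :
    Spec tr X (putData tr i e) s R :=
  store (fun _ => _) (fun _ hσ => hσ.loadsLE i) (fun _ hσ => hσ.loadsLE e)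
    (fun _ hσ => ⟨by rw [hσ.eval e, hσ.eval i]; exact hσ.update_data hi _, h⟩)

theorem seq (h : Spec tr X p s fun s' => Spec tr X q s' R) : Spec tr X (.seq p q) s R :=
  fun σ hσ => by
    obtain ⟨t, τ, s', h₁, h₂, h₃, h₄⟩ := h σ hσ
    obtain ⟨u, ρ, s'', k₁, k₂, k₃, k₄⟩ := h₄ τ h₃
    exact ⟨t + u, ρ, s'', .seq h₁ k₁, add_le_add h₂ k₂, k₃, k₄⟩

theorem ifPos {e : Tm} (h₁ : 0 < e.eval s → Spec tr X p s R)
    (h₂ : ¬ 0 < e.eval s → Spec tr X q s R) : Spec tr X (ifPos tr e p q) s R :=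
  fun σ hσ => by
    have hc := Expr.cost_le (hσ.loadsLE e)
    have hl := Expr.len_eval_le (hσ.loadsLE e)
    have he := hσ.eval e
    by_cases h : 0 < e.eval s
    · obtain ⟨t, τ, s', k₁, k₂, k₃, k₄⟩ := h₁ h σ hσ
      refine ⟨_, τ, s', .ite_pos (he ▸ h) k₁, ?_, k₃, k₄⟩
      simp only [Prog.timeBound, RAM.ifPos]; omega
    · obtain ⟨t, τ, s', k₁, k₂, k₃, k₄⟩ := h₂ h σ hσ
      refine ⟨_, τ, s', .ite_neg (he ▸ h) k₁, ?_, k₃, k₄⟩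
      simp only [Prog.timeBound, RAM.ifPos]; omega

/-- The bound on `μ` is the number of passes that `Prog.timeBound` allows for every loop; its factor
`2 * X + 3` also counts the final failing test. -/
theorem whilePos {e : Tm} (J : St → Prop) (μ : St → ℕ) (hJ : J s) (hμ : μ s ≤ 2 * X + 2)
    (step : ∀ s, J s → 0 < e.eval s → Spec tr X p s fun s' => J s' ∧ μ s' < μ s)
    (exit : ∀ s, J s → ¬ 0 < e.eval s → R s) : Spec tr X (whilePos tr e p) s R := by
  have key : ∀ (n : ℕ) (s : St), J s → μ s ≤ n → ∀ σ, Represents tr X σ s →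
      ∃ t τ s', Exec (.loop (e.compile tr) p) σ t τ ∧
        t ≤ (n + 1) * ((e.compile tr).timeBound X + (1 + (e.compile tr).lenBound X) +
          p.timeBound X) ∧ Represents tr X τ s' ∧ R s' := by
    intro n
    induction n with
    | zero =>
      intro s hJ hμ σ hσ
      have hc := Expr.cost_le (hσ.loadsLE e)
      have hl := Expr.len_eval_le (hσ.loadsLE e)
      have he := hσ.eval e
      -- With measure zero the test must fail, since another pass would have to lower the measure.
      have h : ¬ 0 < e.eval s := fun h => by
        obtain ⟨_, _, _, _, _, _, _, k⟩ := step s hJ h σ hσ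
        omega
      exact ⟨_, σ, s, .loop_neg (he ▸ h), by omega, hσ, exit s hJ h⟩
    | succ n ih =>
      intro s hJ hμ σ hσ
      have hc := Expr.cost_le (hσ.loadsLE e)
      have hl := Expr.len_eval_le (hσ.loadsLE e)
      have he := hσ.eval e
      rw [add_mul _ 1, one_mul]
      by_cases h : 0 < e.eval s
      · obtain ⟨t, τ, s', k₁, k₂, k₃, k₄, k₅⟩ := step s hJ h σ hσ
        obtain ⟨u, ρ, s'', l₁, l₂, l₃, l₄⟩ := ih s' k₄ (by omega) τ k₃
        exact ⟨_, ρ, s'', .loop_pos (he ▸ h) k₁ l₁, by omega, l₃, l₄⟩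
      · exact ⟨_, σ, s, .loop_neg (he ▸ h), by omega, hσ, exit s hJ h⟩
  exact key (2 * X + 2) s hJ hμ

theorem forTo {x : ℕ} {hi : Tm} (J : ℤ → St → Prop) (a b : ℤ) (ha : s.v x = a)
    (hab : a ≤ b) (ha₀ : 0 ≤ a) (hb : b ≤ X) (hJ : J a s)
    (hhi : ∀ i s, J i s → hi.eval s = b)
    (step : ∀ i s, a ≤ i → i < b → s.v x = i → J i s → Spec tr X p s fun s' =>
      s'.v x = i ∧ J (i + 1) { s' with v := Function.update s'.v x (i + 1) })
    (exit : ∀ s, s.v x = b → J b s → R s) : Spec tr X (forTo tr x hi p) s R := by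
  refine whilePos (fun s => a ≤ s.v x ∧ s.v x ≤ b ∧ J (s.v x) s) (fun s => (b - s.v x).toNat)
    ⟨ha.ge, ha ▸ hab, ha.symm ▸ hJ⟩ (by rw [ha]; omega) ?_ ?_
  · rintro s ⟨h₁, h₂, h₃⟩ h
    rw [Tm.eval_sub, hhi _ _ h₃, Tm.eval_var] at h
    refine seq (mono (step _ s h₁ (by omega) rfl h₃) ?_)
    rintro s' ⟨k₁, k₂⟩
    have : (Tm.var x + 1).eval s' = s.v x + 1 := by simp [k₁]
    refine setVar (by rw [this]; exact len_le_self (by omega) (by omega)) ?_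
    rw [this]
    simp only [Function.update_self]
    exact ⟨⟨by omega, by omega, k₂⟩, by omega⟩
  · rintro s ⟨h₁, h₂, h₃⟩ h
    rw [Tm.eval_sub, hhi _ _ h₃, Tm.eval_var] at h
    have hx : s.v x = b := by omega
    exact exit s hx (hx ▸ h₃)

end Spec

end RAM

namespace RAM

/-! ### Row elimination -/

/-- Subtraction of `q` times row `k` from row `i` in the columns below `n`, reduced modulo `Q`. -/
def subRow (Q : ℤ → ℤ) (k n : ℤ) (i q : ℤ) (M : ℤ → ℤ → ℤ) : ℤ → ℤ → ℤ :=
  fun a b => if a = i ∧ 0 ≤ b ∧ b < n then (M i b - q * M k b) % Q b else M a b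

/-- Exchange of the rows `k` and `i` in the columns below `n`. -/
def swapRow (k n i : ℤ) (M : ℤ → ℤ → ℤ) : ℤ → ℤ → ℤ :=
  fun a b => if 0 ≤ b ∧ b < n then M (Equiv.swap k i a) b else M a b

/-- Program for `subRow`; the variables are `q = 0`, `c = 1`, `i = 3`, `k = 4`, `n = 6`. -/
def subRowProg (tr : Bool) : Prog :=
  .seq (setVar tr 1 0) (forTo tr 1 (.var 6) (setMat tr (.var 3) (.var 1)
    ((.mat (.var 3) (.var 1) - .var 0 * .mat (.var 4) (.var 1)) % .vec (.var 1))))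

/-- Program for `swapRow`; the variables are `c = 1`, `t = 2`, `i = 3`, `k = 4`, `n = 6`. -/
def swapRowProg (tr : Bool) : Prog :=
  .seq (setVar tr 1 0) (forTo tr 1 (.var 6)
    (.seq (setVar tr 2 (.mat (.var 4) (.var 1)))
      (.seq (setMat tr (.var 4) (.var 1) (.mat (.var 3) (.var 1)))
        (setMat tr (.var 3) (.var 1) (.var 2)))))

/-- Euclid's algorithm with the rows `k = 4` and `i = 3`, directed by column `5`. -/
def euclidProg (tr : Bool) : Prog :=
  whilePos tr (.mat (.var 3) (.var 5))
    (.seq (setVar tr 0 (.mat (.var 3) (.var 5) / .mat (.var 4) (.var 5)))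
      (.seq (subRowProg tr) (ifPos tr (.mat (.var 3) (.var 5)) (swapRowProg tr) .skip)))

/-- Elimination of the entries in column `5` and the rows from variable `3` up to variable `7`
by means of row `4`. -/
def sweepProg (tr : Bool) : Prog := forTo tr 3 (.var 7) (euclidProg tr)

/-- Halving removes a binary digit. Termination of Euclid's algorithm and of the pivot-halving loop
rests on this. -/
theorem len_lt_of_two_mul_le {a b : ℤ} (ha : 0 < a) (h : 2 * a ≤ b) : len a < len b := by
  have hb := abs_lt_two_pow_len b
  rw [abs_of_pos (by omega)] at hb
  rcases Nat.eq_zero_or_pos (len b) with h₀ | h₀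
  · rw [h₀] at hb; omega
  · have : len a ≤ len b - 1 := by
      rw [len_le_iff, abs_of_pos ha]
      have : (2 : ℤ) ^ len b = 2 * 2 ^ (len b - 1) := by
        rw [← pow_succ']; congr 1; omega
      omega
    omega

/-- `x` is a reduced representative modulo `q`. -/
def Reduced (q x : ℤ) : Prop := 0 ≤ x ∧ (q = 0 ∨ x < q)

/-- Modulus 0 marks a column whose entries are plain integers: `x % 0 = x`, so the same elimination
code serves integer columns and residue columns. -/
theorem Reduced.emod_eq {q x : ℤ} (h : Reduced q x) : x % q = x := by
  rcases h with ⟨h₀, rfl | h⟩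
  · exact Int.emod_zero x
  · exact Int.emod_eq_of_lt h₀ h

theorem Reduced.of_le {q x y : ℤ} (h : Reduced q x) (h₀ : 0 ≤ y) (hy : y ≤ x) : Reduced q y :=
  ⟨h₀, h.2.imp_right fun h => hy.trans_lt h⟩

theorem emod_le_self {a b : ℤ} (ha : 0 ≤ a) (hb : 0 ≤ b) : a % b ≤ a := by
  have := Int.emod_add_mul_ediv a b
  have := mul_nonneg hb (Int.ediv_nonneg ha hb)
  omega

theorem emod_nonneg_of_nonneg {a b : ℤ} (ha : 0 ≤ a) (hb : 0 ≤ b) : 0 ≤ a % b := by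
  rcases hb.eq_or_lt with rfl | hb
  · rwa [Int.emod_zero]
  · exact Int.emod_nonneg _ hb.ne'

variable {tr : Bool} {X : ℕ} {s : St} {R : St → Prop}

/-- Only the reduced value is stored, so `hlen` asks for its length and not for that of the
intermediate product. -/
theorem spec_subRowProg (hki : s.v 4 ≠ s.v 3) (hn : 0 ≤ s.v 6) (hnX : s.v 6 ≤ X)
    (hlen : ∀ b, 0 ≤ b → b < s.v 6 →
      len ((s.M (s.v 3) b - s.v 0 * s.M (s.v 4) b) % s.Q b) ≤ X)
    (h : ∀ v', (∀ x, x ≠ 1 → v' x = s.v x) →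
      R ⟨v', subRow s.Q (s.v 4) (s.v 6) (s.v 3) (s.v 0) s.M, s.Q, s.D⟩) :
    Spec tr X (subRowProg tr) s R := by
  refine .seq (.setVar (by simp [len]) ?_)
  refine .forTo (fun j s' => (∀ x, x ≠ 1 → s'.v x = s.v x) ∧
    s'.M = subRow s.Q (s.v 4) j (s.v 3) (s.v 0) s.M ∧ s'.Q = s.Q ∧ s'.D = s.D) 0 (s.v 6)
    (by simp) hn le_rfl hnX ?_ ?_ ?_ ?_
  · refine ⟨fun x hx => by simp [hx], ?_, rfl, rfl⟩
    funext a b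
    simp only [subRow]
    rw [if_neg (by omega)]
  · rintro i s' ⟨h₁, -⟩
    simpa using h₁ 6 (by norm_num)
  · rintro j s' hj₀ hj hx ⟨h₁, h₂, h₃, h₄⟩
    have e0 := h₁ 0 (by norm_num)
    have e3 := h₁ 3 (by norm_num)
    have e4 := h₁ 4 (by norm_num)
    have hval : ((Tm.mat (.var 3) (.var 1) - .var 0 * .mat (.var 4) (.var 1)) %
        .vec (.var 1)).eval s' = (s.M (s.v 3) j - s.v 0 * s.M (s.v 4) j) % s.Q j := by
      simp [e0, e3, e4, hx, h₂, h₃, subRow, hki]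
    refine .setMat (by rw [hval]; exact hlen j hj₀ hj) ⟨hx, ?_, ?_, h₃, h₄⟩
    · intro x hx'
      simpa [hx'] using h₁ x hx'
    · rw [hval]
      funext a b
      simp only [updateMat, Tm.eval_var, e3, hx, h₂, subRow]
      by_cases hab : a = s.v 3 ∧ b = j
      · rw [if_pos hab, if_pos (by omega), hab.2]
      · rw [if_neg hab]
        by_cases hab' : a = s.v 3 ∧ 0 ≤ b ∧ b < j
        · rw [if_pos hab', if_pos (by omega)]
        · rw [if_neg hab', if_neg (by omega)]
  · rintro ⟨v', M', Q', D'⟩ hx ⟨h₁, h₂, h₃, h₄⟩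
    simp only at h₁ h₂ h₃ h₄
    subst h₂ h₃ h₄
    exact h v' h₁

theorem spec_swapRowProg (hki : s.v 4 ≠ s.v 3) (hn : 0 ≤ s.v 6) (hnX : s.v 6 ≤ X)
    (h : ∀ v', (∀ x, x ≠ 1 → x ≠ 2 → v' x = s.v x) →
      R ⟨v', swapRow (s.v 4) (s.v 6) (s.v 3) s.M, s.Q, s.D⟩) :
    Spec tr X (swapRowProg tr) s R := by
  refine .seq (.setVar (by simp [len]) ?_)
  refine .forTo (fun j s' => (∀ x, x ≠ 1 → x ≠ 2 → s'.v x = s.v x) ∧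
    s'.M = swapRow (s.v 4) j (s.v 3) s.M ∧ s'.Q = s.Q ∧ s'.D = s.D) 0 (s.v 6)
    (by simp) hn le_rfl hnX ?_ ?_ ?_ ?_
  · refine ⟨fun x hx _ => by simp [hx], ?_, rfl, rfl⟩
    funext a b
    simp only [swapRow]
    rw [if_neg (by omega)]
  · rintro i s' ⟨h₁, -⟩
    simpa using h₁ 6 (by norm_num) (by norm_num)
  · rintro j s' hj₀ hj hx ⟨h₁, h₂, h₃, h₄⟩
    have e3 := h₁ 3 (by norm_num) (by norm_num)
    have e4 := h₁ 4 (by norm_num) (by norm_num)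
    refine .of_lenLE fun hlen => ?_
    refine .seq (.setVar (hlen.M _ _) (.seq (.setMat ?_ (.setMat ?_ ⟨?_, ?_, ?_, h₃, h₄⟩))))
    · exact hlen.M _ _
    · simpa using hlen.M _ _
    · simpa using hx
    · intro x hx₁ hx₂
      simpa [hx₁, hx₂] using h₁ x hx₁ hx₂
    · funext a b
      simp only [updateMat, Tm.eval_var, Tm.eval_mat, Function.update_of_ne, ne_eq,
        OfNat.one_ne_ofNat, not_false_eq_true, Nat.reduceEqDiff, e3, e4, hx,
        h₂, Function.update_self]
      simp only [swapRow]
      have hjj : ¬ (0 ≤ j ∧ j < j) := by omega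
      simp only [hjj, if_false]
      by_cases hb : b = j
      · subst hb
        simp only [and_true, if_pos (show 0 ≤ b ∧ b < b + 1 by omega), hjj, if_false]
        by_cases h3 : a = s.v 3
        · simp [h3]
        · by_cases h4 : a = s.v 4
          · simp [h4, hki]
          · simp [h3, h4, Equiv.swap_apply_of_ne_of_ne]
      · have : (0 ≤ b ∧ b < j + 1) ↔ (0 ≤ b ∧ b < j) := by omega
        simp only [hb, and_false, if_false, this]
  · rintro ⟨v', M', Q', D'⟩ hx ⟨h₁, h₂, h₃, h₄⟩
    simp only at h₁ h₂ h₃ h₄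
    subst h₂ h₃ h₄
    exact h v' h₁

/-- `I` is any property preserved by the two row operations, so each caller tracks its own algebraic
content. The gcd of the two directing entries is invariant. At the end row `k` is unchanged, or its
directing entry was zero and became positive, or it was replaced by a proper divisor and so at least
halved. -/
theorem spec_euclidProg (I : (ℤ → ℤ → ℤ) → Prop) {k i col n : ℤ} (h3 : s.v 3 = i)
    (h4 : s.v 4 = k) (h5 : s.v 5 = col) (h6 : s.v 6 = n) (hki : k ≠ i) (hcol : 0 ≤ col)
    (hcoln : col < n) (hnX : n ≤ X) (hk : Reduced (s.Q col) (s.M k col))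
    (hi : Reduced (s.Q col) (s.M i col)) (hQ : ∀ c, 0 ≤ c → c < n → c ≠ col → 0 < s.Q c)
    (hI : I s.M) (hsub : ∀ M q, I M → I (subRow s.Q k n i q M))
    (hswap : ∀ M, I M → I (swapRow k n i M))
    (h : ∀ v' M', (∀ x, 3 ≤ x → v' x = s.v x) → I M' → M' i col = 0 →
      Reduced (s.Q col) (M' k col) →
      ((∀ b, M' k b = s.M k b) ∨
        (0 < M' k col ∧ (s.M k col = 0 ∨ 2 * M' k col ≤ s.M k col))) →
      (s.M i col = 0 → M' = s.M) → (∀ a, a ≠ k → a ≠ i → M' a = s.M a) →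
      R ⟨v', M', s.Q, s.D⟩) :
    Spec tr X (euclidProg tr) s R := by
  refine .of_lenLE fun hlen₀ => ?_
  refine .whilePos (fun s' => (∀ x, 3 ≤ x → s'.v x = s.v x) ∧ s'.Q = s.Q ∧ s'.D = s.D ∧ I s'.M ∧
      (Reduced (s.Q col) (s'.M k col) ∧ Reduced (s.Q col) (s'.M i col)) ∧
      (∀ a, a ≠ k → a ≠ i → s'.M a = s.M a) ∧
      Int.gcd (s'.M k col) (s'.M i col) = Int.gcd (s.M k col) (s.M i col) ∧
      (s'.M = s.M ∨ (0 < s.M i col ∧ ((∀ b, s'.M k b = s.M k b) ∧ s'.M i col = 0 ∨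
        0 < s'.M k col ∧ (s.M k col = 0 ∨ s'.M k col < s.M k col)))))
    -- The last summand pays for a pass with M i < M k, where the quotient is 0 and the rows are
    -- merely exchanged. In a pass with M i ≥ M k > 0 the remainder is at most half of M i, so the
    -- sum of lengths drops. If M k = 0, one exchange finishes.
    (fun s' => if s'.M i col = 0 then 0 else 1 + len (s'.M k col) + len (s'.M i col) +
      if s'.M i col < s'.M k col then 1 else 0)
    ⟨fun _ _ => rfl, rfl, rfl, hI, ⟨hk, hi⟩, fun _ _ _ => rfl, rfl, .inl rfl⟩ ?_ ?_ ?_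
  · have := hlen₀.M k col
    have := hlen₀.M i col
    split_ifs <;> omega
  · rintro s' ⟨hv, hQ', hD, hI', ⟨hk', hi'⟩, hfr, hg, hor⟩ hpos
    have e3 : s'.v 3 = i := (hv 3 le_rfl).trans h3
    have e4 : s'.v 4 = k := (hv 4 (by norm_num)).trans h4
    have e5 : s'.v 5 = col := (hv 5 (by norm_num)).trans h5
    have e6 : s'.v 6 = n := (hv 6 (by norm_num)).trans h6
    simp only [Tm.eval_mat, Tm.eval_var, e3, e5] at hpos
    refine .of_lenLE fun hlen => ?_
    have hq : (Tm.mat (.var 3) (.var 5) / Tm.mat (.var 4) (.var 5)).eval s' =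
        s'.M i col / s'.M k col := by simp [e3, e4, e5]
    refine .seq (.setVar ?_ (.seq (spec_subRowProg ?_ ?_ ?_ ?_ ?_)))
    · rw [hq]
      refine (len_le_of_abs_le ?_).trans (hlen.M i col)
      rw [Int.abs_eq_natAbs, Int.abs_eq_natAbs]
      exact_mod_cast Int.natAbs_ediv_le_natAbs _ _
    · simpa [e3, e4] using hki
    · simp [e6]; omega
    · simpa [e6] using hnX
    · rw [hq]
      intro b hb₀ hb
      simp only [Function.update_self, Function.update_of_ne, ne_eq, OfNat.ofNat_ne_zero,
        not_false_eq_true, e3, e4, e6] at hb ⊢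
      -- In the directing column the new entry is a Euclidean remainder, hence no larger than the
      -- old entry even if the modulus is 0. All other columns have positive moduli, which bound
      -- their entries.
      by_cases hbc : b = col
      · subst hbc
        have : s'.M i b - s'.M i b / s'.M k b * s'.M k b = s'.M i b % s'.M k b := by
          rw [Int.emod_def, mul_comm]
        rw [this, hQ', (hi'.of_le _ _).emod_eq]
        · exact (len_le_of_nonneg_of_le (emod_nonneg_of_nonneg hi'.1 hk'.1) (emod_le_self hi'.1 hk'.1)).trans
            (hlen.M i b)
        · exact emod_nonneg_of_nonneg hi'.1 hk'.1
        · exact emod_le_self hi'.1 hk'.1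
      · have hQb : 0 < s'.Q b := by rw [hQ']; exact hQ b hb₀ hb hbc
        exact (len_le_of_nonneg_of_le (Int.emod_nonneg _ hQb.ne') (Int.emod_lt_of_pos _ hQb).le).trans
          (hlen.Q b)
    · intro v₁ hv₁
      have f3 : v₁ 3 = i := by rw [hv₁ 3 (by norm_num)]; simpa using e3
      have f4 : v₁ 4 = k := by rw [hv₁ 4 (by norm_num)]; simpa using e4
      have f5 : v₁ 5 = col := by rw [hv₁ 5 (by norm_num)]; simpa using e5
      have f6 : v₁ 6 = n := by rw [hv₁ 6 (by norm_num)]; simpa using e6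
      have fv : ∀ x, 3 ≤ x → v₁ x = s.v x := fun x hx => by
        rw [hv₁ x (by omega)]
        simpa [show x ≠ 0 by omega] using hv x hx
      simp only [Function.update_self, Function.update_of_ne, ne_eq, OfNat.ofNat_ne_zero,
        not_false_eq_true, e3, e4, e6, hq, hQ', hD]
      have hI₁ := hsub s'.M (s'.M i col / s'.M k col) hI'
      have hM₁ : ∀ a, a ≠ i → subRow s.Q k n i (s'.M i col / s'.M k col) s'.M a = s'.M a :=
        fun a ha => by funext b; simp only [subRow]; rw [if_neg (by tauto)]
      have hM₂ : subRow s.Q k n i (s'.M i col / s'.M k col) s'.M i col =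
          s'.M i col % s'.M k col := by
        simp only [subRow]
        rw [if_pos (by exact ⟨trivial, hcol, hcoln⟩), show s'.M i col - s'.M i col / s'.M k col * s'.M k col =
          s'.M i col % s'.M k col by rw [Int.emod_def, mul_comm]]
        exact (hi'.of_le (emod_nonneg_of_nonneg hi'.1 hk'.1) (emod_le_self hi'.1 hk'.1)).emod_eq
      generalize subRow s.Q k n i (s'.M i col / s'.M k col) s'.M = M₁ at hI₁ hM₁ hM₂ ⊢
      have hw := hi'.of_le (emod_nonneg_of_nonneg hi'.1 hk'.1) (emod_le_self hi'.1 hk'.1)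
      have hkM : M₁ k = s'.M k := hM₁ k hki
      have hor₀ : 0 < s.M i col := by
        rcases hor with h | h
        · rwa [← h]
        · exact h.1
      refine .ifPos (fun hc => spec_swapRowProg ?_ ?_ ?_ fun v₂ hv₂ => ?_)
        fun hc =>   .skip ⟨⟨fv, by trivial, by trivial, hI₁, ?_⟩, ?_⟩
      · simpa [f3, f4] using hki
      · simp only [f6]; omega
      · simpa [f6] using hnX
      · simp only [Tm.eval_mat, Tm.eval_var, f3, f5, hM₂] at hc
        simp only [f3, f4, f6]
        have hM₃ : swapRow k n i M₁ k col = s'.M i col % s'.M k col := by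
          simp [swapRow, hcol, hcoln, hM₂]
        have hM₄ : swapRow k n i M₁ i col = s'.M k col := by
          simp [swapRow, hcol, hcoln, hkM]
        have hM₅ : ∀ a, a ≠ k → a ≠ i → swapRow k n i M₁ a = s.M a := fun a h₁ h₂ => by
          funext b
          simp only [swapRow, Equiv.swap_apply_of_ne_of_ne h₁ h₂, ite_self, hM₁ a h₂]
          rw [hfr a h₁ h₂]
        have hI₂ := hswap M₁ hI₁
        generalize swapRow k n i M₁ = M₂ at hM₃ hM₄ hM₅ hI₂ ⊢
        have hlt : 0 < s'.M k col → s'.M i col % s'.M k col < s'.M k col :=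
          fun hp => Int.emod_lt_of_pos _ hp
        refine ⟨⟨fun x hx => (hv₂ x (by omega) (by omega)).trans (fv x hx), by trivial, by trivial, hI₂,
          ?_, hM₅, ?_, ?_⟩, ?_⟩
        · rw [hM₃, hM₄]; exact ⟨hw, hk'⟩
        · rw [hM₃, hM₄, ← hg, Int.gcd_emod, Int.gcd_comm]
        · refine .inr ⟨hor₀, .inr ⟨by rwa [hM₃], ?_⟩⟩
          rw [hM₃]
          rcases hor with h | ⟨-, ⟨-, h⟩ | ⟨h₁, h₂⟩⟩
          · rw [← h]
            rcases hk'.1.eq_or_lt with h0 | h0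
            · exact .inl h0.symm
            · exact .inr (hlt h0)
          · omega
          · exact h₂.imp_right fun h => (hlt h₁).trans h
        · simp only [hM₃, hM₄]
          rcases hk'.1.eq_or_lt with h0 | h0
          · rw [if_pos h0.symm, if_neg hpos.ne']; omega
          · have := hlt h0
            rw [if_neg h0.ne', if_neg hpos.ne', if_neg (by omega)]
            by_cases hwp : s'.M i col < s'.M k col
            · rw [if_pos hwp, Int.emod_eq_of_lt hi'.1 hwp]; omega
            · rw [if_neg hwp]
              have := len_lt_of_two_mul_le hc (b := s'.M i col) (by
                have h₁ := Int.emod_add_mul_ediv (s'.M i col) (s'.M k col)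
                have h₂ : 1 ≤ s'.M i col / s'.M k col := by
                  rw [Int.le_ediv_iff_mul_le h0]; omega
                nlinarith)
              omega
      · simp only [Tm.eval_mat, Tm.eval_var, f3, f5, hM₂] at hc
        have hz : s'.M i col % s'.M k col = 0 := le_antisymm (not_lt.1 hc) hw.1
        dsimp only
        rw [hkM, hM₂, ← hg, hz]
        refine ⟨⟨hk', hz ▸ hw⟩, fun a h₁ h₂ => (hM₁ a h₂).trans (hfr a h₁ h₂), ?_,
          .inr ⟨hor₀, ?_⟩⟩
        · rw [← hz, Int.gcd_comm, Int.gcd_emod, Int.gcd_comm]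
        · rcases hor with h | ⟨-, ⟨-, h⟩ | h⟩
          · exact .inl ⟨fun b => by rw [h], rfl⟩
          · omega
          · exact .inr h
      · simp only [Tm.eval_mat, Tm.eval_var, f3, f5, hM₂] at hc
        have hz : s'.M i col % s'.M k col = 0 := le_antisymm (not_lt.1 hc) hw.1
        rw [if_pos (hM₂.trans hz), if_neg hpos.ne']
        omega
  · rintro ⟨v', M', Q', D'⟩ ⟨hv, hQ', hD, hI', ⟨hk', hi'⟩, hfr, hg, hor⟩ hpos
    have e3 : v' 3 = i := (hv 3 le_rfl).trans h3
    have e5 : v' 5 = col := (hv 5 (by norm_num)).trans h5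
    simp only [Tm.eval_mat, Tm.eval_var, e3, e5] at hpos hQ' hD hI' hk' hi' hfr hg hor hv
    subst hQ' hD
    have hz : M' i col = 0 := le_antisymm (not_lt.1 hpos) hi'.1
    refine h v' M' hv hI' hz hk' ?_ ?_ hfr
    · rcases hor with rfl | ⟨hp, h' | ⟨h₁, h₂⟩⟩
      · exact .inl fun _ => rfl
      · exact .inl h'.1
      · refine .inr ⟨h₁, h₂.imp_right fun h₂ => ?_⟩
        -- As M' i col = 0, the gcd invariant makes the new pivot a divisor of the old one; a
        -- positive divisor that is strictly smaller is at most half.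
        have hdvd : M' k col ∣ s.M k col := by
          have h' : ((Int.gcd (s.M k col) (s.M i col) : ℕ) : ℤ) ∣ s.M k col := Int.gcd_dvd_left ..
          rw [← hg, hz, Int.gcd_zero_right] at h'
          exact Int.natAbs_dvd.1 h'
        obtain ⟨c, hc⟩ := hdvd
        rw [hc] at h₂ ⊢
        have : 2 ≤ c := by
          by_contra hc'
          have : c ≤ 1 := by omega
          nlinarith
        nlinarith
    · intro hz'
      rcases hor with rfl | ⟨hp, -⟩
      · rfl
      · omega

end RAM

namespace RAM

/-- The effect of eliminating the entries of column `col` in the rows `lo, …, hi - 1` by means of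
row `k`. -/
structure Swept (Q : ℤ → ℤ) (k col lo hi : ℤ) (M M' : ℤ → ℤ → ℤ) : Prop where
  zero : ∀ a, lo ≤ a → a < hi → M' a col = 0
  reduced : Reduced (Q col) (M' k col)
  pivot : (∀ b, M' k b = M k b) ∨ (0 < M' k col ∧ (M k col = 0 ∨ 2 * M' k col ≤ M k col))
  eq_self : (∀ a, lo ≤ a → a < hi → M a col = 0) → M' = M

variable {tr : Bool} {X : ℕ} {s : St} {R : St → Prop}

/-- The clauses of `Swept` compose along the rows: once the pivot has changed, later rows keep it or
halve it again. The clause that the whole row `k` is unchanged, and not just its pivot, and the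
clause `eq_self` are what make alternating row and column sweeps terminate. -/
theorem spec_sweepProg (I : (ℤ → ℤ → ℤ) → Prop) {k lo hi col n : ℤ} (h3 : s.v 3 = lo)
    (h4 : s.v 4 = k) (h5 : s.v 5 = col) (h6 : s.v 6 = n) (h7 : s.v 7 = hi) (hlo : 0 ≤ lo)
    (hlohi : lo ≤ hi) (hhiX : hi ≤ X) (hk : k < lo ∨ hi ≤ k) (hcol : 0 ≤ col) (hcoln : col < n)
    (hnX : n ≤ X) (hkr : Reduced (s.Q col) (s.M k col))
    (hr : ∀ a, lo ≤ a → a < hi → Reduced (s.Q col) (s.M a col))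
    (hQ : ∀ c, 0 ≤ c → c < n → c ≠ col → 0 < s.Q c) (hI : I s.M)
    (hsub : ∀ M q i, lo ≤ i → i < hi → I M → I (subRow s.Q k n i q M))
    (hswap : ∀ M i, lo ≤ i → i < hi → I M → I (swapRow k n i M))
    (h : ∀ v' M', (∀ x, 4 ≤ x → v' x = s.v x) → I M' → Swept s.Q k col lo hi s.M M' →
      R ⟨v', M', s.Q, s.D⟩) :
    Spec tr X (sweepProg tr) s R := by
  refine .forTo (fun j s' => (∀ x, 4 ≤ x → s'.v x = s.v x) ∧ s'.Q = s.Q ∧ s'.D = s.D ∧ I s'.M ∧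
    (∀ a, j ≤ a → a < hi → s'.M a = s.M a) ∧ Swept s.Q k col lo j s.M s'.M) lo hi h3 hlohi hlo hhiX
    ⟨fun _ _ => rfl, rfl, rfl, hI, fun _ _ _ => rfl, fun _ _ _ => by omega, hkr,
      .inl fun _ => rfl, fun _ => rfl⟩ ?_ ?_ ?_
  · rintro i s' ⟨h₁, -⟩
    exact (h₁ 7 (by norm_num)).trans h7
  · rintro i s' hi₀ hi₁ hx ⟨hv, hQ', hD, hI', hfr, hsw⟩
    have hki : k ≠ i := by omega
    refine spec_euclidProg I hx ((hv 4 le_rfl).trans h4) ((hv 5 (by norm_num)).trans h5)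
      ((hv 6 (by norm_num)).trans h6) hki hcol hcoln hnX (hQ' ▸ hsw.reduced) ?_
      (hQ' ▸ hQ) hI' (fun M q => hQ' ▸ hsub M q i hi₀ hi₁) (fun M => hswap M i hi₀ hi₁) ?_
    · rw [hQ', hfr i le_rfl hi₁]; exact hr i hi₀ hi₁
    · intro v' M' kv kI kz kr kp ks kf
      refine ⟨(kv 3 le_rfl).trans hx, fun x hx => ?_, hQ', hD, kI, fun a h₁ h₂ => ?_, ?_, ?_, ?_, ?_⟩
      · simp only [Function.update_of_ne (show x ≠ 3 by omega)]
        exact (kv x (by omega)).trans (hv x hx)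
      · exact (kf a (by omega) (by omega)).trans (hfr a (by omega) h₂)
      · intro a h₁ h₂
        rcases eq_or_ne a i with rfl | hai
        · exact kz
        · exact (congrFun (kf a (by omega) hai) col).trans (hsw.zero a h₁ (by omega))
      · exact hQ' ▸ kr
      · rcases kp with kp | ⟨kp₁, kp₂⟩
        · simp only [kp]; exact hsw.pivot
        · refine .inr ⟨kp₁, ?_⟩
          rcases hsw.pivot with hp | ⟨hp₁, hp₂⟩
          · rwa [hp] at kp₂
          · refine hp₂.imp_right fun hp₂ => ?_
            dsimp only
            omega
      · intro hz
        have h₁ := hsw.eq_self fun a h₁ h₂ => hz a h₁ (by omega)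
        exact (ks (by rw [h₁]; exact hz i hi₀ (by omega))).trans h₁
  · rintro ⟨v', M', Q', D'⟩ hx ⟨hv, hQ', hD, hI', -, hsw⟩
    simp only at hv hQ' hD hI' hsw
    subst hQ' hD
    exact h v' M' hv hI' hsw

end RAM

/-! ### Row operations preserve the generated subgroup. -/

section RowOperations

variable {G : Type*} [AddCommGroup G] {S : Set ℤ} {k i : ℤ} {x x' : ℤ → G}

/-- Ranging over all `U` expresses equality of generated subgroups without naming them. The group
`G` is left free: it is ℤ for gcds, the rows' group for generators, and a group of homomorphisms for
column operations. -/
theorem forall_mem_iff_of_sub (hk : k ∈ S) (hi : i ∈ S) (hki : k ≠ i) (q : ℤ)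
    (h : ∀ a ∈ S, x' a = if a = i then x i - q • x k else x a) (U : AddSubgroup G) :
    (∀ a ∈ S, x' a ∈ U) ↔ ∀ a ∈ S, x a ∈ U := by
  have h₁ : x' i = x i - q • x k := by rw [h i hi, if_pos rfl]
  have h₂ : x' k = x k := by rw [h k hk, if_neg hki]
  refine ⟨fun H a ha => ?_, fun H a ha => ?_⟩
  · by_cases hai : a = i
    · have := U.add_mem (H i hi) (U.zsmul_mem (H k hk) q)
      rwa [h₁, h₂, sub_add_cancel, ← hai] at this
    · have := H a ha
      rwa [h a ha, if_neg hai] at this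
  · rw [h a ha]
    split_ifs
    · exact U.sub_mem (H i hi) (U.zsmul_mem (H k hk) q)
    · exact H a ha

theorem forall_mem_iff_of_swap (hk : k ∈ S) (hi : i ∈ S)
    (h : ∀ a ∈ S, x' a = x (Equiv.swap k i a)) (U : AddSubgroup G) :
    (∀ a ∈ S, x' a ∈ U) ↔ ∀ a ∈ S, x a ∈ U := by
  have hS : ∀ a ∈ S, Equiv.swap k i a ∈ S := fun a ha => by
    rw [Equiv.swap_apply_def]; split_ifs <;> assumption
  refine ⟨fun H a ha => ?_, fun H a ha => ?_⟩
  · have := H _ (hS a ha)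
    rwa [h _ (hS a ha), Equiv.swap_apply_self] at this
  · rw [h a ha]; exact H _ (hS a ha)

end RowOperations

theorem mem_diagLattice {m : ℕ} {r : Fin m → ℕ} {x : Fin m → ℤ} :
    x ∈ diagLattice r ↔ ∀ i, (r i : ℤ) ∣ x i := by
  simp only [diagLattice, Submodule.mem_toAddSubgroup, LinearMap.mem_range, Matrix.mulVecLin_apply]
  constructor
  · rintro ⟨y, rfl⟩ i
    rw [Matrix.mulVec_diagonal]
    exact dvd_mul_right _ _
  · intro h
    choose y hy using h
    exact ⟨y, funext fun i => by rw [Matrix.mulVec_diagonal, hy]⟩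

/-! ### Column orders, coordinate constraints and partial kernels. -/

namespace GroupRelaxation

variable {m d : ℕ} (P : GroupRelaxation m d)

theorem r_dvd_maxModulus (i : Fin m) : P.r i ∣ P.maxModulus := by
  have : ∃ l ∈ (Finset.univ : Finset (Fin m)), Finset.univ.sup P.r = P.r l :=
    Finset.exists_mem_eq_sup _ ⟨i, Finset.mem_univ i⟩ _
  obtain ⟨l, -, hl⟩ := this
  have hle : ∀ j, P.r j ≤ P.r l := fun j => hl ▸ Finset.le_sup (Finset.mem_univ j)
  rw [maxModulus, hl]
  rcases le_total i l with h | h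
  · exact P.r_dvd _ _ h
  · rw [le_antisymm (hle i) (Nat.le_of_dvd (P.r_pos i) (P.r_dvd _ _ h))]

/-- For m = 0 every column is in the lattice, so the exclusion of such columns forces a row as soon
as there is a column. -/
theorem m_pos (P : GroupRelaxation m d) (j : Fin d) : 0 < m := by
  rcases Nat.eq_zero_or_pos m with rfl | h
  · exact absurd (mem_diagLattice.2 fun i => i.elim0) (P.col_notMem j)
  · exact h

theorem maxModulus_pos (hm : 0 < m) : 0 < P.maxModulus :=
  (P.r_pos ⟨0, hm⟩).trans_le (Finset.le_sup (Finset.mem_univ _))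

theorem zsmul_col_eq_zero (j : Fin d) (n : ℤ) :
    n • P.col j = 0 ↔ ∀ i, (P.r i : ℤ) ∣ n * P.A i j := by
  rw [col, ← QuotientAddGroup.mk_zsmul, QuotientAddGroup.eq_zero_iff, mem_diagLattice]
  rfl

theorem s_dvd_iff (j : Fin d) (n : ℤ) :
    (P.s j : ℤ) ∣ n ↔ ∀ i, (P.r i : ℤ) ∣ n * P.A i j := by
  rw [s, addOrderOf_dvd_iff_zsmul_eq_zero, zsmul_col_eq_zero]

theorem s_dvd_maxModulus (j : Fin d) : P.s j ∣ P.maxModulus := by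
  rw [← Int.natCast_dvd_natCast, s_dvd_iff]
  exact fun i => Dvd.dvd.mul_right (Int.natCast_dvd_natCast.2 (P.r_dvd_maxModulus i)) _

theorem s_pos (j : Fin d) : 0 < P.s j :=
  Nat.pos_of_dvd_of_pos (P.s_dvd_maxModulus j) (P.maxModulus_pos (P.m_pos j))

theorem one_lt_s (j : Fin d) : 1 < P.s j := by
  have h := P.s_pos j
  by_contra h'
  have h₁ : P.s j = 1 := by omega
  refine P.col_notMem j (mem_diagLattice.2 ?_)
  have := (P.s_dvd_iff j 1).1 (by rw [h₁]; norm_num)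
  simpa using this

instance (j : Fin d) : NeZero (P.s j) := ⟨(P.s_pos j).ne'⟩

/-- The hypothesis says in divisibility form that g is the gcd of N and the scaled column. With c =
N/g, c ∣ n means N ∣ n g, which unfolds to r_i ∣ n A_ij for all i, that is s_j ∣ n. -/
theorem ediv_eq_s {g : ℤ} (hg : 0 < g) (j : Fin d)
    (h : ∀ n e : ℤ, e ∣ n * g ↔ e ∣ n * P.maxModulus ∧
      ∀ i, e ∣ n * ((P.maxModulus / P.r i * P.A i j) % P.maxModulus)) :
    (P.maxModulus : ℤ) / g = P.s j := by
  have hN : (0 : ℤ) < P.maxModulus := by exact_mod_cast P.maxModulus_pos (P.m_pos j)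
  have hgN : g ∣ P.maxModulus := by simpa using ((h 1 g).1 (by simp)).1
  obtain ⟨c, hc⟩ := hgN
  have hdiv : (P.maxModulus : ℤ) / g = c := by rw [hc, Int.mul_ediv_cancel_left _ hg.ne']
  rw [hdiv]
  have hc₀ : 0 < c := by
    rw [hc] at hN
    exact pos_of_mul_pos_right hN hg.le
  have key : ∀ n : ℤ, (P.s j : ℤ) ∣ n ↔ c ∣ n := by
    intro n
    have h₁ : c ∣ n ↔ (P.maxModulus : ℤ) ∣ n * g := by
      rw [hc, mul_comm g c]
      exact (mul_dvd_mul_iff_right hg.ne').symm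
    rw [h₁, h, P.s_dvd_iff]
    rw [and_iff_right (dvd_mul_left _ _)]
    refine forall_congr' fun i => ?_
    obtain ⟨u, hu⟩ : (P.r i : ℤ) ∣ P.maxModulus := Int.natCast_dvd_natCast.2 (P.r_dvd_maxModulus i)
    have hr : (P.r i : ℤ) ≠ 0 := by exact_mod_cast (P.r_pos i).ne'
    have hu₀ : u ≠ 0 := by rintro rfl; rw [hu] at hN; simp at hN
    have h₂ : (P.maxModulus : ℤ) / P.r i = u := by rw [hu, Int.mul_ediv_cancel_left _ hr]
    have h₃ : (P.maxModulus : ℤ) ∣ n * (u * P.A i j % P.maxModulus) ↔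
        (P.maxModulus : ℤ) ∣ n * (u * P.A i j) := by
      conv_rhs => rw [← Int.emod_add_mul_ediv (u * P.A i j) P.maxModulus, mul_add]
      exact (dvd_add_left ((dvd_mul_right _ _).mul_left _)).symm
    rw [h₂, h₃, hu, show n * (u * P.A i j) = n * P.A i j * u by ring]
    exact (mul_dvd_mul_iff_right hu₀).symm
  exact Int.dvd_antisymm hc₀.le (by positivity) ((key _).1 dvd_rfl) ((key _).2 dvd_rfl)

/-- The `i`-th coordinate of `ℤ^m / R ℤ^m`. -/
noncomputable def coordHom (i : Fin m) : P.Target →+ ZMod (P.r i) :=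
  QuotientAddGroup.lift (diagLattice P.r)
    ((Int.castAddHom (ZMod (P.r i))).comp (Pi.evalAddMonoidHom _ i)) fun x hx => by
      simpa using (ZMod.intCast_zmod_eq_zero_iff_dvd (x i) (P.r i)).2 (mem_diagLattice.1 hx i)

/-- The `i`-th constraint. -/
noncomputable def rowHom (i : Fin m) : P.Ambient →+ ZMod (P.r i) :=
  (P.coordHom i).comp P.constraintHom

theorem rowHom_apply (i : Fin m) (x : P.Ambient) :
    P.rowHom i x = ∑ j, (P.A i j : ZMod (P.r i)) * ((x j).val : ZMod (P.r i)) := by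
  simp only [rowHom, constraintHom, AddMonoidHom.comp_apply, AddMonoidHom.finsetSum_apply, map_sum]
  refine Finset.sum_congr rfl fun j _ => ?_
  have : ∀ z : ZMod (P.s j), ZMod.lift (P.s j) ⟨zmultiplesHom P.Target (P.col j), P.s_zsmul_col j⟩ z
      = (z.val : ℤ) • P.col j := fun z => by
    have hz : z = ((z.val : ℤ) : ZMod (P.s j)) := by simp
    have := ZMod.lift_coe (P.s j) ⟨zmultiplesHom P.Target (P.col j), P.s_zsmul_col j⟩ (z.val : ℤ)
    rw [← hz] at this
    exact this
  rw [Pi.evalAddMonoidHom_apply, this, map_zsmul]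
  have : P.coordHom i (P.col j) = (P.A i j : ZMod (P.r i)) := rfl
  rw [this, zsmul_eq_mul, Int.cast_natCast, mul_comm]

theorem mem_compressedKernel_iff (x : P.Ambient) :
    x ∈ P.compressedKernel ↔ ∀ i, P.rowHom i x = 0 := by
  rw [compressedKernel, AddMonoidHom.mem_ker]
  simp only [rowHom, AddMonoidHom.comp_apply]
  generalize P.constraintHom x = y
  induction y using QuotientAddGroup.induction_on with
  | H y =>
    rw [QuotientAddGroup.eq_zero_iff, mem_diagLattice]
    exact forall_congr' fun i => (ZMod.intCast_zmod_eq_zero_iff_dvd (y i) (P.r i)).symm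

/-- The elements that satisfy the first `i` constraints. -/
noncomputable def partialKernel (n : ℕ) : AddSubgroup P.Ambient :=
  ⨅ i : Fin m, ⨅ _ : (i : ℕ) < n, (P.rowHom i).ker

theorem mem_partialKernel {n : ℕ} {x : P.Ambient} :
    x ∈ P.partialKernel n ↔ ∀ i : Fin m, (i : ℕ) < n → P.rowHom i x = 0 := by
  simp [partialKernel, AddSubgroup.mem_iInf]

theorem partialKernel_zero : P.partialKernel 0 = ⊤ := by
  ext x; simp [mem_partialKernel]

theorem partialKernel_m : P.partialKernel m = P.compressedKernel := by
  ext x; simp [mem_partialKernel, mem_compressedKernel_iff]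

theorem mem_partialKernel_succ {i : Fin m} {x : P.Ambient} :
    x ∈ P.partialKernel (i + 1) ↔ x ∈ P.partialKernel i ∧ P.rowHom i x = 0 := by
  simp only [mem_partialKernel]
  refine ⟨fun h => ⟨fun l hl => h l (by omega), h i (by omega)⟩, fun h l hl => ?_⟩
  rcases (Nat.lt_succ_iff.1 hl).eq_or_lt with hl | hl
  · rw [Fin.ext hl]; exact h.2
  · exact h.1 l hl

/-- One step of the kernel computation: `h` generates the elements that satisfy the first `i`
constraints, and the elements `(a x, h x)` together with `(r i, 0)` are transformed into `(0, h' x)`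
and `(g, z)` with `g ≠ 0`. -/
theorem closure_eq_partialKernel_succ {ι κ : Type*} (i : Fin m) (h : ι → P.Ambient)
    (hh : AddSubgroup.closure (Set.range h) = P.partialKernel i) (a : ι → ℤ)
    (ha : ∀ x, (a x : ZMod (P.r i)) = P.rowHom i (h x)) (h' : κ → P.Ambient) (g : ℤ) (hg : g ≠ 0)
    (z : P.Ambient)
    (H : ∀ U : AddSubgroup (ℤ × P.Ambient), ((g, z) ∈ U ∧ ∀ x, ((0 : ℤ), h' x) ∈ U) ↔
      (((P.r i : ℤ), (0 : P.Ambient)) ∈ U ∧ ∀ x, (a x, h x) ∈ U)) :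
    AddSubgroup.closure (Set.range h') = P.partialKernel (i + 1) := by
  have hsub : ∀ x, h x ∈ P.partialKernel i := fun x =>
    hh ▸ AddSubgroup.subset_closure ⟨x, rfl⟩
  let φ : ℤ × P.Ambient →+ ZMod (P.r i) :=
    (P.rowHom i).comp (AddMonoidHom.snd _ _) -
      (Int.castAddHom (ZMod (P.r i))).comp (AddMonoidHom.fst _ _)
  have hφ : ∀ y, φ y = P.rowHom i y.2 - (y.1 : ZMod (P.r i)) := fun y => rfl
  -- `U₁` collects the pairs whose integer represents the constraint value at the second entry. It
  -- contains the old rows, hence by `H` the new ones, so a row with first entry 0 satisfies the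
  -- constraint.
  let U₁ : AddSubgroup (ℤ × P.Ambient) := φ.ker ⊓ (P.partialKernel i).comap (AddMonoidHom.snd _ _)
  have hU₁ : ∀ y, y ∈ U₁ ↔ P.rowHom i y.2 = (y.1 : ZMod (P.r i)) ∧ y.2 ∈ P.partialKernel i :=
    fun y => by
      simp only [U₁, AddSubgroup.mem_inf, AddMonoidHom.mem_ker, hφ, sub_eq_zero,
        AddSubgroup.mem_comap]
      rfl
  have base : ((P.r i : ℤ), (0 : P.Ambient)) ∈ U₁ ∧ ∀ x, (a x, h x) ∈ U₁ := by
    refine ⟨(hU₁ _).2 ⟨by simp, AddSubgroup.zero_mem _⟩, fun x => (hU₁ _).2 ⟨(ha x).symm, hsub x⟩⟩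
  apply le_antisymm
  · rw [AddSubgroup.closure_le]
    rintro _ ⟨x, rfl⟩
    have := (hU₁ _).1 (((H U₁).2 base).2 x)
    exact P.mem_partialKernel_succ.2 ⟨this.2, by simpa using this.1⟩
  · intro y hy
    rw [P.mem_partialKernel_succ] at hy
    let G₀ : AddSubgroup (ℤ × P.Ambient) :=
      AddSubgroup.closure (insert ((P.r i : ℤ), (0 : P.Ambient)) (Set.range fun x => (a x, h x)))
    have hG₀ : ((P.r i : ℤ), (0 : P.Ambient)) ∈ G₀ ∧ ∀ x, (a x, h x) ∈ G₀ :=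
      ⟨AddSubgroup.subset_closure (Set.mem_insert _ _),
        fun x => AddSubgroup.subset_closure (Set.mem_insert_of_mem _ ⟨x, rfl⟩)⟩
    have hG₀le : ∀ U : AddSubgroup (ℤ × P.Ambient), (((P.r i : ℤ), (0 : P.Ambient)) ∈ U ∧
        ∀ x, (a x, h x) ∈ U) → G₀ ≤ U := fun U hU => by
      rw [AddSubgroup.closure_le, Set.insert_subset_iff]
      refine ⟨hU.1, ?_⟩
      rintro _ ⟨x, rfl⟩
      exact hU.2 x
    have h₁ : y ∈ G₀.map (AddMonoidHom.snd _ _) := by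
      have : P.partialKernel i ≤ G₀.map (AddMonoidHom.snd _ _) := by
        rw [← hh, AddSubgroup.closure_le]
        rintro _ ⟨x, rfl⟩
        exact ⟨_, hG₀.2 x, rfl⟩
      exact this hy.1
    obtain ⟨⟨b, y'⟩, hb, rfl⟩ := h₁
    change _ ∧ P.rowHom i y' = 0 at hy
    have h₂ := (hU₁ _).1 (hG₀le U₁ base hb)
    have hb₀ : (b : ZMod (P.r i)) = 0 := by
      rw [← h₂.1]; exact hy.2
    obtain ⟨c, rfl⟩ := (ZMod.intCast_zmod_eq_zero_iff_dvd b (P.r i)).1 hb₀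
    -- The first entry is a multiple of r_i because the constraint holds at `y'`; the row (r_i, 0)
    -- removes it.
    have h₃ : ((0 : ℤ), y') ∈ G₀ := by
      have := G₀.sub_mem hb (G₀.zsmul_mem hG₀.1 c)
      simpa [mul_comm] using this
    let K := AddSubgroup.closure (Set.range h')
    let U₃ : AddSubgroup (ℤ × P.Ambient) := AddSubgroup.zmultiples (g, z) ⊔ K.map (AddMonoidHom.inr _ _)
    have h₄ : G₀ ≤ U₃ := hG₀le U₃ ((H U₃).1 ⟨
      (le_sup_left : _ ≤ U₃) (AddSubgroup.mem_zmultiples _),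
      fun x => (le_sup_right : _ ≤ U₃) ⟨h' x, AddSubgroup.subset_closure ⟨x, rfl⟩, rfl⟩⟩)
    obtain ⟨u, hu, w, hw, huw⟩ := AddSubgroup.mem_sup.1 (h₄ h₃)
    obtain ⟨n, rfl⟩ := AddSubgroup.mem_zmultiples_iff.1 hu
    obtain ⟨w, hw, rfl⟩ := hw
    have e₁ := congrArg Prod.fst huw
    have e₂ := congrArg Prod.snd huw
    -- Comparing first entries gives n g = 0, and g ≠ 0 leaves no contribution of (g, z).
    simp only [Prod.fst_add, Prod.smul_fst, AddMonoidHom.inr_apply, add_zero, smul_eq_mul,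
      mul_eq_zero, hg, or_false, Prod.snd_add, Prod.smul_snd] at e₁ e₂
    rw [e₁, zero_smul, zero_add] at e₂
    exact e₂ ▸ hw

end GroupRelaxation

/-! ### Elimination with prescribed range, pivot and width. -/

namespace RAM

/-- `sweepProg` with the given range of rows, pivot row, pivot column and width. -/
def sweepWith (tr : Bool) (lo hi k col n : Tm) : Prog :=
  .seq (setVar tr 3 lo) (.seq (setVar tr 7 hi) (.seq (setVar tr 4 k) (.seq (setVar tr 5 col)
    (.seq (setVar tr 6 n) (sweepProg tr)))))

variable {tr : Bool} {X : ℕ} {s : St} {R : St → Prop}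

/-- Variables below 8 are scratch for the elimination and are overwritten one after another while
the parameters are evaluated. The parameter terms must therefore depend on variables from 8 upwards
only. -/
theorem spec_sweepWith (I : (ℤ → ℤ → ℤ) → Prop) {eLo eHi eK eCol eN : Tm} {k lo hi col n : ℤ}
    (h3 : ∀ v', (∀ x, 8 ≤ x → v' x = s.v x) → eLo.eval ⟨v', s.M, s.Q, s.D⟩ = lo)
    (h7 : ∀ v', (∀ x, 8 ≤ x → v' x = s.v x) → eHi.eval ⟨v', s.M, s.Q, s.D⟩ = hi)
    (h4 : ∀ v', (∀ x, 8 ≤ x → v' x = s.v x) → eK.eval ⟨v', s.M, s.Q, s.D⟩ = k)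
    (h5 : ∀ v', (∀ x, 8 ≤ x → v' x = s.v x) → eCol.eval ⟨v', s.M, s.Q, s.D⟩ = col)
    (h6 : ∀ v', (∀ x, 8 ≤ x → v' x = s.v x) → eN.eval ⟨v', s.M, s.Q, s.D⟩ = n)
    (hlo : 0 ≤ lo) (hlohi : lo ≤ hi) (hhiX : hi ≤ X) (hk : k < lo ∨ hi ≤ k) (hk₀ : 0 ≤ k)
    (hkX : k ≤ X) (hcol : 0 ≤ col) (hcoln : col < n)
    (hnX : n ≤ X) (hkr : Reduced (s.Q col) (s.M k col))
    (hr : ∀ a, lo ≤ a → a < hi → Reduced (s.Q col) (s.M a col))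
    (hQ : ∀ c, 0 ≤ c → c < n → c ≠ col → 0 < s.Q c) (hI : I s.M)
    (hsub : ∀ M q i, lo ≤ i → i < hi → I M → I (subRow s.Q k n i q M))
    (hswap : ∀ M i, lo ≤ i → i < hi → I M → I (swapRow k n i M))
    (h : ∀ v' M', (∀ x, 8 ≤ x → v' x = s.v x) → I M' → Swept s.Q k col lo hi s.M M' →
      R ⟨v', M', s.Q, s.D⟩) :
    Spec tr X (sweepWith tr eLo eHi eK eCol eN) s R := by
  have upd : ∀ (v' : ℕ → ℤ) (y : ℕ) (z : ℤ), y < 8 → (∀ x, 8 ≤ x → v' x = s.v x) →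
      ∀ x, 8 ≤ x → Function.update v' y z x = s.v x := fun v' y z hy hv x hx => by
    rw [Function.update_of_ne (by omega), hv x hx]
  have i0 : ∀ x, 8 ≤ x → s.v x = s.v x := fun _ _ => rfl
  have i3 := upd s.v 3 lo (by norm_num) i0
  have i7 := upd _ 7 hi (by norm_num) i3
  have i4 := upd _ 4 k (by norm_num) i7
  have i5 := upd _ 5 col (by norm_num) i4
  have e3 := h3 _ i0
  have e7 := h7 _ i3
  have e4 := h4 _ i7
  have e5 := h5 _ i4
  have e6 := h6 _ i5
  refine .seq (.setVar (by rw [e3]; exact len_le_self hlo (hlohi.trans hhiX)) ?_)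
  rw [e3]
  refine .seq (.setVar (by rw [e7]; exact len_le_self (hlo.trans hlohi) hhiX) ?_)
  rw [e7]
  refine .seq (.setVar (by rw [e4]; exact len_le_self hk₀ hkX) ?_)
  rw [e4]
  refine .seq (.setVar (by rw [e5]; exact len_le_self hcol (hcoln.le.trans hnX)) ?_)
  rw [e5]
  refine .seq (.setVar (by rw [e6]; exact len_le_self (by omega) hnX) ?_)
  rw [e6]
  refine spec_sweepProg I (k := k) (lo := lo) (hi := hi) (col := col) (n := n) (by simp) (by simp)
    (by simp) (by simp) (by simp) hlo hlohi hhiX hk hcol hcoln hnX hkr hr hQ hI hsub hswap ?_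
  intro v' M' hv hI' hsw
  exact h v' M' (fun x hx => (hv x (by omega)).trans (upd _ 6 n (by norm_num) i5 x hx)) hI' hsw

theorem len_emod_le {a b : ℤ} (hb : 0 < b) (h : len b ≤ X) : len (a % b) ≤ X :=
  (len_le_of_nonneg_of_le (Int.emod_nonneg _ hb.ne') (Int.emod_lt_of_pos _ hb).le).trans h

theorem exists_fin_of_lt {n : ℕ} {i : ℤ} (h₀ : 0 ≤ i) (h : i < n) : ∃ l : Fin n, i = l :=
  ⟨⟨i.toNat, by omega⟩, by simp [h₀]⟩

end RAM

/-! ### Computing the orders s_j. -/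

namespace GroupRelaxation

open RAM

variable {m d : ℕ} {P : GroupRelaxation m d} {X : ℕ} {s : St} {R : St → Prop}

variable (P X) in
/-- The numbers in the data of a group relaxation have bit length at most `X`. -/
structure Fits : Prop where
  m_le : (m : ℤ) ≤ X
  d_le : 2 * (d : ℤ) ≤ X
  A : ∀ i j, len (P.A i j) ≤ X
  r : ∀ i, len (P.r i) ≤ X
  N : len P.maxModulus ≤ X

variable (P) in
/-- The variables `8`, `9`, `10` contain `m`, `d` and the largest modulus, and the registers
contain the moduli and the matrix. -/
structure Loaded (s : St) : Prop where
  var_m : s.v 8 = m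
  var_d : s.v 9 = d
  N : s.v 10 = P.maxModulus
  r : ∀ i : Fin m, s.D (2 + i) = P.r i
  A : ∀ (i : Fin m) (j : Fin d), s.D (2 + m + i * d + j) = P.A i j

theorem Loaded.congr {s' : St} (h : Loaded P s) (h8 : s'.v 8 = s.v 8) (h9 : s'.v 9 = s.v 9)
    (h10 : s'.v 10 = s.v 10) (hD : s'.D = s.D) : Loaded P s' :=
  ⟨h8 ▸ h.var_m, h9 ▸ h.var_d, h10 ▸ h.N, hD ▸ h.r, hD ▸ h.A⟩

/-- Writes the `j`-th column of `A` (`j = 12`), scaled to the modulus `N`, and `N` itself into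
the first column of the matrix. -/
def columnProg : Prog :=
  .seq (setMat false (.var 8) 0 (.var 10)) (.seq (setVar false 14 0) (forTo false 14 (.var 8)
    (.seq (getData false 13 (2 + .var 14))
      (.seq (getData false 2 (2 + .var 8 + .var 14 * .var 9 + .var 12))
        (setMat false (.var 14) 0 (.var 10 / .var 13 * .var 2 % .var 10))))))

/-- Scaling row i by N/r_i turns congruences with different moduli into congruences modulo the
single number N, which is placed in row m as the pivot. -/
theorem spec_columnProg (hX : Fits P X) (hs : Loaded P s) (j : Fin d) (hj : s.v 12 = j)
    (h : ∀ v' M', (∀ x, x ≠ 2 → x ≠ 13 → x ≠ 14 → v' x = s.v x) → M' m 0 = (P.maxModulus : ℤ) →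
      (∀ i : Fin m, M' i 0 = P.maxModulus / P.r i * P.A i j % P.maxModulus) →
      (∀ a b, b ≠ 0 → M' a b = s.M a b) → R ⟨v', M', s.Q, s.D⟩) :
    Spec false X columnProg s R := by
  have hN : (0 : ℤ) < P.maxModulus := by exact_mod_cast P.maxModulus_pos (P.m_pos j)
  refine .seq (.setMat (by simpa [hs.N] using hX.N) (.seq (.setVar (by simp [len]) ?_)))
  refine .forTo (fun i s' => (∀ x, x ≠ 2 → x ≠ 13 → x ≠ 14 → s'.v x = s.v x) ∧ s'.Q = s.Q ∧
    s'.D = s.D ∧ s'.M m 0 = P.maxModulus ∧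
    (∀ l : Fin m, (l : ℤ) < i → s'.M l 0 = P.maxModulus / P.r l * P.A l j % P.maxModulus) ∧
    (∀ a b, b ≠ 0 → s'.M a b = s.M a b)) 0 m (by simp) (by positivity) le_rfl hX.m_le ?_ ?_ ?_ ?_
  · refine ⟨fun x h₁ h₂ h₃ => by simp [h₃], rfl, rfl, by simp [updateMat, hs.var_m, hs.N],
      fun l hl => by omega, fun a b hb => by simp [updateMat, hb]⟩
  · rintro i s' ⟨h₁, -⟩
    simpa [hs.var_m] using h₁ 8 (by norm_num) (by norm_num) (by norm_num)
  · rintro i s' hi₀ hi hx ⟨hv, hQ, hD, hMm, hM, hM'⟩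
    obtain ⟨l, rfl⟩ := exists_fin_of_lt hi₀ hi
    have hs' : Loaded P s' := hs.congr (hv 8 (by norm_num) (by norm_num) (by norm_num))
      (hv 9 (by norm_num) (by norm_num) (by norm_num))
      (hv 10 (by norm_num) (by norm_num) (by norm_num)) hD
    have e12 : s'.v 12 = j := (hv 12 (by norm_num) (by norm_num) (by norm_num)).trans hj
    have hr : s'.D ((2 + Tm.var 14 : Tm).eval s') = P.r l := by simp [hx, hs'.r]
    refine .seq (.getData (by simp [hx]; omega) (hr ▸ hX.r l) ?_)
    rw [hr]
    have hA : s'.D ((2 + .var 8 + .var 14 * .var 9 + .var 12 : Tm).eval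
      { s' with v := Function.update s'.v 13 (P.r l) }) = P.A l j := by
      simp [hx, hs'.var_m, hs'.var_d, e12, hs'.A]
    refine .seq (.getData (by simp [hx, hs'.var_m, hs'.var_d, e12]; positivity) (hA ▸ hX.A l j) ?_)
    dsimp only
    rw [hA]
    refine .setMat ?_ ⟨?_, ?_, hQ, hD, ?_, ?_, ?_⟩
    · simpa [hs'.N] using len_emod_le hN hX.N
    · simpa using hx
    · intro x h₁ h₂ h₃
      simpa [h₁, h₂, h₃] using hv x h₁ h₂ h₃
    · have : (m : ℤ) ≠ l := by omega
      simp [updateMat, hx, this, hMm]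
    · intro l' hl'
      simp only [updateMat, Tm.eval_var, Tm.eval_zero]
      by_cases hll : l' = l
      · subst hll
        simp [hx, hs'.N]
      · have h₁ : (l' : ℤ) ≠ l := fun h => hll (Fin.ext (by exact_mod_cast h))
        simp only [Function.update_of_ne (show (14 : ℕ) ≠ 2 by norm_num),
          Function.update_of_ne (show (14 : ℕ) ≠ 13 by norm_num), hx, h₁, false_and, if_false]
        exact hM l' (by omega)
    · intro a b hb
      simpa [updateMat, hb] using hM' a b hb
  · rintro ⟨v', M', Q', D'⟩ hx ⟨hv, hQ, hD, hMm, hM, hM'⟩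
    simp only at hv hQ hD hMm hM hM'
    subst hQ hD
    exact h v' M' hv hMm (fun i => hM i (by exact_mod_cast i.isLt)) hM'

/-- Computes `s_j` for `j = 12`. -/
def orderProg : Prog :=
  .seq columnProg (.seq (sweepWith false 0 (.var 8) (.var 8) 0 1)
    (setVec false (.var 9 + .var 12) (.var 10 / .mat (.var 8) 0)))

/-- Modulus 0 in column 0 makes the sweep an integer gcd computation. The other columns stay zero
because `kernelProg` later writes an identity matrix into them. -/
theorem spec_orderProg (hX : Fits P X) (hs : Loaded P s) (j : Fin d) (hj : s.v 12 = j)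
    (hQ : s.Q 0 = 0) (hM : ∀ a b, b ≠ 0 → s.M a b = 0)
    (h : ∀ v' M', (∀ x, 8 ≤ x → x ≠ 13 → x ≠ 14 → v' x = s.v x) →
      (∀ a b, b ≠ 0 → M' a b = 0) → R ⟨v', M', Function.update s.Q (d + j) (P.s j), s.D⟩) :
    Spec false X orderProg s R := by
  have hN : (0 : ℤ) < P.maxModulus := by exact_mod_cast P.maxModulus_pos (P.m_pos j)
  have hm := hX.m_le
  have hd := hX.d_le
  refine .seq (spec_columnProg hX hs j hj fun v₁ M₁ hv₁ hm₁ hM₁ hz₁ => .seq ?_)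
  have e8 : v₁ 8 = m := (hv₁ 8 (by norm_num) (by norm_num) (by norm_num)).trans hs.var_m
  have e9 : v₁ 9 = d := (hv₁ 9 (by norm_num) (by norm_num) (by norm_num)).trans hs.var_d
  have e10 : v₁ 10 = P.maxModulus := (hv₁ 10 (by norm_num) (by norm_num) (by norm_num)).trans hs.N
  have e12 : v₁ 12 = j := (hv₁ 12 (by norm_num) (by norm_num) (by norm_num)).trans hj
  have hmod : ∀ i : Fin m, 0 ≤ P.maxModulus / P.r i * P.A i j % P.maxModulus := fun i =>
    Int.emod_nonneg _ hN.ne'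
  refine spec_sweepWith (k := m) (lo := 0) (hi := m) (col := 0) (n := 1)
    -- Common divisors of all multiples of the column are preserved by row operations; this is the
    -- form that `ediv_eq_s` consumes.
    (fun M => (∀ n e : ℤ, (∀ a ∈ Set.Icc (0 : ℤ) m, n * M a 0 ∈ AddSubgroup.zmultiples e) ↔
      ∀ a ∈ Set.Icc (0 : ℤ) m, n * M₁ a 0 ∈ AddSubgroup.zmultiples e) ∧ ∀ a b, b ≠ 0 → M a b = 0)
    (fun _ _ => by simp) (fun v' hv => by simp [hv, e8]) (fun v' hv => by simp [hv, e8])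
    (fun _ _ => by simp) (fun _ _ => by simp) le_rfl (by positivity) hm (.inr le_rfl)
    (by positivity) hm le_rfl one_pos (by have := j.isLt; omega) ?_ ?_ (fun c h₁ h₂ h₃ => by omega)
    ⟨fun n e => Iff.rfl, fun a b hb => (hz₁ a b hb).trans (hM a b hb)⟩ ?_ ?_ ?_
  · dsimp only
    rw [hQ, hm₁]; exact ⟨hN.le, .inl rfl⟩
  · intro a h₁ h₂
    obtain ⟨i, rfl⟩ := exists_fin_of_lt h₁ h₂
    dsimp only
    rw [hQ, hM₁]
    exact ⟨hmod i, .inl rfl⟩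
  · rintro M q i h₁ h₂ ⟨hM₂, hz₂⟩
    refine ⟨fun n e => Iff.trans ?_ (hM₂ n e), fun a b hb => ?_⟩
    · refine forall_mem_iff_of_sub (S := Set.Icc (0 : ℤ) m) (k := m) (i := i)
        (x := fun a => n * M a 0) (by simp)
        ⟨h₁, h₂.le⟩ (by omega) q (fun a _ => ?_) _
      by_cases hai : a = i
      · subst hai
        simp [subRow, hQ]
        ring
      · simp [subRow, hai]
    · have : ¬ (a = i ∧ 0 ≤ b ∧ b < 1) := by omega
      simp only [subRow, this, if_false, hz₂ a b hb]
  · rintro M i h₁ h₂ ⟨hM₂, hz₂⟩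
    refine ⟨fun n e => Iff.trans ?_ (hM₂ n e), fun a b hb => ?_⟩
    · refine forall_mem_iff_of_swap (S := Set.Icc (0 : ℤ) m) (k := m) (i := i)
        (x := fun a => n * M a 0) (by simp)
        ⟨h₁, h₂.le⟩ (fun a _ => ?_) _
      simp [swapRow]
    · have : ¬ (0 ≤ b ∧ b < 1) := by omega
      simp only [swapRow, this, if_false, hz₂ a b hb]
  · rintro v₂ M₂ hv₂ ⟨hM₂, hz₂⟩ hsw
    have hpos : 0 < M₂ m 0 := by
      rcases hsw.pivot with hp | ⟨hp, -⟩
      · rw [hp]; exact hN.trans_eq hm₁.symm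
      · exact hp
    have hval : (.var 10 / .mat (.var 8) 0 : Tm).eval ⟨v₂, M₂, s.Q, s.D⟩ = P.s j := by
      simp only [Tm.eval_div, Tm.eval_var, Tm.eval_mat, Tm.eval_zero,
        hv₂ 8 (by norm_num), hv₂ 10 (by norm_num), e8, e10]
      refine P.ediv_eq_s hpos j fun n e => ?_
      have := hM₂ n e
      simp only [Int.mem_zmultiples_iff] at this
      constructor
      · intro he
        have h₁ := this.1 fun a ha => by
          rcases ha.2.eq_or_lt with rfl | ham
          · exact he
          · rw [hsw.zero a ha.1 ham, mul_zero]; exact dvd_zero e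
        refine ⟨hm₁ ▸ h₁ m (by simp), fun i => ?_⟩
        rw [← hM₁ i]
        exact h₁ i ⟨by positivity, by exact_mod_cast i.isLt.le⟩
      · rintro ⟨h₁, h₂⟩
        refine this.2 (fun a ha => ?_) m (by simp)
        rcases ha.2.eq_or_lt with rfl | ham
        · rwa [hm₁]
        · obtain ⟨i, rfl⟩ := exists_fin_of_lt ha.1 ham
          rw [hM₁]; exact h₂ i
    have hidx : (.var 9 + .var 12 : Tm).eval ⟨v₂, M₂, s.Q, s.D⟩ = d + j := by
      simp [hv₂, e9, e12]
    refine .setVec ?_ ?_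
    · rw [hval]
      refine (len_le_of_nonneg_of_le (by positivity) ?_).trans hX.N
      exact_mod_cast Nat.le_of_dvd (by exact_mod_cast hN) (P.s_dvd_maxModulus j)
    · rw [hval, hidx]
      exact h v₂ M₂ (fun x h₁ h₂ h₃ => (hv₂ x h₁).trans (hv₁ x (by omega) h₂ h₃)) hz₂

/-- Computes all `s_j`. -/
def ordersProg : Prog :=
  .seq (setVec false 0 0) (.seq (setVar false 12 0) (forTo false 12 (.var 9) orderProg))

theorem spec_ordersProg (hX : Fits P X) (hs : Loaded P s) (hd : 0 < d) (hM : s.M = 0)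
    (h : ∀ v' M' Q', Loaded P ⟨v', M', Q', s.D⟩ → (∀ a b, b ≠ 0 → M' a b = 0) →
      (∀ j : Fin d, Q' (d + j) = P.s j) → R ⟨v', M', Q', s.D⟩) :
    Spec false X ordersProg s R := by
  have hdX := hX.d_le
  refine .seq (.setVec (by simp [len]) (.seq (.setVar (by simp [len]) ?_)))
  refine .forTo (fun i s' => Loaded P s' ∧ s'.D = s.D ∧ s'.Q 0 = 0 ∧
    (∀ a b, b ≠ 0 → s'.M a b = 0) ∧ ∀ j : Fin d, (j : ℤ) < i → s'.Q (d + j) = P.s j) 0 d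
    (by simp) (by positivity) le_rfl (by omega) ?_ ?_ ?_ ?_
  · refine ⟨hs.congr (by simp) (by simp) (by simp) rfl, rfl, by simp, by simp [hM],
      fun j hj => by omega⟩
  · rintro i s' ⟨h₁, -⟩
    exact h₁.var_d
  · rintro i s' hi₀ hi hx ⟨h₁, hD, hQ, hM, hs'⟩
    obtain ⟨l, rfl⟩ := exists_fin_of_lt hi₀ hi
    refine spec_orderProg hX h₁ l hx hQ hM fun v' M' hv hM' => ⟨?_, ?_, hD, ?_, hM', ?_⟩
    · exact (hv 12 (by norm_num) (by norm_num) (by norm_num)).trans hx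
    · refine h₁.congr ?_ ?_ ?_ rfl <;> simp [hv]
    · have : (0 : ℤ) ≠ d + l := by omega
      simp [Function.update_of_ne this, hQ]
    · intro j hj
      dsimp only
      by_cases hjl : j = l
      · subst hjl; simp
      · have h₁ : (d + j : ℤ) ≠ d + l := fun h => hjl (Fin.ext (by omega))
        rw [Function.update_of_ne h₁]
        exact hs' j (by omega)
  · rintro ⟨v', M', Q', D'⟩ hx ⟨h₁, hD, hQ, hM, hs'⟩
    simp only at hD hQ hM hs'
    subst hD
    exact h v' M' Q' h₁ hM fun j => hs' j (by exact_mod_cast j.isLt)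

end GroupRelaxation

/-! ### Computing generators of the compressed kernel. -/

namespace GroupRelaxation

open RAM

variable {m d : ℕ} {P : GroupRelaxation m d} {X : ℕ} {s : St} {R : St → Prop}

variable (P) in
/-- The element of the ambient group in row `a` and the columns `d, …, 2d - 1`. -/
noncomputable def rowElt (M : ℤ → ℤ → ℤ) (a : ℤ) : P.Ambient := fun j => ((M a (d + j) : ℤ) : ZMod (P.s j))

variable (P) in
/-- The entries in row `a` and the columns `d, …, 2d - 1` are reduced. -/
def RowReduced (M : ℤ → ℤ → ℤ) (a : ℤ) : Prop :=
  ∀ j : Fin d, 0 ≤ M a (d + j) ∧ M a (d + j) < P.s j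

theorem RowReduced.val_rowElt {M : ℤ → ℤ → ℤ} {a : ℤ} (h : RowReduced P M a) (j : Fin d) :
    ((rowElt P M a j).val : ℤ) = M a (d + j) := by
  rw [rowElt, ZMod.val_intCast, Int.emod_eq_of_lt (h j).1 (h j).2]

section
variable {Q : ℤ → ℤ} {k i n q : ℤ} {M : ℤ → ℤ → ℤ}

theorem rowElt_subRow (hQ : ∀ j : Fin d, Q (d + j) = P.s j) (hn : n = 2 * d) (a : ℤ) :
    rowElt P (subRow Q k n i q M) a =
      if a = i then rowElt P M i - q • rowElt P M k else rowElt P M a := by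
  by_cases hai : a = i
  · subst hai
    rw [if_pos rfl]
    funext j
    have : (0 : ℤ) ≤ d + j ∧ (d + j : ℤ) < n := by omega
    simp [rowElt, subRow, hQ, this]
  · rw [if_neg hai]
    funext j
    simp [rowElt, subRow, hai]

theorem rowElt_swapRow (hn : n = 2 * d) (a : ℤ) :
    rowElt P (swapRow k n i M) a = rowElt P M (Equiv.swap k i a) := by
  funext j
  have : (0 : ℤ) ≤ d + j ∧ (d + j : ℤ) < n := by omega
  simp [rowElt, swapRow, this]

theorem RowReduced.subRow (hQ : ∀ j : Fin d, Q (d + j) = P.s j) (hn : n = 2 * d) {a : ℤ}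
    (h : RowReduced P M a) : RowReduced P (subRow Q k n i q M) a := by
  intro j
  have hj : (0 : ℤ) ≤ d + j ∧ (d + j : ℤ) < n := by omega
  have hs : (0 : ℤ) < P.s j := by exact_mod_cast P.s_pos j
  by_cases hai : a = i
  · subst hai
    simp only [RAM.subRow, hj, and_true, if_true, hQ]
    exact ⟨Int.emod_nonneg _ hs.ne', Int.emod_lt_of_pos _ hs⟩
  · simpa [RAM.subRow, hai] using h j

theorem RowReduced.swapRow (hn : n = 2 * d) {a : ℤ} (h : RowReduced P M (Equiv.swap k i a)) :
    RowReduced P (swapRow k n i M) a := by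
  intro j
  have hj : (0 : ℤ) ≤ d + j ∧ (d + j : ℤ) < n := by omega
  simpa [RAM.swapRow, hj] using h j

theorem swap_mem_Icc {b a : ℤ} (hk : k ∈ Set.Icc 0 b) (hi : i ∈ Set.Icc 0 b)
    (ha : a ∈ Set.Icc 0 b) : Equiv.swap k i a ∈ Set.Icc 0 b := by
  rw [Equiv.swap_apply_def]; split_ifs <;> assumption

theorem forall_mem_Icc_iff {p : ℤ → Prop} :
    (∀ a ∈ Set.Icc (0 : ℤ) d, p a) ↔ p d ∧ ∀ x : Fin d, p x := by
  refine ⟨fun h => ⟨h d (by simp), fun x => h x ⟨by positivity, by omega⟩⟩, fun h a ha => ?_⟩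
  rcases ha.2.eq_or_lt with rfl | had
  · exact h.1
  · obtain ⟨l, rfl⟩ := exists_fin_of_lt ha.1 had
    exact h.2 l

end

/-- Computes the value of row `i = 15` of `A` at the vector in row `12`, modulo the number in
variable `13`. -/
def dotProg : Prog :=
  .seq (setVar false 2 0) (.seq (setVar false 14 0) (forTo false 14 (.var 9)
    (.seq (getData false 1 (2 + .var 8 + .var 15 * .var 9 + .var 14))
      (setVar false 2 ((.var 2 + .var 1 * .mat (.var 12) (.var 9 + .var 14)) % .var 13)))))

theorem spec_dotProg (hX : Fits P X) (hs : Loaded P s) (i : Fin m) (hi : s.v 15 = i)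
    (hr : s.v 13 = P.r i) (hrow : RowReduced P s.M (s.v 12))
    (h : ∀ v', (∀ x, x ≠ 1 → x ≠ 2 → x ≠ 14 → v' x = s.v x) → 0 ≤ v' 2 → len (v' 2) ≤ X →
      ((v' 2 : ℤ) : ZMod (P.r i)) = P.rowHom i (rowElt P s.M (s.v 12)) →
      R ⟨v', s.M, s.Q, s.D⟩) :
    Spec false X dotProg s R := by
  have hdX := hX.d_le
  have hr₀ : (0 : ℤ) < P.r i := by exact_mod_cast P.r_pos i
  refine .seq (.setVar (by simp [len]) (.seq (.setVar (by simp [len]) ?_)))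
  refine .forTo (fun c s' => (∀ x, x ≠ 1 → x ≠ 2 → x ≠ 14 → s'.v x = s.v x) ∧ s'.M = s.M ∧
    s'.Q = s.Q ∧ s'.D = s.D ∧ 0 ≤ s'.v 2 ∧ len (s'.v 2) ≤ X ∧ ((s'.v 2 : ℤ) : ZMod (P.r i)) =
      ∑ j ∈ Finset.univ.filter (fun j : Fin d => (j : ℤ) < c),
        (P.A i j : ZMod (P.r i)) * (s.M (s.v 12) (d + j) : ZMod (P.r i))) 0 d
    (by simp) (by positivity) le_rfl (by omega) ?_ ?_ ?_ ?_
  · refine ⟨fun x h₁ h₂ h₃ => by simp [h₂, h₃], rfl, rfl, rfl, by simp, by simp [len], ?_⟩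
    rw [Finset.filter_false_of_mem (fun j _ => by omega)]
    simp
  · rintro c s' ⟨h₁, -⟩
    simpa [hs.var_d] using h₁ 9 (by norm_num) (by norm_num) (by norm_num)
  · rintro c s' hc₀ hc hx ⟨hv, hM, hQ, hD, -, -, hsum⟩
    obtain ⟨l, rfl⟩ := exists_fin_of_lt hc₀ hc
    have hs' : Loaded P s' := hs.congr (hv 8 (by norm_num) (by norm_num) (by norm_num))
      (hv 9 (by norm_num) (by norm_num) (by norm_num))
      (hv 10 (by norm_num) (by norm_num) (by norm_num)) hD
    have e12 : s'.v 12 = s.v 12 := hv 12 (by norm_num) (by norm_num) (by norm_num)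
    have e13 : s'.v 13 = P.r i := (hv 13 (by norm_num) (by norm_num) (by norm_num)).trans hr
    have e15 : s'.v 15 = i := (hv 15 (by norm_num) (by norm_num) (by norm_num)).trans hi
    have hA : s'.D ((2 + .var 8 + .var 15 * .var 9 + .var 14 : Tm).eval s') = P.A i l := by
      simp [hx, hs'.var_m, hs'.var_d, e15, hs'.A]
    refine .seq (.getData (by simp [hx, hs'.var_m, hs'.var_d, e15]; positivity)
      (hA ▸ hX.A i l) ?_)
    rw [hA]
    have hval : ((.var 2 + .var 1 * .mat (.var 12) (.var 9 + .var 14)) % .var 13 : Tm).eval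
        { s' with v := Function.update s'.v 1 (P.A i l) } =
        (s'.v 2 + P.A i l * s.M (s.v 12) (d + l)) % P.r i := by
      simp [hM, e12, hs'.var_d, hx, e13]
    refine .setVar (by rw [hval]; exact len_emod_le hr₀ (hX.r i))
      ⟨by simpa using hx, ?_, hM, hQ, hD, ?_, ?_, ?_⟩
    · intro x h₁ h₂ h₃
      simpa [h₁, h₂, h₃] using hv x h₁ h₂ h₃
    · rw [hval]; simpa using Int.emod_nonneg _ hr₀.ne'
    · rw [hval]; simpa using len_emod_le hr₀ (hX.r i)
    · rw [hval]
      have hins : Finset.univ.filter (fun j : Fin d => (j : ℤ) < l + 1) =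
          insert l (Finset.univ.filter (fun j : Fin d => (j : ℤ) < l)) := by
        ext j
        simp only [Finset.mem_filter, Finset.mem_univ, true_and, Finset.mem_insert, Fin.ext_iff]
        omega
      rw [hins, Finset.sum_insert (by simp)]
      simp [hsum, add_comm]
  · rintro ⟨v', M', Q', D'⟩ hx ⟨hv, hM, hQ, hD, h₀, hl, hsum⟩
    simp only at hv hM hQ hD h₀ hl hsum
    subst hM hQ hD
    refine h v' hv h₀ hl ?_
    rw [hsum, Finset.filter_true_of_mem (fun j _ => by omega), P.rowHom_apply]
    refine Finset.sum_congr rfl fun j _ => ?_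
    rw [← hrow.val_rowElt j, Int.cast_natCast]

/-- Computes the values of row `i = 15` of `A` at all generators. -/
def dotsProg : Prog :=
  .seq (setVar false 12 0) (forTo false 12 (.var 9)
    (.seq dotProg (setMat false (.var 12) 0 (.var 2))))

theorem spec_dotsProg (hX : Fits P X) (hs : Loaded P s) (hd : 0 < d) (i : Fin m)
    (hi : s.v 15 = i) (hr : s.v 13 = P.r i) (hrow : ∀ x : Fin d, RowReduced P s.M x)
    (h : ∀ v' M', (∀ x, x ≠ 1 → x ≠ 2 → x ≠ 12 → x ≠ 14 → v' x = s.v x) →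
      (∀ x : Fin d, 0 ≤ M' x 0 ∧
        ((M' x 0 : ℤ) : ZMod (P.r i)) = P.rowHom i (rowElt P s.M x)) →
      (∀ a b, b ≠ 0 → M' a b = s.M a b) → R ⟨v', M', s.Q, s.D⟩) :
    Spec false X dotsProg s R := by
  have hdX := hX.d_le
  refine .seq (.setVar (by simp [len]) ?_)
  refine .forTo (fun c s' => (∀ x, x ≠ 1 → x ≠ 2 → x ≠ 12 → x ≠ 14 → s'.v x = s.v x) ∧
    s'.Q = s.Q ∧ s'.D = s.D ∧ (∀ x : Fin d, (x : ℤ) < c → 0 ≤ s'.M x 0 ∧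
        ((s'.M x 0 : ℤ) : ZMod (P.r i)) = P.rowHom i (rowElt P s.M x)) ∧
      (∀ a b, b ≠ 0 → s'.M a b = s.M a b)) 0 d
    (by simp) (by positivity) le_rfl (by omega) ?_ ?_ ?_ ?_
  · exact ⟨fun x h₁ h₂ h₃ h₄ => by simp [h₃], rfl, rfl, fun x hx => by omega, fun _ _ _ => rfl⟩
  · rintro c s' ⟨h₁, -⟩
    simpa [hs.var_d] using h₁ 9 (by norm_num) (by norm_num) (by norm_num) (by norm_num)
  · rintro c s' hc₀ hc hx ⟨hv, hQ, hD, hM, hM'⟩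
    obtain ⟨l, rfl⟩ := exists_fin_of_lt hc₀ hc
    have hv' : ∀ x, 8 ≤ x → x ≠ 12 → x ≠ 14 → s'.v x = s.v x :=
      fun x h₁ h₂ h₃ => hv x (by omega) (by omega) h₂ h₃
    have hs' : Loaded P s' := hs.congr (hv' 8 (by norm_num) (by norm_num) (by norm_num))
      (hv' 9 (by norm_num) (by norm_num) (by norm_num))
      (hv' 10 (by norm_num) (by norm_num) (by norm_num)) hD
    have hcol : ∀ j : Fin d, (d + j : ℤ) ≠ 0 := fun j => by omega
    have hred : RowReduced P s'.M (s'.v 12) := fun j => by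
      rw [hx, hM' _ _ (hcol j)]; exact hrow l j
    have hel : rowElt P s'.M (s'.v 12) = rowElt P s.M l := by
      funext j
      rw [rowElt, rowElt, hx, hM' _ _ (hcol j)]
    refine .seq (spec_dotProg hX hs' i ((hv' 15 (by norm_num) (by norm_num) (by norm_num)).trans hi)
      ((hv' 13 (by norm_num) (by norm_num) (by norm_num)).trans hr) hred
      fun v₁ hv₁ h₀ hl hval => .setMat hl ⟨?_, ?_, hQ, hD, ?_, ?_⟩)
    · exact (hv₁ 12 (by norm_num) (by norm_num) (by norm_num)).trans hx
    · intro x h₁ h₂ h₃ h₄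
      simpa [h₃] using (hv₁ x h₁ h₂ h₄).trans (hv x h₁ h₂ h₃ h₄)
    · intro x hxl
      have e12 : v₁ 12 = l := (hv₁ 12 (by norm_num) (by norm_num) (by norm_num)).trans hx
      simp only [updateMat, Tm.eval_var, Tm.eval_zero, e12]
      by_cases hxl' : x = l
      · subst hxl'
        rw [if_pos (by simp)]
        exact ⟨h₀, hval.trans (by rw [hel])⟩
      · rw [if_neg (fun h => hxl' (Fin.ext (by exact_mod_cast h.1)))]
        exact hM x (by have : (x : ℕ) ≠ l := fun h => hxl' (Fin.ext h)
                       omega)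
    · intro a b hb
      simpa [updateMat, hb] using hM' a b hb
  · rintro ⟨v', M', Q', D'⟩ hx ⟨hv, hQ, hD, hM, hM'⟩
    simp only at hv hQ hD hM hM'
    subst hQ hD
    exact h v' M' hv (fun x => hM x (by exact_mod_cast x.isLt)) hM'

/-- Writes the number in variable `13` and zeros into row `d`. -/
def pivotRowProg : Prog :=
  .seq (setVar false 12 0) (.seq (forTo false 12 (2 * .var 9) (setMat false (.var 9) (.var 12) 0))
    (setMat false (.var 9) 0 (.var 13)))

theorem spec_pivotRowProg (hX : Fits P X) (hs : Loaded P s) (hd : 0 < d)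
    (h : ∀ v' M', (∀ x, x ≠ 12 → v' x = s.v x) → M' d 0 = s.v 13 →
      (∀ b, 0 < b → b < 2 * (d : ℤ) → M' d b = 0) →
      (∀ a : ℤ, a ≠ d → M' a = s.M a) → R ⟨v', M', s.Q, s.D⟩) :
    Spec false X pivotRowProg s R := by
  have hdX := hX.d_le
  refine .seq (.setVar (by simp [len]) (.seq ?_))
  refine .forTo (fun c s' => (∀ x, x ≠ 12 → s'.v x = s.v x) ∧
    s'.Q = s.Q ∧ s'.D = s.D ∧ (∀ b, 0 ≤ b → b < c → s'.M d b = 0) ∧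
      (∀ a : ℤ, a ≠ d → s'.M a = s.M a)) 0 (2 * d)
    (by simp) (by positivity) le_rfl hdX ?_ ?_ ?_ ?_
  · exact ⟨fun x h₁ => by simp [h₁], rfl, rfl, fun b _ _ => by omega, fun _ _ => rfl⟩
  · rintro c s' ⟨h₁, -⟩
    simp [h₁ 9 (by norm_num), hs.var_d]
  · rintro c s' hc₀ hc hx ⟨hv, hQ, hD, hM, hM'⟩
    have e9 : s'.v 9 = d := (hv 9 (by norm_num)).trans hs.var_d
    refine .setMat (by simp [len]) ⟨hx, ?_, hQ, hD, ?_, ?_⟩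
    · intro x h₁
      simpa [h₁] using hv x h₁
    · intro b hb hbc
      simp only [updateMat, Tm.eval_var, Tm.eval_zero, e9, hx]
      by_cases hbc' : b = c
      · simp [hbc']
      · simpa [hbc'] using hM b hb (by omega)
    · intro a ha
      funext b
      simp [updateMat, e9, ha, hM']
  · rintro ⟨v', M', Q', D'⟩ hx ⟨hv, hQ, hD, hM, hM'⟩
    simp only at hv hQ hD hM hM'
    subst hQ hD
    have e9 : v' 9 = d := (hv 9 (by norm_num)).trans hs.var_d
    refine .of_lenLE fun hlen => .setMat (hlen.v 13) ?_
    refine h v' _ hv ?_ ?_ ?_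
    · simp [updateMat, e9, hv 13]
    · intro b h₁ h₂
      simpa [updateMat, h₁.ne'] using hM b h₁.le h₂
    · intro a ha
      funext b
      simp [updateMat, e9, ha, hM']

/-- Passes from generators of the elements that satisfy the first `i` constraints to generators of
the elements that satisfy the first `i + 1` constraints, `i = 15`. -/
def constraintProg : Prog :=
  .seq (getData false 13 (2 + .var 15)) (.seq dotsProg (.seq pivotRowProg
    (sweepWith false 0 (.var 9) (.var 9) 0 (2 * .var 9))))

/-- Row x holds h_x in the columns from d on and its constraint value in column 0; row d holds (r_i,
0). Sweeping column 0 over the integers produces the situation of `closure_eq_partialKernel_succ`,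
and the leftover row (g, z) is dropped by being overwritten in the next step. -/
theorem spec_constraintProg (hX : Fits P X) (hs : Loaded P s) (hd : 0 < d) (i : Fin m)
    (hi : s.v 15 = i) (hQ₀ : s.Q 0 = 0) (hQ₁ : ∀ c : ℤ, 0 < c → c < d → s.Q c = P.maxModulus)
    (hQ₂ : ∀ j : Fin d, s.Q (d + j) = P.s j) (hrow : ∀ x : Fin d, RowReduced P s.M x)
    (hK : AddSubgroup.closure (Set.range fun x : Fin d => rowElt P s.M x) = P.partialKernel i)
    (h : ∀ v' M', (∀ x, 8 ≤ x → x ≠ 12 → x ≠ 13 → x ≠ 14 → v' x = s.v x) →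
      (∀ x : Fin d, RowReduced P M' x) →
      AddSubgroup.closure (Set.range fun x : Fin d => rowElt P M' x) = P.partialKernel (i + 1) →
      R ⟨v', M', s.Q, s.D⟩) :
    Spec false X constraintProg s R := by
  have hdX := hX.d_le
  have hN : (0 : ℤ) < P.maxModulus := by exact_mod_cast P.maxModulus_pos (P.m_pos ⟨0, hd⟩)
  have hr₀ : (0 : ℤ) < P.r i := by exact_mod_cast P.r_pos i
  have hri : s.D ((2 + .var 15 : Tm).eval s) = P.r i := by simp [hi, hs.r]
  refine .seq (.getData (by simp [hi]; positivity) (hri ▸ hX.r i) ?_)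
  rw [hri]
  refine .seq (spec_dotsProg hX (hs.congr (by simp) (by simp) (by simp) rfl) hd i (by simpa using hi)
    (by simp) hrow fun v₁ M₁ hv₁ hM₁ hM₁' => ?_)
  have hv₁' : ∀ x, 8 ≤ x → x ≠ 12 → x ≠ 13 → x ≠ 14 → v₁ x = s.v x := fun x h₁ h₂ h₃ h₄ => by
    simpa [h₃] using hv₁ x (by omega) (by omega) h₂ h₄
  have hs₁ : Loaded P ⟨v₁, M₁, s.Q, s.D⟩ := hs.congr (hv₁' 8 (by norm_num) (by norm_num)
    (by norm_num) (by norm_num)) (hv₁' 9 (by norm_num) (by norm_num) (by norm_num) (by norm_num))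
      (hv₁' 10 (by norm_num) (by norm_num) (by norm_num) (by norm_num)) rfl
  refine .seq (spec_pivotRowProg hX hs₁ hd fun v₂ M₂ hv₂ hp₀ hp hM₂ => ?_)
  dsimp only at hp₀ hp hM₂ hv₂ hM₁ hM₁'
  have e13 : v₁ 13 = P.r i := by
    simpa using hv₁ 13 (by norm_num) (by norm_num) (by norm_num) (by norm_num)
  have e9 : v₂ 9 = d := (hv₂ 9 (by norm_num)).trans hs₁.var_d
  rw [e13] at hp₀
  have hcol : ∀ j : Fin d, (d + j : ℤ) ≠ 0 := fun j => by omega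
  have hne : ∀ x : Fin d, (x : ℤ) ≠ d := fun x => by omega
  have hrow₂ : ∀ x : Fin d, rowElt P M₂ x = rowElt P s.M x := fun x => by
    funext j
    rw [rowElt, rowElt, hM₂ _ (hne x), hM₁' _ _ (hcol j)]
  have hrowd : rowElt P M₂ d = 0 := by
    funext j
    rw [rowElt, hp _ (by omega) (by omega)]
    simp
  have hred₂ : ∀ a ∈ Set.Icc (0 : ℤ) d, RowReduced P M₂ a := by
    rw [forall_mem_Icc_iff]
    refine ⟨fun j => ?_, fun x j => ?_⟩
    · rw [hp _ (by omega) (by omega)]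
      exact ⟨le_rfl, by exact_mod_cast P.s_pos j⟩
    · rw [hM₂ _ (hne x), hM₁' _ _ (hcol j)]; exact hrow x j
  have hd0 : (0 : ℤ) < 2 * d := by positivity
  refine spec_sweepWith (k := d) (lo := 0) (hi := d) (col := 0) (n := 2 * d)
    (fun M => (∀ U : AddSubgroup (ℤ × P.Ambient),
      (∀ a ∈ Set.Icc (0 : ℤ) d, (M a 0, rowElt P M a) ∈ U) ↔
        ∀ a ∈ Set.Icc (0 : ℤ) d, (M₂ a 0, rowElt P M₂ a) ∈ U) ∧
      ∀ a ∈ Set.Icc (0 : ℤ) d, RowReduced P M a)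
    (fun _ _ => by simp) (fun v' hv => by simp [hv, e9]) (fun v' hv => by simp [hv, e9])
    (fun _ _ => by simp) (fun v' hv => by simp [hv, e9]) le_rfl (by positivity) (by omega)
    (.inr le_rfl) (by positivity) (by omega) le_rfl (by positivity) hdX ?_ ?_ ?_
    ⟨fun U => Iff.rfl, hred₂⟩ ?_ ?_ ?_
  · dsimp only
    rw [hQ₀, hp₀]; exact ⟨hr₀.le, .inl rfl⟩
  · intro a h₁ h₂
    obtain ⟨x, rfl⟩ := exists_fin_of_lt h₁ h₂
    dsimp only
    rw [hQ₀, hM₂ _ (hne x)]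
    exact ⟨(hM₁ x).1, .inl rfl⟩
  · intro c h₁ h₂ h₃
    dsimp only
    by_cases hcd : c < d
    · rw [hQ₁ c (by omega) hcd]; exact hN
    · obtain ⟨j, hj⟩ := exists_fin_of_lt (n := d) (i := c - d) (by omega) (by omega)
      have : c = d + j := by omega
      rw [this, hQ₂]
      exact_mod_cast P.s_pos j
  · rintro M q l h₁ h₂ ⟨hM, hred⟩
    refine ⟨fun U => Iff.trans ?_ (hM U), fun a ha => (hred a ha).subRow hQ₂ rfl⟩
    refine forall_mem_iff_of_sub (S := Set.Icc (0 : ℤ) d) (k := d) (i := l)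
      (x := fun a => (M a 0, rowElt P M a)) (by simp) ⟨h₁, h₂.le⟩ (by omega) q (fun a _ => ?_) _
    rw [rowElt_subRow hQ₂ rfl]
    by_cases hal : a = l
    · subst hal
      simp only [if_true, subRow, le_refl, hd0, and_self, hQ₀, Int.emod_zero]
      rfl
    · simp [subRow, hal]
  · rintro M l h₁ h₂ ⟨hM, hred⟩
    have hl : l ∈ Set.Icc (0 : ℤ) d := ⟨h₁, h₂.le⟩
    have hk : (d : ℤ) ∈ Set.Icc (0 : ℤ) d := by simp
    refine ⟨fun U => Iff.trans ?_ (hM U),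
      fun a ha => (hred _ (swap_mem_Icc hk hl ha)).swapRow rfl⟩
    refine forall_mem_iff_of_swap (S := Set.Icc (0 : ℤ) d) (k := d) (i := l)
      (x := fun a => (M a 0, rowElt P M a)) hk hl (fun a _ => ?_) _
    rw [rowElt_swapRow rfl]
    simp only [swapRow, le_refl, hd0, and_self, if_true]
  · rintro v₃ M₃ hv₃ ⟨hM₃, hred₃⟩ hsw
    refine h v₃ M₃ (fun x h₁ h₂ h₃ h₄ => ((hv₃ x h₁).trans (hv₂ x h₂)).trans (hv₁' x h₁ h₂ h₃ h₄))
      (forall_mem_Icc_iff.1 hred₃).2 ?_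
    have hpos : 0 < M₃ d 0 := by
      rcases hsw.pivot with hp' | ⟨hp', -⟩
      · rw [hp']; exact hr₀.trans_eq hp₀.symm
      · exact hp'
    refine P.closure_eq_partialKernel_succ i (fun x : Fin d => rowElt P s.M x) hK
      (fun x => M₂ x 0) (fun x => ?_) _ (M₃ d 0) hpos.ne' (rowElt P M₃ d) fun U => ?_
    · rw [hM₂ _ (hne x)]; exact (hM₁ x).2
    · have := hM₃ U
      rw [forall_mem_Icc_iff, forall_mem_Icc_iff, hp₀, hrowd] at this
      have hz : ∀ x : Fin d, M₃ x 0 = 0 := fun x => hsw.zero x (by positivity) (by omega)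
      simpa only [hz, hrow₂] using this

/-- Computes generators of the compressed kernel. -/
def kernelProg : Prog :=
  .seq (setVar false 12 0) (.seq (forTo false 12 (.var 9)
      (.seq (setMat false (.var 12) (.var 9 + .var 12) 1) (setVec false (.var 12) (.var 10))))
    (.seq (setVec false 0 0) (.seq (setVar false 15 0) (forTo false 15 (.var 8) constraintProg))))

theorem spec_kernelProg (hX : Fits P X) (hs : Loaded P s) (hd : 0 < d)
    (hM : ∀ a b, b ≠ 0 → s.M a b = 0) (hQ : ∀ j : Fin d, s.Q (d + j) = P.s j)
    (h : ∀ v' M' Q', Loaded P ⟨v', M', Q', s.D⟩ → (∀ x : Fin d, RowReduced P M' x) →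
      AddSubgroup.closure (Set.range fun x : Fin d => rowElt P M' x) = P.compressedKernel →
      (∀ c : ℤ, 0 < c → c < d → Q' c = P.maxModulus) →
      (∀ j : Fin d, Q' (d + j) = P.s j) → R ⟨v', M', Q', s.D⟩) :
    Spec false X kernelProg s R := by
  have hdX := hX.d_le
  refine .seq (.setVar (by simp [len]) (.seq ?_))
  refine .forTo (fun c s' => (∀ x, x ≠ 12 → s'.v x = s.v x) ∧ s'.D = s.D ∧
    (∀ a b, b ≠ 0 → s'.M a b = if 0 ≤ a ∧ a < c ∧ b = d + a then 1 else 0) ∧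
    (∀ b, 0 ≤ b → b < c → s'.Q b = P.maxModulus) ∧ (∀ j : Fin d, s'.Q (d + j) = P.s j)) 0 d
    (by simp) (by positivity) le_rfl (by omega) ?_ ?_ ?_ ?_
  · refine ⟨fun x hx => by simp [hx], rfl, fun a b hb => ?_, fun b _ _ => by omega, hQ⟩
    rw [if_neg (by omega)]
    exact hM a b hb
  · rintro c s' ⟨h₁, -⟩
    simpa [hs.var_d] using h₁ 9 (by norm_num)
  · rintro c s' hc₀ hc hx ⟨hv, hD, hM', hQ', hQ''⟩
    have e9 : s'.v 9 = d := (hv 9 (by norm_num)).trans hs.var_d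
    have e10 : s'.v 10 = P.maxModulus := (hv 10 (by norm_num)).trans hs.N
    refine .seq (.setMat (len_le_self (by simp) (by simp; omega)) (.setVec (by simpa [e10] using hX.N)
      ⟨hx, fun x hx' => by simpa [hx'] using hv x hx', hD, fun a b hb => ?_, fun b hb₀ hb => ?_,
        fun j => ?_⟩))
    · simp only [updateMat, Tm.eval_var, Tm.eval_add, Tm.eval_one, e9, hx, hM' a b hb]
      split_ifs <;> first | rfl | omega
    · simp only [Tm.eval_var, hx, e10, Function.update_apply]
      split_ifs with hbc
      · rfl
      · exact hQ' b hb₀ (by omega)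
    · simp only [Tm.eval_var, hx]
      rw [Function.update_of_ne (by omega)]
      exact hQ'' j
  · rintro ⟨v₁, M₁, Q₁, D₁⟩ hx ⟨hv, hD, hM₁, hQ₁, hQ₂⟩
    simp only at hv hD hM₁ hQ₁ hQ₂
    subst hD
    refine .seq (.setVec (by simp [len]) (.seq (.setVar (by simp [len]) ?_)))
    simp only [Tm.eval_zero]
    -- Columns 1, …, d - 1 are idle here, but the sweeps run through them, so they need a positive
    -- modulus to keep their entries bounded.
    have hQ₃ : ∀ c : ℤ, 0 < c → c < d → Function.update Q₁ 0 0 c = P.maxModulus := fun c h₁ h₂ => by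
      rw [Function.update_of_ne h₁.ne']; exact hQ₁ c h₁.le h₂
    have hQ₄ : ∀ j : Fin d, Function.update Q₁ 0 0 (d + j) = P.s j := fun j => by
      rw [Function.update_of_ne (by omega)]; exact hQ₂ j
    have hunit : ∀ x j : Fin d, M₁ x (d + j) = if j = x then 1 else 0 := fun x j => by
      rw [hM₁ _ _ (by omega)]
      refine if_congr ?_ rfl rfl
      rw [Fin.ext_iff]
      omega
    refine .forTo (fun c s' => Loaded P s' ∧ s'.D = s.D ∧ s'.Q = Function.update Q₁ 0 0 ∧
      (∀ x : Fin d, RowReduced P s'.M x) ∧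
      AddSubgroup.closure (Set.range fun x : Fin d => rowElt P s'.M x) = P.partialKernel c.toNat)
      0 m (by simp) (by positivity) le_rfl hX.m_le ?_ ?_ ?_ ?_
    · refine ⟨hs.congr (by simp [hv]) (by simp [hv]) (by simp [hv]) rfl, rfl, rfl, ?_, ?_⟩
      · intro x j
        dsimp only
        rw [hunit]
        -- The entry 1 is a reduced residue because s_j > 1, which holds since no column lies in the
        -- lattice.
        have := P.one_lt_s j
        split_ifs <;> omega
      · rw [Int.toNat_zero, P.partialKernel_zero, eq_top_iff]
        rintro y -
        have : y = ∑ x : Fin d, (y x).val • rowElt P M₁ x := by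
          funext j
          rw [Finset.sum_apply, Finset.sum_eq_single j]
          · simp [rowElt, hunit]
          · intro b _ hb
            simp [rowElt, hunit, hb.symm]
          · simp
        rw [this]
        exact AddSubgroup.sum_mem _ fun x _ =>
          AddSubgroup.nsmul_mem _ (AddSubgroup.subset_closure (Set.mem_range_self x)) _
    · rintro c s' ⟨h₁, -⟩
      exact h₁.var_m
    · rintro c s' hc₀ hc hx ⟨hs', hD, hQ', hred, hK⟩
      obtain ⟨l, rfl⟩ := exists_fin_of_lt hc₀ hc
      refine spec_constraintProg hX hs' hd l hx (by simp [hQ']) (hQ' ▸ hQ₃) (hQ' ▸ hQ₄) hred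
        (by simpa using hK) fun v' M' hv' hred' hK' => ?_
      refine ⟨?_, ?_, hD, hQ', hred', ?_⟩
      · exact (hv' 15 (by norm_num) (by norm_num) (by norm_num) (by norm_num)).trans hx
      · refine hs'.congr ?_ ?_ ?_ rfl <;> simp [hv']
      · rw [hK']; rfl
    · rintro ⟨v', M', Q', D'⟩ hx ⟨hs', hD, hQ', hred, hK⟩
      simp only at hD hQ' hred hK
      subst hD hQ'
      exact h v' M' _ hs' hred (by simpa [P.partialKernel_m] using hK) hQ₃ hQ₄

end GroupRelaxation

/-! ### Diagonalizing the generators. -/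

namespace GroupRelaxation

open RAM

variable {m d : ℕ} {P : GroupRelaxation m d} {X : ℕ} {s : St} {R : St → Prop}

variable (P) in
/-- The rows of the matrix contain generators of the compressed kernel and the values at them of
jointly injective homomorphisms to `ℤ / N ℤ`; the square matrix of these values is diagonal in the
rows and columns below `k`. -/
structure Stage (k : ℤ) (M : ℤ → ℤ → ℤ) : Prop where
  exists_hom : ∃ E : ℤ → P.Ambient →+ ZMod P.maxModulus,
    (∀ i ∈ Set.Ico (0 : ℤ) d, ∀ j ∈ Set.Ico (0 : ℤ) d,
      ((M i j : ℤ) : ZMod P.maxModulus) = E j (rowElt P M i)) ∧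
    ∀ y, (∀ j ∈ Set.Ico (0 : ℤ) d, E j y = 0) → y = 0
  mem_iff : ∀ U : AddSubgroup P.Ambient,
    (∀ a ∈ Set.Ico (0 : ℤ) d, rowElt P M a ∈ U) ↔ P.compressedKernel ≤ U
  red : ∀ a ∈ Set.Ico (0 : ℤ) d, RowReduced P M a
  range : ∀ i ∈ Set.Ico (0 : ℤ) d, ∀ j ∈ Set.Ico (0 : ℤ) d, 0 ≤ M i j ∧ M i j < P.maxModulus
  zero : ∀ i ∈ Set.Ico (0 : ℤ) d, ∀ j ∈ Set.Ico (0 : ℤ) d, i ≠ j → i < k ∨ j < k → M i j = 0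

theorem swap_mem_Ico {k i b a : ℤ} (hk : k ∈ Set.Ico 0 b) (hi : i ∈ Set.Ico 0 b)
    (ha : a ∈ Set.Ico 0 b) : Equiv.swap k i a ∈ Set.Ico 0 b := by
  rw [Equiv.swap_apply_def]; split_ifs <;> assumption

namespace Stage

variable {Q : ℤ → ℤ} {k i q : ℤ} {M : ℤ → ℤ → ℤ}

/-- A row operation acts on the generators and on their values under the E_j alike, so the same
homomorphisms still describe the matrix. Cleared rows and columns survive because row `k` vanishes
in the columns below `k`. -/
theorem subRow (hd : 0 < d) (h : Stage P k M) (hQ : ∀ j : Fin d, Q (d + j) = P.s j)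
    (hQ' : ∀ j ∈ Set.Ico (0 : ℤ) d, Q j = P.maxModulus) (hk : k ∈ Set.Ico (0 : ℤ) d)
    (hki : k < i) (hid : i < d) : Stage P k (subRow Q k (2 * d) i q M) := by
  have hN : (0 : ℤ) < P.maxModulus := by exact_mod_cast P.maxModulus_pos (P.m_pos ⟨0, hd⟩)
  have hi : i ∈ Set.Ico (0 : ℤ) d := ⟨hk.1.trans hki.le, hid⟩
  have hentry : ∀ a, ∀ j ∈ Set.Ico (0 : ℤ) d, RAM.subRow Q k (2 * d) i q M a j =
      if a = i then (M i j - q * M k j) % P.maxModulus else M a j := fun a j hj => by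
    have : (0 : ℤ) ≤ j ∧ j < 2 * d := ⟨hj.1, by have := hj.2; omega⟩
    simp [RAM.subRow, this, hQ' j hj]
  refine ⟨?_, fun U => ?_, fun a ha => (h.red a ha).subRow hQ rfl, fun a ha j hj => ?_,
    fun a ha j hj haj hor => ?_⟩
  · obtain ⟨E, hE, hE'⟩ := h.exists_hom
    refine ⟨E, fun a ha j hj => ?_, hE'⟩
    rw [hentry a j hj, rowElt_subRow hQ rfl]
    split_ifs
    · rw [map_sub, map_zsmul, ← hE i hi j hj, ← hE k hk j hj, ZMod.intCast_mod]
      push_cast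
      rw [zsmul_eq_mul]
    · exact hE a ha j hj
  · rw [← h.mem_iff U]
    exact forall_mem_iff_of_sub hk hi hki.ne q (fun a _ => rowElt_subRow hQ rfl a) U
  · rw [hentry a j hj]
    split_ifs
    · exact ⟨Int.emod_nonneg _ hN.ne', Int.emod_lt_of_pos _ hN⟩
    · exact h.range a ha j hj
  · rw [hentry a j hj]
    split_ifs with hai
    · subst hai
      rw [h.zero a ha j hj haj hor, h.zero k hk j hj (by omega) (by omega)]
      simp
    · exact h.zero a ha j hj haj hor

theorem swapRow (h : Stage P k M) (hk : k ∈ Set.Ico (0 : ℤ) d) (hki : k < i) (hid : i < d) :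
    Stage P k (swapRow k (2 * d) i M) := by
  have hi : i ∈ Set.Ico (0 : ℤ) d := ⟨hk.1.trans hki.le, hid⟩
  have hentry : ∀ a, ∀ j ∈ Set.Ico (0 : ℤ) d, RAM.swapRow k (2 * d) i M a j =
      M (Equiv.swap k i a) j := fun a j hj => by
    have : (0 : ℤ) ≤ j ∧ j < 2 * d := ⟨hj.1, by have := hj.2; omega⟩
    simp [RAM.swapRow, this]
  refine ⟨?_, fun U => ?_, fun a ha => (h.red _ (swap_mem_Ico hk hi ha)).swapRow rfl,
    fun a ha j hj => ?_, fun a ha j hj haj hor => ?_⟩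
  · obtain ⟨E, hE, hE'⟩ := h.exists_hom
    refine ⟨E, fun a ha j hj => ?_, hE'⟩
    rw [hentry a j hj, rowElt_swapRow rfl]
    exact hE _ (swap_mem_Ico hk hi ha) j hj
  · rw [← h.mem_iff U]
    exact forall_mem_iff_of_swap hk hi (fun a _ => rowElt_swapRow rfl a) U
  · rw [hentry a j hj]
    exact h.range _ (swap_mem_Ico hk hi ha) j hj
  · rw [hentry a j hj]
    have hsw := Equiv.swap_apply_def k i a
    refine h.zero _ (swap_mem_Ico hk hi ha) j hj ?_ ?_ <;> rw [hsw] <;> split_ifs <;> omega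

/-- A column operation leaves the generators alone and replaces E_i by E_i - q E_k. Joint
injectivity is preserved: apply `forall_mem_iff_of_sub` to the subgroup of homomorphisms vanishing
at y. -/
theorem subCol (hd : 0 < d) (h : Stage P k M)
    (hQ' : ∀ j ∈ Set.Ico (0 : ℤ) d, Q j = P.maxModulus) (hk : k ∈ Set.Ico (0 : ℤ) d)
    (hki : k < i) (hid : i < d) :
    Stage P k fun a b => RAM.subRow Q k d i q (fun a b => M b a) b a := by
  have hN : (0 : ℤ) < P.maxModulus := by exact_mod_cast P.maxModulus_pos (P.m_pos ⟨0, hd⟩)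
  have hi : i ∈ Set.Ico (0 : ℤ) d := ⟨hk.1.trans hki.le, hid⟩
  have hentry : ∀ a ∈ Set.Ico (0 : ℤ) d, ∀ j, RAM.subRow Q k d i q (fun a b => M b a) j a =
      if j = i then (M a i - q * M a k) % P.maxModulus else M a j := fun a ha j => by
    have : (0 : ℤ) ≤ a ∧ a < d := ha
    simp [RAM.subRow, this, hQ' a ha]
  have hcol : ∀ (a : ℤ) (j : Fin d), RAM.subRow Q k d i q (fun a b => M b a) (d + j) a =
      M a (d + j) := fun a j => by
    have : (d + j : ℤ) ≠ i := by omega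
    simp [RAM.subRow, this]
  have hrow : ∀ a, rowElt P (fun a b => RAM.subRow Q k d i q (fun a b => M b a) b a) a =
      rowElt P M a := fun a => by
    funext j
    rw [rowElt, rowElt, hcol]
  refine ⟨?_, fun U => ?_, fun a ha j => ?_, fun a ha j hj => ?_, fun a ha j hj haj hor => ?_⟩
  · obtain ⟨E, hE, hE'⟩ := h.exists_hom
    refine ⟨fun j => if j = i then E i - q • E k else E j, fun a ha j hj => ?_, fun y hy => ?_⟩
    · rw [hentry a ha j, hrow]
      dsimp only
      split_ifs
      · rw [AddMonoidHom.sub_apply, AddMonoidHom.zsmul_apply, ← hE a ha i hi, ← hE a ha k hk,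
          ZMod.intCast_mod]
        push_cast
        rw [zsmul_eq_mul]
      · exact hE a ha j hj
    · exact hE' y ((forall_mem_iff_of_sub (x := E) hk hi hki.ne q (fun a _ => rfl)
        (AddMonoidHom.eval y : (P.Ambient →+ ZMod P.maxModulus) →+ _).ker).1 hy)
  · simp only [hrow, h.mem_iff U]
  · rw [hcol]
    exact h.red a ha j
  · rw [hentry a ha j]
    split_ifs
    · exact ⟨Int.emod_nonneg _ hN.ne', Int.emod_lt_of_pos _ hN⟩
    · exact h.range a ha j hj
  · rw [hentry a ha j]
    split_ifs with hai
    · subst hai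
      rw [h.zero a ha j hj haj hor, h.zero a ha k hk (by omega) (by omega)]
      simp
    · exact h.zero a ha j hj haj hor

theorem swapCol (h : Stage P k M) (hk : k ∈ Set.Ico (0 : ℤ) d) (hki : k < i) (hid : i < d) :
    Stage P k fun a b => RAM.swapRow k d i (fun a b => M b a) b a := by
  have hi : i ∈ Set.Ico (0 : ℤ) d := ⟨hk.1.trans hki.le, hid⟩
  have hentry : ∀ a ∈ Set.Ico (0 : ℤ) d, ∀ j, RAM.swapRow k d i (fun a b => M b a) j a =
      M a (Equiv.swap k i j) := fun a ha j => by
    have : (0 : ℤ) ≤ a ∧ a < d := ha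
    simp [RAM.swapRow, this]
  have hcol : ∀ (a : ℤ) (j : Fin d), RAM.swapRow k d i (fun a b => M b a) (d + j) a =
      M a (d + j) := fun a j => by
    have hk' := hk.2
    simp [RAM.swapRow, Equiv.swap_apply_of_ne_of_ne (show (d + j : ℤ) ≠ k by omega)
      (show (d + j : ℤ) ≠ i by omega)]
  have hrow : ∀ a, rowElt P (fun a b => RAM.swapRow k d i (fun a b => M b a) b a) a =
      rowElt P M a := fun a => by
    funext j
    rw [rowElt, rowElt, hcol]
  refine ⟨?_, fun U => ?_, fun a ha j => ?_, fun a ha j hj => ?_, fun a ha j hj haj hor => ?_⟩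
  · obtain ⟨E, hE, hE'⟩ := h.exists_hom
    refine ⟨fun j => E (Equiv.swap k i j), fun a ha j hj => ?_, fun y hy => ?_⟩
    · rw [hentry a ha j, hrow]
      exact hE a ha _ (swap_mem_Ico hk hi hj)
    · exact hE' y ((forall_mem_iff_of_swap (x := E) hk hi (fun a _ => rfl)
        (AddMonoidHom.eval y : (P.Ambient →+ ZMod P.maxModulus) →+ _).ker).1 hy)
  · simp only [hrow, h.mem_iff U]
  · rw [hcol]
    exact h.red a ha j
  · rw [hentry a ha j]
    exact h.range a ha _ (swap_mem_Ico hk hi hj)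
  · rw [hentry a ha j]
    have hsw := Equiv.swap_apply_def k i j
    refine h.zero a ha _ (swap_mem_Ico hk hi hj) ?_ ?_ <;> rw [hsw] <;> split_ifs <;> omega

end Stage

/-- One elimination of column `15` by row operations and of row `15` by column operations. -/
def roundProg : Prog :=
  .seq (sweepWith false (.var 15 + 1) (.var 9) (.var 15) (.var 15) (2 * .var 9))
    (sweepWith true (.var 15 + 1) (.var 9) (.var 15) (.var 15) (.var 9))

variable (d) in
/-- The effect of `roundProg` on the matrix. -/
structure RoundPost (k : ℤ) (M M' : ℤ → ℤ → ℤ) : Prop where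
  row : ∀ j, k < j → j < d → M' k j = 0
  col : (∀ i, k < i → i < d → M' i k = 0) ∨ 0 < M' k k
  half : (∀ j, k < j → j < d → M k j = 0) → 0 < M k k →
    (∀ i, k < i → i < d → M' i k = 0) ∨ (0 < M' k k ∧ 2 * M' k k ≤ M k k)
  eq_self : (∀ j, k < j → j < d → M k j = 0) → (∀ i, k < i → i < d → M i k = 0) → M' = M

/-- With row k clear beforehand there are two cases. If the row sweep leaves row k unchanged, the
column sweep has nothing to do and column k stays clear. Otherwise the pivot has been halved, and
the column sweep either leaves column k clear or halves the pivot again. -/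
theorem spec_roundProg (hX : Fits P X) (hs : Loaded P s) {k : ℤ} (hk : k ∈ Set.Ico (0 : ℤ) d)
    (h15 : s.v 15 = k) (hQ : ∀ j : Fin d, s.Q (d + j) = P.s j)
    (hQ' : ∀ j ∈ Set.Ico (0 : ℤ) d, s.Q j = P.maxModulus) (hst : Stage P k s.M)
    (h : ∀ v' M', (∀ x, 8 ≤ x → v' x = s.v x) → Stage P k M' → RoundPost d k s.M M' →
      R ⟨v', M', s.Q, s.D⟩) :
    Spec false X roundProg s R := by
  have hdX := hX.d_le
  obtain ⟨hk₀, hkd⟩ := hk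
  have hd : 0 < d := by omega
  have hN : (0 : ℤ) < P.maxModulus := by exact_mod_cast P.maxModulus_pos (P.m_pos ⟨0, hd⟩)
  have hred : ∀ M, Stage P k M → ∀ i ∈ Set.Ico (0 : ℤ) d, ∀ j ∈ Set.Ico (0 : ℤ) d,
      Reduced (s.Q k) (M i j) := fun M hM i hi j hj => by
    rw [hQ' k ⟨hk₀, hkd⟩]
    exact ⟨(hM.range i hi j hj).1, .inr (hM.range i hi j hj).2⟩
  have hQpos : ∀ c, 0 ≤ c → c < 2 * (d : ℤ) → 0 < s.Q c := fun c h₀ h₁ => by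
    by_cases hcd : c < d
    · rw [hQ' c ⟨h₀, hcd⟩]; exact hN
    · obtain ⟨j, hj⟩ := exists_fin_of_lt (n := d) (i := c - d) (by omega) (by omega)
      have : c = d + j := by omega
      rw [this, hQ]
      exact_mod_cast P.s_pos j
  refine .seq (spec_sweepWith (Stage P k) (k := k) (lo := k + 1) (hi := d) (col := k) (n := 2 * d)
    (fun v' hv => by simp [hv, h15]) (fun v' hv => by simp [hv, hs.var_d])
    (fun v' hv => by simp [hv, h15]) (fun v' hv => by simp [hv, h15])
    (fun v' hv => by simp [hv, hs.var_d]) (by omega) (by omega) (by omega) (.inl (by omega)) hk₀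
    (by omega) hk₀ (by omega) hdX (hred _ hst k ⟨hk₀, hkd⟩ k ⟨hk₀, hkd⟩)
    (fun a h₁ h₂ => hred _ hst a ⟨by omega, h₂⟩ k ⟨hk₀, hkd⟩) (fun c h₁ h₂ _ => hQpos c h₁ h₂) hst
    (fun M q i h₁ h₂ hM => hM.subRow hd hQ hQ' ⟨hk₀, hkd⟩ (by omega) h₂)
    (fun M i h₁ h₂ hM => hM.swapRow ⟨hk₀, hkd⟩ (by omega) h₂) ?_)
  intro v₁ M₁ hv₁ hst₁ hsw₁
  have e9 : v₁ 9 = d := (hv₁ 9 (by norm_num)).trans hs.var_d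
  have e15 : v₁ 15 = k := (hv₁ 15 (by norm_num)).trans h15
  -- All of the first d moduli equal N, so reading the matrix transposed does not disturb the
  -- reduction.
  refine Spec.transpose (tr := true) (R := fun s' => R { s' with M := fun i j => s'.M j i }) ?_
  refine spec_sweepWith (fun M => Stage P k fun i j => M j i) (k := k) (lo := k + 1) (hi := d)
    (col := k) (n := d)
    (fun v' hv => by simp [hv, e15]) (fun v' hv => by simp [hv, e9])
    (fun v' hv => by simp [hv, e15]) (fun v' hv => by simp [hv, e15])
    (fun v' hv => by simp [hv, e9]) (by omega) (by omega) (by omega) (.inl (by omega)) hk₀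
    (by omega) hk₀ (by omega) (by omega) (hred _ hst₁ k ⟨hk₀, hkd⟩ k ⟨hk₀, hkd⟩)
    (fun a h₁ h₂ => hred _ hst₁ k ⟨hk₀, hkd⟩ a ⟨by omega, h₂⟩)
    (fun c h₁ h₂ _ => hQpos c h₁ (by omega)) hst₁
    (fun M q i h₁ h₂ hM => hM.subCol hd hQ' ⟨hk₀, hkd⟩ (by omega) h₂)
    (fun M i h₁ h₂ hM => hM.swapCol ⟨hk₀, hkd⟩ (by omega) h₂) ?_
  intro v₂ M₂ hv₂ hst₂ hsw₂
  refine h v₂ (fun i j => M₂ j i) (fun x hx => (hv₂ x hx).trans (hv₁ x hx)) hst₂ ?_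
  have hz₁ : ∀ i, k < i → i < d → M₁ i k = 0 := fun i h₁ h₂ => hsw₁.zero i (by omega) h₂
  have hp₂ := hsw₂.pivot
  have he₂ := hsw₂.eq_self
  simp only at hp₂ he₂
  refine ⟨fun j h₁ h₂ => hsw₂.zero j (by omega) h₂, ?_, fun hr hp => ?_, fun hr hc => ?_⟩
  · rcases hp₂ with hp | ⟨hp, -⟩
    · exact .inl fun i h₁ h₂ => (hp i).trans (hz₁ i h₁ h₂)
    · exact .inr hp
  · rcases hsw₁.pivot with hp₁ | ⟨hp₁, hp₁'⟩
    · have := he₂ fun a h₁ h₂ => (hp₁ a).trans (hr a (by omega) h₂)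
      subst this
      exact .inl hz₁
    · rcases hp₂ with hp₂ | ⟨hp₂, hp₂'⟩
      · exact .inl fun i h₁ h₂ => (hp₂ i).trans (hz₁ i h₁ h₂)
      · exact .inr ⟨hp₂, by omega⟩
  · have h₁ := hsw₁.eq_self fun a h₁ h₂ => hc a (by omega) h₂
    subst h₁
    rw [he₂ fun a h₁ h₂ => hr a (by omega) h₂]

/-- Clears row `15` and column `15` outside the diagonal. -/
def stageProg : Prog :=
  .seq roundProg (.seq (setVar false 11 (.var 10))
    (whilePos false (.var 11) (.seq roundProg (setVar false 11 (.var 11 / 2)))))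

/-- Variable 11 starts at N and is halved in every pass. It bounds the pivot as long as column k is
not clear, so when it reaches 0 the column must be clear. Passes after that change nothing, by
`RoundPost.eq_self`. -/
theorem spec_stageProg (hX : Fits P X) (hs : Loaded P s) {k : ℤ} (hk : k ∈ Set.Ico (0 : ℤ) d)
    (h15 : s.v 15 = k) (hQ : ∀ j : Fin d, s.Q (d + j) = P.s j)
    (hQ' : ∀ j ∈ Set.Ico (0 : ℤ) d, s.Q j = P.maxModulus) (hst : Stage P k s.M)
    (h : ∀ v' M', (∀ x, 8 ≤ x → x ≠ 11 → v' x = s.v x) → Stage P (k + 1) M' →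
      R ⟨v', M', s.Q, s.D⟩) :
    Spec false X stageProg s R := by
  refine .seq (spec_roundProg hX hs hk h15 hQ hQ' hst fun v₁ M₁ hv₁ hst₁ hr₁ => ?_)
  have e10 : v₁ 10 = P.maxModulus := (hv₁ 10 (by norm_num)).trans hs.N
  refine .seq (.setVar (by simpa [e10] using hX.N) (.of_lenLE fun hlen => ?_))
  refine .whilePos (fun s' => (∀ x, 8 ≤ x → x ≠ 11 → s'.v x = s.v x) ∧ s'.Q = s.Q ∧ s'.D = s.D ∧
      Stage P k s'.M ∧ (∀ j, k < j → j < d → s'.M k j = 0) ∧ 0 ≤ s'.v 11 ∧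
      ((∀ i, k < i → i < d → s'.M i k = 0) ∨ (0 < s'.M k k ∧ s'.M k k ≤ s'.v 11)))
    (fun s' => len (s'.v 11)) ⟨fun x h₁ h₂ => ?_, rfl, rfl, hst₁, hr₁.row, ?_,
      hr₁.col.imp_right fun h₀ => ⟨h₀, ?_⟩⟩ ?_ ?_ ?_
  · simp [h₂, hv₁ x h₁]
  · simp [e10]
  · simpa [e10] using (hst₁.range k hk k hk).2.le
  · have := hlen.v 11
    omega
  · rintro s' ⟨hv, hQs, hD, hst', hrow, hT₀, hcol⟩ hT
    simp only [Tm.eval_var] at hT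
    have hs' : Loaded P s' := hs.congr (hv 8 (by norm_num) (by norm_num))
      (hv 9 (by norm_num) (by norm_num)) (hv 10 (by norm_num) (by norm_num)) hD
    refine .of_lenLE fun hlen' => ?_
    refine .seq (spec_roundProg hX hs' hk ((hv 15 (by norm_num) (by norm_num)).trans h15)
      (hQs ▸ hQ) (hQs ▸ hQ') hst' fun v₂ M₂ hv₂ hst₂ hr₂ => ?_)
    have e11 : v₂ 11 = s'.v 11 := hv₂ 11 (by norm_num)
    have hval : (.var 11 / 2 : Tm).eval ⟨v₂, M₂, s'.Q, s'.D⟩ = s'.v 11 / 2 := by simp [e11]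
    have hle : s'.v 11 / 2 ≤ s'.v 11 := by omega
    have h0 : 0 ≤ s'.v 11 / 2 := by omega
    refine .setVar ?_ ⟨⟨fun x h₁ h₂ => ?_, hQs, hD, hst₂, hr₂.row, ?_, ?_⟩, ?_⟩
    · rw [hval]
      exact (len_le_of_nonneg_of_le h0 hle).trans (hlen'.v 11)
    · simpa [h₂] using (hv₂ x h₁).trans (hv x h₁ h₂)
    · rw [hval]; simpa using h0
    · rw [hval]
      simp only [Function.update_self]
      rcases hcol with hc | ⟨hc₁, hc₂⟩
      · rw [hr₂.eq_self hrow hc]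
        exact .inl hc
      · exact (hr₂.half hrow hc₁).imp_right fun hp => ⟨hp.1, by omega⟩
    · rw [hval]
      simp only [Function.update_self]
      rcases h0.eq_or_lt with h0' | h0'
      -- The step from counter 1 to 0 is not covered by halving of positive numbers, but the length
      -- still drops from positive to 0.
      · rw [← h0']
        have := abs_lt_two_pow_len (s'.v 11)
        rw [abs_of_pos hT] at this
        have h1 : len (0 : ℤ) = 0 := by simp [len]
        rw [h1]
        by_contra hcon
        have h2 : len (s'.v 11) = 0 := by omega
        rw [h2] at this
        omega
      · exact len_lt_of_two_mul_le h0' (by omega)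
  · rintro ⟨v', M', Q', D'⟩ ⟨hv, hQs, hD, hst', hrow, hT₀, hcol⟩ hT
    simp only [Tm.eval_var] at hv hQs hD hst' hrow hT₀ hcol hT
    subst hQs hD
    refine h v' M' hv ⟨hst'.exists_hom, hst'.mem_iff, hst'.red, hst'.range,
      fun i hi j hj hij hor => ?_⟩
    have hcol' : ∀ i, k < i → i < d → M' i k = 0 := by
      rcases hcol with hc | ⟨hc₁, hc₂⟩
      · exact hc
      · omega
    by_cases hor' : i < k ∨ j < k
    · exact hst'.zero i hi j hj hij hor'
    · by_cases hik : i = k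
      · subst hik
        exact hrow j (by omega) hj.2
      · have hjk : j = k := by omega
        subst hjk
        exact hcol' i (by omega) hi.2

variable (P) in
/-- The embedding of `ℤ / s_j ℤ` into `ℤ / N ℤ`, composed with the `j`-th coordinate. -/
noncomputable def scaleHom (j : Fin d) : P.Ambient →+ ZMod P.maxModulus :=
  (ZMod.lift (P.s j) ⟨zmultiplesHom (ZMod P.maxModulus)
    ((P.maxModulus / P.s j : ℕ) : ZMod P.maxModulus), by
      rw [zmultiplesHom_apply, natCast_zsmul, nsmul_eq_mul, ← Nat.cast_mul,
        Nat.mul_div_cancel' (P.s_dvd_maxModulus j), ZMod.natCast_self]⟩).comp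
    (Pi.evalAddMonoidHom _ j)

theorem scaleHom_apply (j : Fin d) (y : P.Ambient) :
    P.scaleHom j y = (((y j).val * (P.maxModulus / P.s j) : ℕ) : ZMod P.maxModulus) := by
  have hz : y j = (((y j).val : ℤ) : ZMod (P.s j)) := by simp
  rw [scaleHom, AddMonoidHom.comp_apply, Pi.evalAddMonoidHom_apply]
  conv_lhs => rw [hz]
  rw [ZMod.lift_coe, zmultiplesHom_apply, natCast_zsmul, nsmul_eq_mul, Nat.cast_mul]

theorem eq_zero_of_scaleHom {y : P.Ambient} (h : ∀ j, P.scaleHom j y = 0) : y = 0 := by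
  funext j
  have h₁ := h j
  rw [scaleHom_apply, ZMod.natCast_eq_zero_iff] at h₁
  have hs := P.s_pos j
  obtain ⟨c, hc⟩ := P.s_dvd_maxModulus j
  have hN := P.maxModulus_pos (P.m_pos j)
  have hc₀ : 0 < c := by
    rcases Nat.eq_zero_or_pos c with rfl | h
    · omega
    · exact h
  rw [hc, Nat.mul_div_cancel_left _ hs] at h₁
  have h₂ : P.s j ∣ (y j).val := Nat.dvd_of_mul_dvd_mul_right hc₀ h₁
  exact (ZMod.val_eq_zero _).1 (Nat.eq_zero_of_dvd_of_lt h₂ (ZMod.val_lt _))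

/-- Writes the images of the generators under the embedding into `(ℤ / N ℤ)^d` into the first `d`
columns. -/
def embedProg : Prog :=
  .seq (setVar false 12 0) (forTo false 12 (.var 9)
    (.seq (setVar false 14 0) (forTo false 14 (.var 9)
      (setMat false (.var 12) (.var 14)
        (.mat (.var 12) (.var 9 + .var 14) * (.var 10 / .vec (.var 9 + .var 14)))))))

theorem mul_div_s_lt (j : Fin d) {y : ℤ} (h : y < P.s j) :
    y * ((P.maxModulus : ℤ) / P.s j) < P.maxModulus := by
  have hs : (0 : ℤ) < P.s j := by exact_mod_cast P.s_pos j
  obtain ⟨c, hc⟩ := P.s_dvd_maxModulus j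
  have hN := P.maxModulus_pos (P.m_pos j)
  have hc₀ : 0 < c := by
    rcases Nat.eq_zero_or_pos c with rfl | h
    · omega
    · exact h
  rw [hc]
  push_cast
  rw [Int.mul_ediv_cancel_left _ hs.ne']
  exact mul_lt_mul_of_pos_right h (by exact_mod_cast hc₀)

theorem spec_embedProg (hX : Fits P X) (hs : Loaded P s)
    (hQ : ∀ j : Fin d, s.Q (d + j) = P.s j) (hred : ∀ x : Fin d, RowReduced P s.M x)
    (h : ∀ v' M', (∀ x, x ≠ 12 → x ≠ 14 → v' x = s.v x) →
      (∀ x j : Fin d, M' x j = s.M x (d + j) * ((P.maxModulus : ℤ) / P.s j)) →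
      (∀ a b : ℤ, d ≤ b → M' a b = s.M a b) → R ⟨v', M', s.Q, s.D⟩) :
    Spec false X embedProg s R := by
  have hdX := hX.d_le
  refine .seq (.setVar (by simp [len]) ?_)
  refine .forTo (fun i s' => (∀ x, x ≠ 12 → x ≠ 14 → s'.v x = s.v x) ∧ s'.Q = s.Q ∧ s'.D = s.D ∧
    (∀ x j : Fin d, (x : ℤ) < i → s'.M x j = s.M x (d + j) * ((P.maxModulus : ℤ) / P.s j)) ∧
      (∀ a b : ℤ, d ≤ b → s'.M a b = s.M a b)) 0 d
    (by simp) (by positivity) le_rfl (by omega) ?_ ?_ ?_ ?_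
  · exact ⟨fun x h₁ _ => by simp [h₁], rfl, rfl, fun x j hx => by omega, fun _ _ _ => rfl⟩
  · rintro i s' ⟨h₁, -⟩
    simpa [hs.var_d] using h₁ 9 (by norm_num) (by norm_num)
  · rintro i s₁ hi₀ hi hx ⟨hv, hQ', hD, hM, hM'⟩
    obtain ⟨l, rfl⟩ := exists_fin_of_lt hi₀ hi
    refine .seq (.setVar (by simp [len]) ?_)
    refine .forTo (fun i s' => (∀ x, x ≠ 14 → s'.v x = s₁.v x) ∧ s'.Q = s.Q ∧ s'.D = s.D ∧
      (∀ x j : Fin d, (x : ℤ) < l ∨ x = l ∧ (j : ℤ) < i →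
        s'.M x j = s.M x (d + j) * ((P.maxModulus : ℤ) / P.s j)) ∧
        (∀ a b : ℤ, d ≤ b → s'.M a b = s.M a b)) 0 d
      (by simp) (by positivity) le_rfl (by omega) ?_ ?_ ?_ ?_
    · exact ⟨fun x h₁ => by simp [h₁], hQ', hD, fun x j hx => hM x j (by omega), hM'⟩
    · rintro i s' ⟨h₁, -⟩
      simp [h₁ 9 (by norm_num), hv 9 (by norm_num) (by norm_num), hs.var_d]
    · rintro i s₂ hi₀ hi hx₂ ⟨kv, kQ, kD, kM, kM'⟩
      obtain ⟨c, rfl⟩ := exists_fin_of_lt hi₀ hi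
      have e9 : s₂.v 9 = d :=
        ((kv 9 (by norm_num)).trans (hv 9 (by norm_num) (by norm_num))).trans hs.var_d
      have e10 : s₂.v 10 = P.maxModulus :=
        ((kv 10 (by norm_num)).trans (hv 10 (by norm_num) (by norm_num))).trans hs.N
      have e12 : s₂.v 12 = l := (kv 12 (by norm_num)).trans hx
      have hval : (.mat (.var 12) (.var 9 + .var 14) * (.var 10 / .vec (.var 9 + .var 14)) : Tm).eval
          s₂ = s.M l (d + c) * ((P.maxModulus : ℤ) / P.s c) := by
        simp [e9, e10, e12, hx₂, kQ, hQ, kM']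
      refine .setMat ?_ ⟨hx₂, fun x h₁ => by simpa [h₁] using kv x h₁, kQ, kD, fun x j hxj => ?_,
        fun a b hb => ?_⟩
      · rw [hval]
        exact (len_le_of_nonneg_of_le (mul_nonneg (hred l c).1 (by positivity))
          (mul_div_s_lt c (hred l c).2).le).trans hX.N
      · rw [hval]
        simp only [updateMat, Tm.eval_var, e12, hx₂]
        split_ifs with hif
        · have h₁ : x = l := Fin.ext (by exact_mod_cast hif.1)
          have h₂ : j = c := Fin.ext (by exact_mod_cast hif.2)
          rw [h₁, h₂]
        · refine kM x j ?_
          rcases hxj with hxj | ⟨hxl, hj⟩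
          · exact .inl hxj
          · refine .inr ⟨hxl, ?_⟩
            have : ¬ ((j : ℤ) = c) := fun h => hif ⟨by rw [hxl], h⟩
            omega
      · rw [hval]
        have : b ≠ c := by omega
        simpa [updateMat, hx₂, this] using kM' a b hb
    · rintro s₂ hx₂ ⟨kv, kQ, kD, kM, kM'⟩
      refine ⟨(kv 12 (by norm_num)).trans hx, fun x h₁ h₂ => ?_, kQ, kD, fun x j hx => ?_, kM'⟩
      · simpa [h₁] using (kv x h₂).trans (hv x h₁ h₂)
      · refine kM x j ?_
        have hj := j.isLt
        rw [Fin.ext_iff]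
        omega
  · rintro ⟨v', M', Q', D'⟩ hx ⟨hv, hQ', hD, hM, hM'⟩
    simp only at hv hQ' hD hM hM'
    subst hQ' hD
    exact h v' M' hv (fun x j => hM x j (by exact_mod_cast x.isLt)) hM'

/-- The homomorphisms are the embeddings ℤ/s_j → ℤ/N after the coordinates. They are jointly
injective, and for k = 0 the diagonality condition is empty. -/
theorem stage_zero {M M' : ℤ → ℤ → ℤ} (hred : ∀ x : Fin d, RowReduced P M x)
    (hK : AddSubgroup.closure (Set.range fun x : Fin d => rowElt P M x) = P.compressedKernel)
    (h₁ : ∀ x j : Fin d, M' x j = M x (d + j) * ((P.maxModulus : ℤ) / P.s j))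
    (h₂ : ∀ a b : ℤ, d ≤ b → M' a b = M a b) : Stage P 0 M' := by
  have hrow : ∀ a, rowElt P M' a = rowElt P M a := fun a => by
    funext j
    rw [rowElt, rowElt, h₂ _ _ (by omega)]
  have hfin : ∀ p : ℤ → Prop, (∀ a ∈ Set.Ico (0 : ℤ) d, p a) ↔ ∀ x : Fin d, p x := fun p => by
    refine ⟨fun h x => h x ⟨by positivity, by exact_mod_cast x.isLt⟩, fun h a ha => ?_⟩
    obtain ⟨x, rfl⟩ := exists_fin_of_lt ha.1 ha.2
    exact h x
  refine ⟨⟨fun j => if hj : 0 ≤ j ∧ j < d then P.scaleHom ⟨j.toNat, by omega⟩ else 0, ?_, ?_⟩,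
    ?_, ?_, ?_, ?_⟩
  · simp only [hfin, hrow]
    intro x j
    have hj : (0 : ℤ) ≤ j ∧ (j : ℤ) < d := ⟨by positivity, by exact_mod_cast j.isLt⟩
    rw [dif_pos hj]
    simp only [Int.toNat_natCast, Fin.eta]
    rw [scaleHom_apply, h₁, ← (hred x).val_rowElt j, ← Int.natCast_div, ← Nat.cast_mul,
      Int.cast_natCast]
  · simp only [hfin]
    intro y hy
    refine eq_zero_of_scaleHom fun j => ?_
    have hj : (0 : ℤ) ≤ j ∧ (j : ℤ) < d := ⟨by positivity, by exact_mod_cast j.isLt⟩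
    have := hy j
    rw [dif_pos hj] at this
    simpa only [Int.toNat_natCast, Fin.eta] using this
  · intro U
    simp only [hfin, hrow]
    rw [← hK, AddSubgroup.closure_le, Set.range_subset_iff]
    rfl
  · simp only [hfin]
    intro x j
    rw [h₂ _ _ (by omega)]
    exact hred x j
  · simp only [hfin]
    intro x j
    rw [h₁]
    exact ⟨mul_nonneg (hred x j).1 (by positivity), mul_div_s_lt j (hred x j).2⟩
  · intro i hi j hj _ h
    have := hi.1
    have := hj.1
    omega

/-- Makes the generators of the compressed kernel independent. -/
def diagonalizeProg : Prog :=
  .seq (setVec false 0 (.var 10)) (.seq embedProg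
    (.seq (setVar false 15 0) (forTo false 15 (.var 9) stageProg)))

theorem spec_diagonalizeProg (hX : Fits P X) (hs : Loaded P s) (hd : 0 < d)
    (hred : ∀ x : Fin d, RowReduced P s.M x)
    (hK : AddSubgroup.closure (Set.range fun x : Fin d => rowElt P s.M x) = P.compressedKernel)
    (hQ₁ : ∀ c : ℤ, 0 < c → c < d → s.Q c = P.maxModulus) (hQ : ∀ j : Fin d, s.Q (d + j) = P.s j)
    (h : ∀ v' M' Q', Loaded P ⟨v', M', Q', s.D⟩ → Stage P d M' → R ⟨v', M', Q', s.D⟩) :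
    Spec false X diagonalizeProg s R := by
  have hdX := hX.d_le
  -- Column 0 had modulus 0 during the kernel computation; it now receives the modulus N like the
  -- other value columns.
  refine .seq (.setVec (by simpa [hs.N] using hX.N) ?_)
  simp only [Tm.eval_zero, Tm.eval_var, hs.N]
  have hQ₂ : ∀ j : Fin d, Function.update s.Q 0 P.maxModulus (d + j) = P.s j := fun j => by
    rw [Function.update_of_ne (by omega)]; exact hQ j
  have hQ₃ : ∀ c ∈ Set.Ico (0 : ℤ) d, Function.update s.Q 0 P.maxModulus c = P.maxModulus := by
    rintro c ⟨h₁, h₂⟩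
    rcases h₁.eq_or_lt with rfl | h₁
    · simp
    · rw [Function.update_of_ne h₁.ne']; exact hQ₁ c h₁ h₂
  refine .seq (spec_embedProg hX (hs.congr rfl rfl rfl rfl) hQ₂ hred fun v₁ M₁ hv₁ h₁ h₂ => ?_)
  have hst := stage_zero hred hK h₁ h₂
  refine .seq (.setVar (by simp [len]) ?_)
  refine .forTo (fun k s' => Loaded P s' ∧ s'.D = s.D ∧
    s'.Q = Function.update s.Q 0 P.maxModulus ∧ Stage P k s'.M) 0 d
    (by simp) (by positivity) le_rfl (by omega) ⟨?_, rfl, rfl, hst⟩ ?_ ?_ ?_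
  · exact hs.congr (by simp [hv₁]) (by simp [hv₁]) (by simp [hv₁]) rfl
  · rintro i s' ⟨h₁, -⟩
    exact h₁.var_d
  · rintro k s' hk₀ hk hx ⟨hs', hD, hQ', hst'⟩
    refine spec_stageProg hX hs' ⟨hk₀, hk⟩ hx (hQ' ▸ hQ₂) (hQ' ▸ hQ₃) hst' fun v' M' hv hM' => ?_
    refine ⟨(hv 15 (by norm_num) (by norm_num)).trans hx, ?_, hD, hQ', hM'⟩
    refine hs'.congr ?_ ?_ ?_ rfl <;> simp [hv]
  · rintro ⟨v', M', Q', D'⟩ hx ⟨hs', hD, hQ', hst'⟩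
    simp only at hD hQ' hst'
    subst hD hQ'
    exact h v' M' _ hs' hst'

end GroupRelaxation

/-! ### Independence from a diagonal matrix of values. -/

section Diagonal

variable {G H : Type*} [AddCommGroup G] [AddCommGroup H] {n : ℕ} {h : Fin n → G}
  {E : Fin n → G →+ H}

/-- Let y lie in ⟨h_i⟩ and in the sum of the others. As a multiple of h_i it is killed by E_j for j
≠ i, and as a combination of the others by E_i, so y = 0. -/
theorem iSupIndep_zmultiples_of_diagonal (hE : ∀ y, (∀ j, E j y = 0) → y = 0)
    (hh : ∀ i j, i ≠ j → E j (h i) = 0) : iSupIndep fun i => AddSubgroup.zmultiples (h i) := by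
  intro i
  rw [AddSubgroup.disjoint_def]
  intro y hy hy'
  refine hE y fun j => ?_
  by_cases hij : i = j
  · subst hij
    have : (⨆ (j : Fin n) (_ : j ≠ i), AddSubgroup.zmultiples (h j)) ≤ (E i).ker := by
      refine iSup₂_le fun j hj => ?_
      rw [AddSubgroup.zmultiples_le]
      exact hh j i hj
    exact this hy'
  · obtain ⟨c, rfl⟩ := AddSubgroup.mem_zmultiples_iff.1 hy
    rw [map_zsmul, hh i j hij, smul_zero]

/-- The homomorphism `⨁_i ℤ / n_i ℤ → G` given by elements `h_i` of order `n_i`. -/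
noncomputable def sumLift (h : Fin n → G) : (∀ i, ZMod (addOrderOf (h i))) →+ G :=
  ∑ i, (ZMod.lift (addOrderOf (h i)) ⟨zmultiplesHom G (h i), by
    rw [zmultiplesHom_apply, natCast_zsmul]; exact addOrderOf_nsmul_eq_zero (h i)⟩).comp
      (Pi.evalAddMonoidHom _ i)

theorem sumLift_intCast (c : Fin n → ℤ) :
    sumLift h (fun i => (c i : ZMod (addOrderOf (h i)))) = ∑ i, c i • h i := by
  simp [sumLift, AddMonoidHom.finsetSum_apply]

theorem range_sumLift : (sumLift h).range = AddSubgroup.closure (Set.range h) := by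
  apply le_antisymm
  · rintro _ ⟨y, rfl⟩
    choose c hc using fun i => ZMod.intCast_surjective (y i)
    obtain rfl : (fun i => (c i : ZMod (addOrderOf (h i)))) = y := funext hc
    rw [sumLift_intCast]
    exact AddSubgroup.sum_mem _ fun i _ =>
      AddSubgroup.zsmul_mem _ (AddSubgroup.subset_closure (Set.mem_range_self i)) _
  · rw [AddSubgroup.closure_le, Set.range_subset_iff]
    intro i
    refine ⟨fun j => ((Pi.single i 1 : Fin n → ℤ) j : ZMod (addOrderOf (h j))), ?_⟩
    rw [sumLift_intCast, Finset.sum_eq_single i]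
    · simp
    · intro j _ hj
      simp [hj]
    · simp

/-- Applying E_j to a relation ∑ c_i h_i = 0 isolates E_j(c_j h_j) = 0. The other E_l kill h_j
anyway, so c_j h_j = 0 and the order of h_j divides c_j. -/
theorem sumLift_injective_of_diagonal (hE : ∀ y, (∀ j, E j y = 0) → y = 0)
    (hh : ∀ i j, i ≠ j → E j (h i) = 0) : Function.Injective (sumLift h) := by
  rw [injective_iff_map_eq_zero]
  intro y hy
  choose c hc using fun i => ZMod.intCast_surjective (y i)
  obtain rfl : (fun i => (c i : ZMod (addOrderOf (h i)))) = y := funext hc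
  rw [sumLift_intCast] at hy
  funext j
  have hj : c j • h j = 0 := by
    refine hE _ fun l => ?_
    by_cases hjl : j = l
    · subst hjl
      have := congrArg (E j) hy
      rw [map_sum, map_zero, Finset.sum_eq_single j] at this
      · exact this
      · intro i _ hij
        rw [map_zsmul, hh i j hij, smul_zero]
      · simp
    · rw [map_zsmul, hh j l hjl, smul_zero]
  rw [Pi.zero_apply, ZMod.intCast_zmod_eq_zero_iff_dvd]
  exact addOrderOf_dvd_iff_zsmul_eq_zero.2 hj

end Diagonal

theorem List.getD_flatMap_of_length {α : Type*} {f : α → List ℤ} {d : ℕ} (hf : ∀ a, (f a).length = d)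
    (l : List α) (i j : ℕ) (hi : i < l.length) (hj : j < d) :
    (l.flatMap f).getD (i * d + j) 0 = (f l[i]).getD j 0 := by
  induction l generalizing i with
  | nil => simp at hi
  | cons a l ih =>
    rw [List.flatMap_cons]
    cases i with
    | zero =>
      rw [List.getD_append _ _ _ _ (by rw [hf]; omega)]
      simp
    | succ i =>
      rw [List.getD_append_right _ _ _ _ (by rw [hf]; nlinarith), hf,
        show (i + 1) * d + j - d = i * d + j by rw [add_mul, one_mul]; omega]
      exact ih i (by simpa using hi)

/-! ### Input, output and the assembled program. -/

namespace GroupRelaxation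

open RAM

variable {m d : ℕ} {P : GroupRelaxation m d} {X : ℕ} {s : St} {R : St → Prop}

/-- Writes the generators into the registers `0, 1, 2, …`. -/
def outputProg : Prog :=
  .seq (putData false 0 (.var 9)) (.seq (setVar false 12 0) (forTo false 12 (.var 9)
    (.seq (setVar false 14 0) (forTo false 14 (.var 9)
      (putData false (1 + .var 12 * .var 9 + .var 14) (.mat (.var 12) (.var 9 + .var 14)))))))

theorem index_inj {x l j c : Fin d} (h : (1 + x * d + j : ℤ) = 1 + l * d + c) : x = l ∧ j = c := by
  have hj := j.isLt
  have hc := c.isLt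
  have hxl : (x : ℤ) = l := by
    rcases lt_trichotomy (x : ℤ) l with h' | h' | h'
    · nlinarith
    · exact h'
    · nlinarith
  rw [hxl] at h
  exact ⟨Fin.ext (by exact_mod_cast hxl), Fin.ext (by omega)⟩

/-- The output may overwrite the input data: everything still needed is in the workspace at negative
addresses. -/
theorem spec_outputProg (hX : 2 * (d : ℤ) ≤ X) (h9 : s.v 9 = d)
    (h : ∀ v' (D' : ℤ → ℤ), D' 0 = d → (∀ x j : Fin d, D' (1 + x * d + j) = s.M x (d + j)) →
      R ⟨v', s.M, s.Q, D'⟩) :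
    Spec false X outputProg s R := by
  refine .seq (.putData (by simp) ?_)
  refine .seq (.setVar (by simp [len]) ?_)
  refine .forTo (fun i s' => s'.v 9 = d ∧ s'.M = s.M ∧ s'.Q = s.Q ∧ s'.D 0 = d ∧
    ∀ x j : Fin d, (x : ℤ) < i → s'.D (1 + x * d + j) = s.M x (d + j)) 0 d
    (by simp) (by positivity) le_rfl (by omega) ?_ ?_ ?_ ?_
  · exact ⟨by simp [h9], rfl, rfl, by simp [h9], fun x j hx => by omega⟩
  · rintro i s' ⟨h₁, -⟩
    exact h₁
  · rintro i s₁ hi₀ hi hx ⟨e9, hM, hQ, hD₀, hD⟩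
    obtain ⟨l, rfl⟩ := exists_fin_of_lt hi₀ hi
    refine .seq (.setVar (by simp [len]) ?_)
    refine .forTo (fun i s' => s'.v 9 = d ∧ s'.v 12 = l ∧ s'.M = s.M ∧ s'.Q = s.Q ∧ s'.D 0 = d ∧
      ∀ x j : Fin d, (x : ℤ) < l ∨ x = l ∧ (j : ℤ) < i → s'.D (1 + x * d + j) = s.M x (d + j)) 0 d
      (by simp) (by positivity) le_rfl (by omega) ?_ ?_ ?_ ?_
    · exact ⟨by simp [e9], by simp [hx], hM, hQ, hD₀, fun x j hx => hD x j (by omega)⟩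
    · rintro i s' ⟨h₁, -⟩
      exact h₁
    · rintro i s₂ hi₀ hi hx₂ ⟨e9, e12, hM, hQ, hD₀, hD⟩
      obtain ⟨c, rfl⟩ := exists_fin_of_lt hi₀ hi
      have hidx : (1 + .var 12 * .var 9 + .var 14 : Tm).eval s₂ = 1 + l * d + c := by
        simp [e9, e12, hx₂]
      have hval : (.mat (.var 12) (.var 9 + .var 14) : Tm).eval s₂ = s.M l (d + c) := by
        simp [e9, e12, hx₂, hM]
      have hpos : (0 : ℤ) < 1 + l * d + c := by positivity
      refine .putData (by rw [hidx]; exact hpos.le) ⟨hx₂, by simpa using e9, by simpa using e12, hM,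
        hQ, ?_, fun x j hxj => ?_⟩
      · rw [hidx]
        simpa [Function.update_of_ne hpos.ne] using hD₀
      · rw [hidx, hval]
        dsimp only
        by_cases hxc : x = l ∧ j = c
        · rw [hxc.1, hxc.2, Function.update_self]
        · rw [Function.update_of_ne (fun h => hxc (index_inj h))]
          refine hD x j (hxj.imp_right fun hxj => ⟨hxj.1, ?_⟩)
          have : ¬ ((j : ℤ) = c) := fun h => hxc ⟨hxj.1, Fin.ext (by exact_mod_cast h)⟩
          omega
    · rintro s₂ hx₂ ⟨e9, e12, hM, hQ, hD₀, hD⟩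
      refine ⟨e12, by simpa using e9, hM, hQ, hD₀, fun x j hx => hD x j ?_⟩
      have hj := j.isLt
      rw [Fin.ext_iff]
      omega
  · rintro ⟨v', M', Q', D'⟩ hx ⟨-, hM, hQ, hD₀, hD⟩
    simp only at hM hQ hD₀ hD
    subst hM hQ
    exact h v' D' hD₀ fun x j => hD x j (by exact_mod_cast x.isLt)

/-- The program that computes cyclic generators of the compressed kernel. -/
def compressedKernelProg : Prog :=
  .seq (getData false 8 0) (.seq (getData false 9 1) (.seq
    (ifPos false (.var 9) (.seq (getData false 10 (1 + .var 8))
      (.seq ordersProg (.seq kernelProg diagonalizeProg))) .skip) outputProg))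

variable (P)

theorem data_eq : P.data = ([(m : ℤ), (d : ℤ)] ++ (List.ofFn (fun i => (P.r i : ℤ)) ++
    ((List.finRange m).flatMap (fun i => List.ofFn (P.A i)) ++
    (List.ofFn P.b ++ (List.finRange d).flatMap (fun j => [(P.c j).num, ((P.c j).den : ℤ)]))))) := by
  simp [data]

theorem memOfList_data_r (i : Fin m) : memOfList P.data (2 + i) = P.r i := by
  have h : (2 + i : ℤ).toNat = 2 + i := by omega
  rw [memOfList, if_pos (by positivity), h, data_eq, List.getD_append_right _ _ _ _ (by simp),
    List.getD_append _ _ _ _ (by simp)]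
  simp

theorem memOfList_data_A (i : Fin m) (j : Fin d) :
    memOfList P.data (2 + m + i * d + j) = P.A i j := by
  have h : (2 + m + i * d + j : ℤ).toNat = 2 + (m + (i * d + j)) := by
    rw [show (2 + m + i * d + j : ℤ) = ((2 + (m + (i * d + j)) : ℕ) : ℤ) by push_cast; ring,
      Int.toNat_natCast]
  have hlt : (i : ℕ) * d + j < m * d := by
    have := i.isLt
    have := j.isLt
    nlinarith
  rw [memOfList, if_pos (by positivity), h, data_eq, List.getD_append_right _ _ _ _ (by simp)]
  simp only [List.length_cons, List.length_nil, Nat.zero_add, Nat.reduceAdd, Nat.add_sub_cancel_left]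
  rw [List.getD_append_right _ _ _ _ (by simp), List.length_ofFn, Nat.add_sub_cancel_left,
    List.getD_append _ _ _ _ (by simpa [List.length_flatMap] using hlt)]
  refine (List.getD_flatMap_of_length (fun a => List.length_ofFn) _ _ _ (by simp) j.isLt).trans ?_
  simp

/-- By the divisibility chain the last modulus is the largest, so N is read from register m + 1. -/
theorem r_last (hm : 0 < m) : P.r ⟨m - 1, by omega⟩ = P.maxModulus := by
  refine le_antisymm (Finset.le_sup (Finset.mem_univ _)) (Finset.sup_le fun i _ => ?_)
  exact Nat.le_of_dvd (P.r_pos _) (P.r_dvd _ _ (Fin.le_def.2 (by have := i.isLt; simp; omega)))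

/-- The initial state of the machine. -/
def initialState : St := ⟨fun _ => 0, 0, 0, memOfList P.data⟩

theorem represents_initialState (X : ℕ) :
    Represents false X (memOfList P.data) P.initialState := by
  have h : ∀ a < 0, memOfList P.data a = 0 := fun a ha => if_neg (by omega)
  refine ⟨fun x => h _ (cell_neg _ _ _), fun i j => h _ (matCell_neg _ _ _),
    fun i => h _ (cell_neg _ _ _), fun a _ => rfl, fun a ha => ?_⟩
  rw [h a ha]
  simp [len]

theorem fits : Fits P (2 * (m + d + Nat.size P.supNorm + Nat.size P.maxModulus + 1)) where
  m_le := by push_cast; omega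
  d_le := by push_cast; omega
  A i j := by
    have h : (P.A i j).natAbs ≤ P.supNorm :=
      (Finset.le_sup (f := fun j => (P.A i j).natAbs) (Finset.mem_univ j)).trans
        (Finset.le_sup (f := fun i => Finset.univ.sup fun j => (P.A i j).natAbs) (Finset.mem_univ i))
    have := Nat.size_le_size h
    rw [len]
    omega
  r i := by
    have h : P.r i ≤ P.maxModulus := Finset.le_sup (Finset.mem_univ i)
    have := Nat.size_le_size h
    rw [len, Int.natAbs_natCast]
    omega
  N := by
    rw [len, Int.natAbs_natCast]
    omega

variable {P}

theorem spec_compressedKernelProg (hX : Fits P X) :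
    Spec false X compressedKernelProg P.initialState fun s' =>
      ∃ M, Stage P d M ∧ s'.D 0 = d ∧ ∀ x j : Fin d, s'.D (1 + x * d + j) = M x (d + j) := by
  have hm := hX.m_le
  have hd := hX.d_le
  have h₀ : memOfList P.data 0 = m := rfl
  have h₁ : memOfList P.data 1 = d := rfl
  have g₀ : P.initialState.D ((0 : Tm).eval P.initialState) = m := h₀
  refine .seq (.getData le_rfl (by rw [g₀]; exact len_le_self (by positivity) hm) ?_)
  rw [g₀]
  refine .seq (.getData (by simp) (by
    simp only [initialState, Tm.eval_one, h₁]
    exact len_le_self (by positivity) (by omega)) ?_)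
  simp only [initialState, Tm.eval_one, h₁]
  refine .seq (.ifPos (fun hpos => ?_) fun hneg => .skip ?_)
  · simp only [Tm.eval_var, Function.update_self] at hpos
    have hd₀ : 0 < d := by exact_mod_cast hpos
    have hm₀ : 0 < m := P.m_pos ⟨0, hd₀⟩
    have h₂ : memOfList P.data (1 + m) = P.maxModulus := by
      rw [← P.r_last hm₀, ← memOfList_data_r]
      congr 1
      simp only
      omega
    refine .seq (.getData (by simp; positivity) (by simpa [h₂] using hX.N) ?_)
    have hs : ∀ M Q, Loaded P ⟨Function.update (Function.update (Function.update (fun _ => 0) 8 (m : ℤ))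
        9 (d : ℤ)) 10 (P.maxModulus : ℤ), M, Q, memOfList P.data⟩ := fun M Q =>
      ⟨by simp, by simp, by simp, P.memOfList_data_r, P.memOfList_data_A⟩
    simp only [Tm.eval_add, Tm.eval_one, Tm.eval_var, Function.update_self, ne_eq,
      Nat.reduceEqDiff, not_false_eq_true, Function.update_of_ne, h₂]
    refine .seq (spec_ordersProg hX (hs _ _) hd₀ rfl fun v₁ M₁ Q₁ hs₁ hM₁ hQ₁ => ?_)
    refine .seq (spec_kernelProg hX hs₁ hd₀ hM₁ hQ₁ fun v₂ M₂ Q₂ hs₂ hred hK hQ₂ hQ₂' => ?_)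
    refine spec_diagonalizeProg hX hs₂ hd₀ hred hK hQ₂ hQ₂' fun v₃ M₃ Q₃ hs₃ hst => ?_
    exact spec_outputProg hd hs₃.var_d fun v₄ D₄ hD₀ hD => ⟨M₃, hst, hD₀, hD⟩
  -- Without columns the ambient group is trivial and there may be no modulus to read, so the
  -- program only writes 0 as the number of generators.
  · simp only [Tm.eval_var, Function.update_self] at hneg
    have hd₀ : d = 0 := by omega
    subst hd₀
    refine spec_outputProg hd (by simp) fun v₄ D₄ hD₀ hD => ⟨0, ?_, hD₀, hD⟩
    have hsub : ∀ y : P.Ambient, y = 0 := fun y => funext fun j => j.elim0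
    refine ⟨⟨0, fun i hi => ?_, fun y _ => hsub y⟩, fun U => ⟨fun _ y _ => ?_, fun _ a ha => ?_⟩,
      fun a ha => ?_, fun i hi => ?_, fun i hi => ?_⟩
    · simp at hi
    · rw [hsub y]; exact U.zero_mem
    · simp at ha
    · simp at ha
    · simp at hi
    · simp at hi

theorem Stage.exists_generators {M : ℤ → ℤ → ℤ} (h : Stage P d M) :
    IsCyclicGenerators P.compressedKernel (fun x : Fin d => rowElt P M x) ∧
      Nonempty (P.compressedKernel ≃+
        (∀ i : Fin d, ZMod (addOrderOf (rowElt P M ((i : ℕ) : ℤ))))) := by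
  obtain ⟨E, hE, hinj⟩ := h.exists_hom
  have hmem : ∀ x : Fin d, (x : ℤ) ∈ Set.Ico (0 : ℤ) d := fun x =>
    ⟨by positivity, by exact_mod_cast x.isLt⟩
  have hinj' : ∀ y, (∀ j : Fin d, E j y = 0) → y = 0 := fun y hy => hinj y fun j hj => by
    obtain ⟨l, rfl⟩ := exists_fin_of_lt hj.1 hj.2
    exact hy l
  have hdiag : ∀ i j : Fin d, i ≠ j → E j (rowElt P M i) = 0 := fun i j hij => by
    rw [← hE i (hmem i) j (hmem j), h.zero i (hmem i) j (hmem j)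
      (fun h => hij (Fin.ext (by exact_mod_cast h))) (.inl (hmem i).2), Int.cast_zero]
  have hcl : AddSubgroup.closure (Set.range fun x : Fin d => rowElt P M x) =
      P.compressedKernel := by
    apply le_antisymm
    · rw [AddSubgroup.closure_le, Set.range_subset_iff]
      exact fun x => (h.mem_iff _).2 le_rfl x (hmem x)
    · refine (h.mem_iff _).1 fun a ha => ?_
      obtain ⟨l, rfl⟩ := exists_fin_of_lt ha.1 ha.2
      exact AddSubgroup.subset_closure ⟨l, rfl⟩
  refine ⟨⟨hcl, iSupIndep_zmultiples_of_diagonal (E := fun j : Fin d => E j) hinj' hdiag⟩, ⟨?_⟩⟩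
  have hf := sumLift_injective_of_diagonal (h := fun x : Fin d => rowElt P M x)
    (E := fun j : Fin d => E j) hinj' hdiag
  exact ((AddMonoidHom.ofInjective hf).trans
    (AddEquiv.addSubgroupCongr (range_sumLift.trans hcl))).symm

end GroupRelaxation

theorem mainTheorem9 :
    ∃ (prog : RAM.Prog) (C k : ℕ), ∀ (m d : ℕ) (P : GroupRelaxation m d),
      ∃ (t : ℕ) (τ : RAM.Mem) (v : ℕ) (h : Fin v → P.Ambient),
        RAM.Exec prog (RAM.memOfList P.data) t τ ∧
        P.Holds τ h ∧
        IsCyclicGenerators P.compressedKernel h ∧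
        Nonempty (P.compressedKernel ≃+ (∀ i : Fin v, ZMod (addOrderOf (h i)))) ∧
        t ≤ C * (m + d + Nat.size P.supNorm + Nat.size P.maxModulus + 1) ^ k := by
  obtain ⟨C, k, hC⟩ := RAM.Prog.polyBounded_timeBound GroupRelaxation.compressedKernelProg
  -- Here X = 2(x + 1), with x the sum of the size parameters, and X + 1 ≤ 3(x + 1) accounts for the
  -- factor `3 ^ k`.
  refine ⟨GroupRelaxation.compressedKernelProg, C * 3 ^ k, k, fun m d P => ?_⟩
  obtain ⟨t, τ, s', hexec, ht, hrep, M, hst, hD₀, hD⟩ :=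
    GroupRelaxation.spec_compressedKernelProg P.fits _ (P.represents_initialState _)
  obtain ⟨hgen, hiso⟩ := hst.exists_generators
  refine ⟨t, τ, d, fun x : Fin d => GroupRelaxation.rowElt P M x, hexec, ⟨?_, fun i j => ?_⟩, hgen,
    hiso, ?_⟩
  · rw [hrep.D 0 le_rfl, hD₀]
  · rw [hrep.D _ (by positivity), hD,
      (hst.red i ⟨by positivity, by exact_mod_cast i.isLt⟩).val_rowElt j]
  · refine (ht.trans (hC _)).trans ?_
    generalize m + d + Nat.size P.supNorm + Nat.size P.maxModulus = x
    rw [mul_assoc, ← mul_pow]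
    gcongr
    omega
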